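/- **Setting (non-stationary bandits with knapsacks).** There are $m$ arms, a null arm with zero reward and zero consumption, $d\ge 1$ resources, each with budget $B=bT$ ($b>0$), and a horizon $T$. An instance is a sequence of laws $\mathcal P_1,\dots,\mathcal P_T$; the outcomes $(r_t,c_t)\sim\mathcal P_t$, with rewards $r_{t,i}\in[0,1]$ and consumptions $c_{t,j,i}\in[0,1]$, are independent over $t$. A policy $\pi$ is a (possibly randomized) rule that picks the arm $i_t$ from the actions and the rewards and consumptions of the played arms at times $1,\dots,t-1$; it may depend on $m,d,T,b$, but not on the instance. Let $\tau$ be the first time with $\sum_{t\le\tau}c_{t,j,i_t}>B$ for some $j$ ($\tau=T+1$ if there is none). The regret is $\mathrm{Reg}(\pi,T)=\mathrm{OPT}(T)-\mathbb E[\sum_{t<\tau}r_{t,i_t}]$, where $\mathrm{OPT}(T)$ is the supremum of the expected collected reward over all policies, which may here be chosen with knowledge of the laws $\mathcal P_t$. Let $\mu_{t,i}=\mathbb E[r_{t,i}]$ and $C_{t,j,i}=\mathbb E[c_{t,j,i}]$, and let $\bar\mu,\bar C$ be their averages over $t$. Put $$V_1=\sum_{t=1}^{T-1}\max_i|\mu_{t,i}-\mu_{t+1,i}|,\qquad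 V_2=\max_j\sum_{t=1}^{T-1}\max_i|C_{t,j,i}-C_{t+1,j,i}|,$$ $$W_1=\sum_{t=1}^{T}\max_i|\mu_{t,i}-\bar\mu_i|,\qquad W_2=\sum_{t=1}^{T}\max_i\sum_j|C_{t,j,i}-\bar C_{j,i}|.$$ Let $\bar q$ be the largest value of $\|q\|_\infty$ over all optimal solutions $(q,\alpha)$ of the dual linear program $$\min_{q\ge0,\ \alpha\ge 0}\ Tb\sum_j q_j+\sum_{t=1}^T\alpha_t\quad\text{s.t.}\quad \mu_{t,i}-\sum_jC_{t,j,i}q_j\le\alpha_t\ \text{ for all } t,i,$$ and of its single-period versions ($\mathrm{LP}(\mu_t,C_t)$ with budget $b$, for $t=1,\dots,T$). **Theorem (regret lower bounds).** (i) There are universal constants $c,\kappa>0$ such that for all $m\ge2$, $d\ge1$, $T\ge2$, $b>0$, all $0<V\le\kappa T/m$ and every policy $\pi$ there is an instance with $V_1=V$ and $W_2=0$ for which $$\mathrm{Reg}(\pi,T)\ \ge\ c\,m^{1/3}V_1^{1/3}T^{2/3}.$$ (ii) For every $b_0<1$ there are constants $c,\kappa>0$ such that for all $m,d,T\ge1$,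 $0<b\le b_0$, all $V$ with $\sqrt{m/T}\le V\le\kappa b^3T/m$ and every policy $\pi$ there is an instance with $V_2=V$ and $W_1=0$ for which $$\mathrm{Reg}(\pi,T)\ \ge\ c\cdot\frac1b\,m^{1/3}V_2^{1/3}T^{2/3}.$$ (iii) For every $b_0<1$ there are constants $c,\kappa,K>0$ such that for all $m,d,T\ge1$, $0<b\le b_0$, all $q\in(0,\kappa/b]$, $w_1\in[0,\kappa qbT]$, $w_2\in[0,\kappa bT]$ with $w_1+qw_2\ge Kqb$, there are two instances such that: both have constant laws on the first half $t\le\lfloor T/2\rfloor$ and on the second half $t>\lfloor T/2\rfloor$; they coincide on the first half; in the second half all arms become at least as good in the one (expected rewards do not decrease, expected consumptions do not increase) and at most as good in the other; both have $W_1=w_1$, $W_2=w_2$ and $q\le\bar q\le2q$; and every policy $\pi$ satisfies $$\mathrm{Reg}(\pi,T)\ \ge\ c\,(W_1+\bar qW_2)$$ on at least one of the two. -/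

import Mathlib

open MeasureTheory

noncomputable section

namespace BwK

/-- The outcome of one period: the reward `o.1 i` of every arm `i`, and the consumption `o.2 j i`
of every resource `j` by every arm `i`. -/
abbrev Outcome (m d : ℕ) : Type := (Fin m → ℝ) × (Fin d → Fin m → ℝ)

/-- An action: `some i` plays the arm `i`, and `none` is the null arm (do nothing). -/
def Action (m : ℕ) : Type := Option (Fin m)

instance (m : ℕ) : MeasurableSpace (Action m) := ⊤

/-- The reward that an action collects; the null arm has reward zero. -/
def gain {m d : ℕ} (o : Outcome m d) (a : Action m) : ℝ :=
  Option.elim a 0 (fun i => o.1 i)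

/-- The amount of resource `j` that an action consumes; the null arm consumes nothing. -/
def cost {m d : ℕ} (o : Outcome m d) (a : Action m) (j : Fin d) : ℝ :=
  Option.elim a 0 (fun i => o.2 j i)

/-- What the learner sees of one period (bandit feedback): the action taken, its reward and
its consumption of every resource. -/
abbrev Observation (m d : ℕ) : Type := Action m × ℝ × (Fin d → ℝ)

def observe {m d : ℕ} (o : Outcome m d) (a : Action m) : Observation m d :=
  (a, gain o a, fun j => cost o a j)

/-- A randomized non-anticipating policy: it draws a private random seed and then picks every action
as a measurable function of the seed and of the observations from the earlier periods.
Periods are numbered from `0`. -/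
structure Policy (m d : ℕ) where
  Seed : Type
  [measurableSpaceSeed : MeasurableSpace Seed]
  seedLaw : Measure Seed
  [isProbabilityMeasure_seedLaw : IsProbabilityMeasure seedLaw]
  act : (t : ℕ) → Seed → (Fin t → Observation m d) → Action m
  measurable_act : ∀ t, Measurable (fun p : Seed × (Fin t → Observation m d) => act t p.1 p.2)

attribute [instance] Policy.measurableSpaceSeed Policy.isProbabilityMeasure_seedLaw

/-- An environment with `m` arms (besides the null arm), `d` resources and horizon `T`: the laws
of the outcomes of the `T` periods, with rewards and consumptions in `[0,1]`. The outcomes of different periods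
are independent, see `Policy.value`. -/
structure Instance (m d T : ℕ) where
  law : Fin T → Measure (Outcome m d)
  isProbabilityMeasure_law : ∀ t, IsProbabilityMeasure (law t)
  reward_mem : ∀ t, ∀ᵐ o ∂(law t), ∀ i, o.1 i ∈ Set.Icc (0 : ℝ) 1
  consumption_mem : ∀ t, ∀ᵐ o ∂(law t), ∀ j i, o.2 j i ∈ Set.Icc (0 : ℝ) 1

namespace Policy

variable {m d T : ℕ}

/-- The observations of the first `t` periods, for a given seed and given outcomes. -/
def history (π : Policy m d) (s : π.Seed) (ω : Fin T → Outcome m d) :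
    (t : ℕ) → t ≤ T → (Fin t → Observation m d)
  | 0, _ => Fin.elim0
  | t + 1, h =>
      Fin.snoc (π.history s ω t (Nat.le_of_succ_le h))
        (observe (ω ⟨t, h⟩) (π.act t s (π.history s ω t (Nat.le_of_succ_le h))))

/-- The action in period `t`. -/
def action (π : Policy m d) (s : π.Seed) (ω : Fin T → Outcome m d) (t : Fin T) : Action m :=
  π.act t s (π.history s ω t t.isLt.le)

/-- No resource has been used beyond the budget `B` up to and including period `t`. -/
def WithinBudget (π : Policy m d) (B : ℝ) (s : π.Seed) (ω : Fin T → Outcome m d) (t : Fin T) :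
    Prop :=
  ∀ j, ∑ u ∈ Finset.Iic t, cost (ω u) (π.action s ω u) j ≤ B

open Classical in
/-- The reward collected before the first period in which a budget is violated (the reward of
that period is lost), or up to the horizon if this does not happen. -/
def collected (π : Policy m d) (B : ℝ) (s : π.Seed) (ω : Fin T → Outcome m d) : ℝ :=
  ∑ t, if π.WithinBudget B s ω t then gain (ω t) (π.action s ω t) else 0

/-- The expected collected reward in the environment `I`, with budget `B` of every resource. -/
def value (π : Policy m d) (I : Instance m d T) (B : ℝ) : ℝ :=
  haveI := I.isProbabilityMeasure_law
  ∫ p, π.collected B p.1 p.2 ∂(π.seedLaw.prod (Measure.pi I.law))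

end Policy

/-- A feasible point `(q, α)` of the dual of the linear program with expected rewards `μ` and
expected consumptions `C` over `S` periods. The last condition is the constraint of the null
arm, whose reward and consumption vanish. -/
def DualFeasible {m d S : ℕ} (μ : Fin S → Fin m → ℝ) (C : Fin S → Fin d → Fin m → ℝ)
    (q : Fin d → ℝ) (α : Fin S → ℝ) : Prop :=
  (∀ j, 0 ≤ q j) ∧ (∀ t i, μ t i - ∑ j, C t j i * q j - α t ≤ 0) ∧ ∀ t, 0 ≤ α t

/-- The objective of the dual linear program, with budget `b * S` of every resource. -/
def dualObjective {d S : ℕ} (b : ℝ) (q : Fin d → ℝ) (α : Fin S → ℝ) : ℝ :=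
  S * ∑ j, b * q j + ∑ t, α t

/-- `q` is the price vector of an optimal solution of the dual linear program. -/
def IsDualPrice {m d S : ℕ} (b : ℝ) (μ : Fin S → Fin m → ℝ) (C : Fin S → Fin d → Fin m → ℝ)
    (q : Fin d → ℝ) : Prop :=
  ∃ α, DualFeasible μ C q α ∧
    ∀ q' α', DualFeasible μ C q' α' → dualObjective b q α ≤ dualObjective b q' α'

namespace Instance

variable {m d T : ℕ}

/-- The expected reward vectors. -/
def μ (I : Instance m d T) (t : Fin T) (i : Fin m) : ℝ := ∫ o, o.1 i ∂(I.law t)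

/-- The expected consumption matrices. -/
def C (I : Instance m d T) (t : Fin T) (j : Fin d) (i : Fin m) : ℝ := ∫ o, o.2 j i ∂(I.law t)

/-- The optimal expected reward of a policy that may be designed with knowledge of the laws. -/
def opt (I : Instance m d T) (B : ℝ) : ℝ := ⨆ π : Policy m d, π.value I B

def regret (I : Instance m d T) (B : ℝ) (π : Policy m d) : ℝ := I.opt B - π.value I B

/-- Local variation of the expected rewards; the norm of `Fin m → ℝ` is the maximum norm. -/
def V₁ (I : Instance m d T) : ℝ :=
  ∑ t : Fin (T - 1), ‖I.μ ⟨t, by omega⟩ - I.μ ⟨t + 1, by omega⟩‖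

/-- Local variation of the expected consumption, maximized over the resources. -/
def V₂ (I : Instance m d T) : ℝ :=
  ⨆ j : Fin d, ∑ t : Fin (T - 1), ‖I.C ⟨t, by omega⟩ j - I.C ⟨t + 1, by omega⟩ j‖

def meanμ (I : Instance m d T) (i : Fin m) : ℝ := (1 / (T : ℝ)) * ∑ t, I.μ t i

def meanC (I : Instance m d T) (j : Fin d) (i : Fin m) : ℝ := (1 / (T : ℝ)) * ∑ t, I.C t j i

/-- Global variation of the expected rewards. -/
def W₁ (I : Instance m d T) : ℝ := ∑ t, ‖I.μ t - I.meanμ‖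

/-- Global variation of the expected consumption, in the operator norm of matrices for the
`1`-norm (the largest column sum; columns are arms). -/
def W₂ (I : Instance m d T) : ℝ := ∑ t, ⨆ i : Fin m, ∑ j, |I.C t j i - I.meanC j i|

/-- The largest dual price: the largest maximum norm of an optimal price vector of the dual of
the benchmark linear program or of one of the single-period linear programs. -/
def qbar (I : Instance m d T) (b : ℝ) : ℝ :=
  sSup {v : ℝ | ∃ q : Fin d → ℝ, v = ‖q‖ ∧
    (IsDualPrice b I.μ I.C q ∨
      ∃ t, IsDualPrice b (fun _ : Fin 1 => I.μ t) (fun _ : Fin 1 => I.C t) q)}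

/-- The laws are constant on each of the two halves of the horizon. -/
def IsTwoPhase (I : Instance m d T) : Prop :=
  ∀ s t : Fin T, (s.val < T / 2 ↔ t.val < T / 2) → I.law s = I.law t

/-- In the second half the arms are at least as good as in the first half: rewards do not
decrease and consumptions do not increase. -/
def SecondHalfBetter (I : Instance m d T) : Prop :=
  ∀ s t : Fin T, s.val < T / 2 → T / 2 ≤ t.val →
    (∀ i, I.μ s i ≤ I.μ t i) ∧ ∀ j i, I.C t j i ≤ I.C s j i

/-- In the second half the arms are at most as good as in the first half. -/
def SecondHalfWorse (I : Instance m d T) : Prop :=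
  ∀ s t : Fin T, s.val < T / 2 → T / 2 ≤ t.val →
    (∀ i, I.μ t i ≤ I.μ s i) ∧ ∀ j i, I.C s j i ≤ I.C t j i

end Instance

end BwK

end

/-! Parts (ii) and (iii) need no statistics. In a deterministic environment whose consumption `l *
b` per play exceeds the budget rate `b`, the total budget does not suffice for playing always. Two
environments agree on the first half and then improve or deteriorate. In the improving one the
budget should be saved for the second half, in the deteriorating one it should be spent at once. A
policy makes the same number `N` of first-half plays in both. Each play by which `N` exceeds the
optimum of the first, or falls short of the optimum of the second, costs at least a fixed amount
`g`; these losses add up to a quantity free of `N` (`two_phase_gap`). Hence the two regrets sum to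
order (jump of the reward + price × jump of the consumption) × `T`, up to rounding
(`half_switch_regret`). For (iii) the jumps are tuned to give the prescribed `W₁` and `W₂`, and the
ratio of reward to consumption controls the dual prices. For (ii) only the consumption jumps, and
variation that does not fit into the jump is used up by a small oscillation in the first half. The
resulting regret, linear in `T`, dominates the claimed rate in the stated range of `V`.

Part (i) is a bandit lower bound without consumption. The horizon is cut into blocks; in each block
one special arm has mean `1 / 2 + ε` and the others `1 / 2`, with `ε` at most of order `√(m / L)`
for block length `L`, so that a block carries too little information to find the arm. A change of
measure on histories (`playProb_raised_le`) shows that some arm, once made special, is missed a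
constant fraction of the block (`exists_rarely_played`). Past plays do not depend on future laws, so
the special arms can be fixed block by block for the given policy (`exists_special_arms`). Balancing
block number against `ε` under the constraint `V₁ = V` gives the rate `m^(1/3) V^(1/3) T^(2/3)`.
When `V` is too small for several blocks, a single block is used. -/

noncomputable section

namespace BwK

variable {m d T : ℕ}

/-! ### Measurability and elementary properties of policies. -/

instance : DecidableEq (Action m) := inferInstanceAs (DecidableEq (Option (Fin m)))

instance : Countable (Action m) := inferInstanceAs (Countable (Option (Fin m)))

instance : DiscreteMeasurableSpace (Action m) := ⟨fun _ => trivial⟩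

/-- The null arm. -/
def idle : Action m := none

/-- The action that plays the arm `i`. -/
def pull (i : Fin m) : Action m := some i

theorem pull_ne_idle (i : Fin m) : pull i ≠ idle := Option.some_ne_none i

theorem pull_injective : Function.Injective (pull : Fin m → Action m) :=
  Option.some_injective _

theorem eq_idle_or_pull (a : Action m) : a = idle ∨ ∃ i, a = pull i := by
  rcases h : (a : Option (Fin m)) with _ | i
  exacts [Or.inl rfl, Or.inr ⟨i, rfl⟩]

@[simp] theorem gain_idle (o : Outcome m d) : gain o idle = 0 := rfl

@[simp] theorem gain_pull (o : Outcome m d) (i : Fin m) : gain o (pull i) = o.1 i := rfl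

@[simp] theorem cost_idle (o : Outcome m d) (j : Fin d) : cost o idle j = 0 := rfl

@[simp] theorem cost_pull (o : Outcome m d) (i : Fin m) (j : Fin d) :
    cost o (pull i) j = o.2 j i := rfl

theorem measurable_gain : Measurable (fun p : Outcome m d × Action m => gain p.1 p.2) := by
  refine measurable_from_prod_countable_left fun a => ?_
  rcases eq_idle_or_pull a with rfl | ⟨i, rfl⟩
  · exact measurable_const
  · exact (measurable_pi_apply i).comp measurable_fst

theorem measurable_cost (j : Fin d) :
    Measurable (fun p : Outcome m d × Action m => cost p.1 p.2 j) := by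
  refine measurable_from_prod_countable_left fun a => ?_
  rcases eq_idle_or_pull a with rfl | ⟨i, rfl⟩
  · exact measurable_const
  · exact (measurable_pi_apply i).comp ((measurable_pi_apply j).comp measurable_snd)

theorem measurable_observe :
    Measurable (fun p : Outcome m d × Action m => observe p.1 p.2) :=
  measurable_snd.prodMk (measurable_gain.prodMk (measurable_pi_lambda _ measurable_cost))

theorem measurable_snoc {α X : Type*} [MeasurableSpace α] [MeasurableSpace X] {t : ℕ}
    {f : α → Fin t → X} {g : α → X} (hf : Measurable f) (hg : Measurable g) :
    Measurable (fun a => (Fin.snoc (f a) (g a) : Fin (t + 1) → X)) := by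
  refine measurable_pi_lambda _ fun i => ?_
  refine Fin.lastCases ?_ (fun i => ?_) i
  · simpa using hg
  · simpa using measurable_pi_iff.1 hf i

namespace Policy

theorem measurable_history (π : Policy m d) (t : ℕ) (h : t ≤ T) :
    Measurable (fun p : π.Seed × (Fin T → Outcome m d) => π.history p.1 p.2 t h) := by
  induction t with
  | zero => exact measurable_const
  | succ t ih =>
    have ih := ih (Nat.le_of_succ_le h)
    have ha : Measurable (fun p : π.Seed × (Fin T → Outcome m d) =>
        π.act t p.1 (π.history p.1 p.2 t (Nat.le_of_succ_le h))) :=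
      (π.measurable_act t).comp (measurable_fst.prodMk ih)
    exact measurable_snoc ih (measurable_observe.comp
      (((measurable_pi_apply (⟨t, h⟩ : Fin T)).comp measurable_snd).prodMk ha))

theorem measurable_action (π : Policy m d) (t : Fin T) :
    Measurable (fun p : π.Seed × (Fin T → Outcome m d) => π.action p.1 p.2 t) :=
  (π.measurable_act t).comp (measurable_fst.prodMk (π.measurable_history t t.isLt.le))

theorem measurableSet_withinBudget (π : Policy m d) (B : ℝ) (t : Fin T) :
    MeasurableSet {p : π.Seed × (Fin T → Outcome m d) | π.WithinBudget B p.1 p.2 t} := by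
  unfold WithinBudget
  rw [Set.ofPred_forall]
  refine MeasurableSet.iInter fun j => measurableSet_le ?_ measurable_const
  exact Finset.measurable_sum _ fun u _ => (measurable_cost j).comp
    (((measurable_pi_apply u).comp measurable_snd).prodMk (π.measurable_action u))

theorem measurable_gain_action (π : Policy m d) (t : Fin T) :
    Measurable (fun p : π.Seed × (Fin T → Outcome m d) => gain (p.2 t) (π.action p.1 p.2 t)) :=
  measurable_gain.comp (((measurable_pi_apply t).comp measurable_snd).prodMk (π.measurable_action t))

theorem measurable_collected (π : Policy m d) (B : ℝ) :
    Measurable (fun p : π.Seed × (Fin T → Outcome m d) => π.collected B p.1 p.2) := by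
  classical
  unfold collected
  exact Finset.measurable_sum _ fun t _ => Measurable.ite (π.measurableSet_withinBudget B t)
    (π.measurable_gain_action t) measurable_const

/-- The joint law of the seed and of the outcomes. -/
def jointLaw (π : Policy m d) (I : Instance m d T) : Measure (π.Seed × (Fin T → Outcome m d)) :=
  haveI := I.isProbabilityMeasure_law
  π.seedLaw.prod (Measure.pi I.law)

instance (π : Policy m d) (I : Instance m d T) : IsProbabilityMeasure (π.jointLaw I) := by
  have := I.isProbabilityMeasure_law
  unfold jointLaw
  infer_instance

theorem value_eq (π : Policy m d) (I : Instance m d T) (B : ℝ) :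
    π.value I B = ∫ p, π.collected B p.1 p.2 ∂(π.jointLaw I) := rfl

theorem ae_jointLaw (π : Policy m d) (I : Instance m d T) {P : Fin T → Outcome m d → Prop}
    (h : ∀ t, ∀ᵐ o ∂(I.law t), P t o) : ∀ᵐ p ∂(π.jointLaw I), ∀ t, P t (p.2 t) := by
  have := I.isProbabilityMeasure_law
  rw [ae_all_iff]
  intro t
  have h1 : ∀ᵐ ω ∂(Measure.pi I.law), P t (ω t) :=
    (Measure.quasiMeasurePreserving_eval I.law t).ae (h t)
  exact Measure.quasiMeasurePreserving_snd.ae h1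

theorem gain_mem {o : Outcome m d} (h : ∀ i, o.1 i ∈ Set.Icc (0 : ℝ) 1) (a : Action m) :
    gain o a ∈ Set.Icc (0 : ℝ) 1 := by
  rcases eq_idle_or_pull a with rfl | ⟨i, rfl⟩
  · simp
  · exact h i

theorem collected_mem (π : Policy m d) (B : ℝ) (s : π.Seed) {ω : Fin T → Outcome m d}
    (h : ∀ t i, (ω t).1 i ∈ Set.Icc (0 : ℝ) 1) : π.collected B s ω ∈ Set.Icc (0 : ℝ) T := by
  have h1 := fun t => gain_mem (h t) (π.action s ω t)
  constructor
  · refine Finset.sum_nonneg fun t _ => ?_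
    split_ifs
    exacts [(h1 t).1, le_rfl]
  · calc π.collected B s ω ≤ ∑ _t : Fin T, (1 : ℝ) := by
          refine Finset.sum_le_sum fun t _ => ?_
          split_ifs
          exacts [(h1 t).2, zero_le_one]
      _ = T := by simp

theorem integrable_collected (π : Policy m d) (I : Instance m d T) (B : ℝ) :
    Integrable (fun p => π.collected B p.1 p.2) (π.jointLaw I) := by
  refine Integrable.of_bound (π.measurable_collected B).aestronglyMeasurable (T : ℝ) ?_
  filter_upwards [π.ae_jointLaw I I.reward_mem] with p hp
  have := π.collected_mem B p.1 hp
  rw [Real.norm_of_nonneg this.1]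
  exact this.2

theorem value_le (π : Policy m d) (I : Instance m d T) (B : ℝ) : π.value I B ≤ T := by
  rw [value_eq]
  calc _ ≤ ∫ _p, (T : ℝ) ∂(π.jointLaw I) := by
        refine integral_mono_ae (π.integrable_collected I B) (integrable_const _) ?_
        filter_upwards [π.ae_jointLaw I I.reward_mem] with p hp
        exact (π.collected_mem B p.1 hp).2
    _ = T := by simp

theorem value_le_opt (π : Policy m d) (I : Instance m d T) (B : ℝ) : π.value I B ≤ I.opt B :=
  le_ciSup (f := fun π : Policy m d => π.value I B)
    ⟨(T : ℝ), by rintro _ ⟨π, rfl⟩; exact π.value_le I B⟩ π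

/-- The policy that plays a prescribed sequence of actions. -/
def schedule (a : ℕ → Action m) : Policy m d where
  Seed := Unit
  seedLaw := Measure.dirac ()
  act t _ _ := a t
  measurable_act _ := measurable_const

/-- The actions up to time `t` depend only on the outcomes of the earlier periods. -/
theorem history_congr (π : Policy m d) (s : π.Seed) {ω ω' : Fin T → Outcome m d} (t : ℕ)
    (h : t ≤ T) (hω : ∀ u : Fin T, u.val < t → ω u = ω' u) :
    π.history s ω t h = π.history s ω' t h := by
  induction t with
  | zero => rfl
  | succ t ih =>
    have h1 := ih (Nat.le_of_succ_le h) fun u hu => hω u (by omega)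
    simp only [history]
    rw [h1, hω ⟨t, h⟩ (by simp)]

theorem action_congr (π : Policy m d) (s : π.Seed) {ω ω' : Fin T → Outcome m d} (t : Fin T)
    (hω : ∀ u, u < t → ω u = ω' u) : π.action s ω t = π.action s ω' t := by
  unfold action
  rw [π.history_congr s t t.isLt.le fun u hu => hω u hu]

end Policy

/-! ### Deterministic environments with two phases, and the conflict between saving and spending. -/

/-- An outcome in which all arms have the reward `r` and consume `c` of the resource `0`. -/
def uniformOutcome (m d : ℕ) (r c : ℝ) : Outcome m d :=
  (fun _ => r, fun j _ => if j.val = 0 then c else 0)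

theorem uniformOutcome_cost_mem {c : ℝ} (hc : c ∈ Set.Icc (0 : ℝ) 1) (j : Fin d) :
    (if j.val = 0 then c else 0) ∈ Set.Icc (0 : ℝ) 1 := by
  split_ifs
  exacts [hc, ⟨le_rfl, zero_le_one⟩]

/-- The instance with deterministic rewards `r t` and consumptions `c t` of the resource `0`. -/
def detInstance (m d T : ℕ) (r c : ℕ → ℝ) (hr : ∀ t, r t ∈ Set.Icc (0 : ℝ) 1)
    (hc : ∀ t, c t ∈ Set.Icc (0 : ℝ) 1) : Instance m d T where
  law t := Measure.dirac (uniformOutcome m d (r t) (c t))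
  isProbabilityMeasure_law _ := inferInstance
  reward_mem t := by
    rw [ae_dirac_eq]
    exact fun _ => hr t
  consumption_mem t := by
    rw [ae_dirac_eq]
    exact fun j _ => uniformOutcome_cost_mem (hc t) j

section Det

variable {r c : ℕ → ℝ} (hr : ∀ t, r t ∈ Set.Icc (0 : ℝ) 1) (hc : ∀ t, c t ∈ Set.Icc (0 : ℝ) 1)

theorem detInstance_μ (t : Fin T) : (detInstance m d T r c hr hc).μ t = fun _ => r t := by
  ext i
  simp [Instance.μ, detInstance, uniformOutcome]

theorem detInstance_C (t : Fin T) :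
    (detInstance m d T r c hr hc).C t = fun j _ => if j.val = 0 then c t else 0 := by
  ext j i
  simp [Instance.C, detInstance, uniformOutcome]

theorem det_value (π : Policy m d) (B : ℝ) :
    π.value (detInstance m d T r c hr hc) B
      = ∫ s, π.collected B s (fun t : Fin T => uniformOutcome m d (r t) (c t)) ∂π.seedLaw := by
  set I := detInstance m d T r c hr hc
  have := I.isProbabilityMeasure_law
  have h1 : ∀ᵐ p ∂(π.jointLaw I), p.2 = fun t : Fin T => uniformOutcome m d (r t) (c t) := by
    have := π.ae_jointLaw I (P := fun t o => o = uniformOutcome m d (r t) (c t))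
      (fun t => by simp [I, detInstance, ae_dirac_eq])
    filter_upwards [this] with p hp
    exact funext hp
  rw [Policy.value_eq]
  have h2 : (fun p : π.Seed × (Fin T → Outcome m d) => π.collected B p.1 p.2) =ᵐ[π.jointLaw I]
      fun p => π.collected B p.1 (fun t : Fin T => uniformOutcome m d (r t) (c t)) := by
    filter_upwards [h1] with p hp
    rw [hp]
  rw [integral_congr_ae h2]
  unfold Policy.jointLaw
  rw [integral_fun_fst (fun s => π.collected B s (fun t : Fin T => uniformOutcome m d (r t) (c t)))]
  simp

include hr in
theorem det_integrable (π : Policy m d) (B : ℝ) :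
    Integrable (fun s => π.collected B s
      (fun t : Fin T => uniformOutcome m d (r t) (c t))) π.seedLaw := by
  refine Integrable.of_bound ((π.measurable_collected B).comp
    (measurable_id.prodMk measurable_const)).aestronglyMeasurable (T : ℝ) (ae_of_all _ fun s => ?_)
  have := π.collected_mem B s (ω := fun t : Fin T => uniformOutcome m d (r t) (c t))
    (fun t _ => hr t)
  rw [Real.norm_of_nonneg this.1]
  exact this.2

end Det

theorem gain_uniformOutcome (r c : ℝ) (a : Action m) :
    gain (uniformOutcome m d r c) a = if a = idle then 0 else r := by
  rcases eq_idle_or_pull a with rfl | ⟨i, rfl⟩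
  · simp
  · simp [uniformOutcome, pull_ne_idle]

theorem cost_uniformOutcome (r c : ℝ) (a : Action m) (j : Fin d) :
    cost (uniformOutcome m d r c) a j = if a ≠ idle ∧ j.val = 0 then c else 0 := by
  rcases eq_idle_or_pull a with rfl | ⟨i, rfl⟩
  · simp
  · simp [uniformOutcome, pull_ne_idle]

namespace Policy

open Classical in
/-- The periods in which an arm is played within the budget. -/
def played (π : Policy m d) (B : ℝ) (s : π.Seed) (ω : Fin T → Outcome m d) : Finset (Fin T) :=
  Finset.univ.filter fun t => π.WithinBudget B s ω t ∧ π.action s ω t ≠ idle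

theorem collected_uniformOutcome (π : Policy m d) (B : ℝ) (s : π.Seed) (r c : ℕ → ℝ) :
    π.collected B s (fun t : Fin T => uniformOutcome m d (r t) (c t))
      = ∑ t ∈ π.played B s (fun t : Fin T => uniformOutcome m d (r t) (c t)), r t := by
  classical
  unfold collected played
  rw [Finset.sum_filter]
  refine Finset.sum_congr rfl fun t _ => ?_
  rw [gain_uniformOutcome]
  split_ifs <;> simp_all

/-- The budget condition at the last period of `played` already charges every earlier member of this
set. -/
theorem played_cost_le (π : Policy m d) (hd : 1 ≤ d) {B : ℝ} (hB : 0 ≤ B) (s : π.Seed)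
    (r : ℕ → ℝ) {c : ℕ → ℝ} (hc : ∀ t, 0 ≤ c t) :
    ∑ t ∈ π.played B s (fun t : Fin T => uniformOutcome m d (r t) (c t)), c t ≤ B := by
  classical
  set ω := fun t : Fin T => uniformOutcome m d (r t) (c t) with hω
  rcases (π.played B s ω).eq_empty_or_nonempty with h | h
  · simpa [h] using hB
  · set t₀ := (π.played B s ω).max' h
    have h0 : t₀ ∈ π.played B s ω := Finset.max'_mem _ h
    have hw : π.WithinBudget B s ω t₀ := (Finset.mem_filter.1 h0).2.1
    refine le_trans ?_ (hw ⟨0, hd⟩)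
    have h1 : ∀ u ∈ π.played B s ω, c u = cost (ω u) (π.action s ω u) ⟨0, hd⟩ := by
      intro u hu
      rw [hω, cost_uniformOutcome, if_pos ⟨(Finset.mem_filter.1 hu).2.2, rfl⟩]
    rw [Finset.sum_congr rfl h1]
    refine Finset.sum_le_sum_of_subset_of_nonneg (fun u hu => ?_) fun u _ _ => ?_
    · exact Finset.mem_Iic.2 (Finset.le_max' _ u hu)
    · rw [hω, cost_uniformOutcome]
      split_ifs
      exacts [hc u, le_rfl]

/-- Causality: environments that agree up to `h` cannot be told apart before `h`. This forces a
common number of first-phase plays on both environments. -/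
theorem played_congr (π : Policy m d) (B : ℝ) (s : π.Seed) {ω ω' : Fin T → Outcome m d} {h : ℕ}
    (hω : ∀ u : Fin T, u.val < h → ω u = ω' u) :
    (π.played B s ω).filter (fun t => t.val < h) = (π.played B s ω').filter (fun t => t.val < h) := by
  classical
  have ha : ∀ t : Fin T, t.val < h → π.action s ω t = π.action s ω' t := fun t ht =>
    π.action_congr s t fun u hu => hω u (lt_trans hu ht)
  have hw : ∀ t : Fin T, t.val < h → (π.WithinBudget B s ω t ↔ π.WithinBudget B s ω' t) := by
    intro t ht
    unfold WithinBudget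
    refine forall_congr' fun j => ?_
    rw [Finset.sum_congr rfl fun u hu => ?_]
    have hu' : u.val < h := lt_of_le_of_lt (Fin.le_def.1 (Finset.mem_Iic.1 hu)) ht
    rw [ha u hu', hω u hu']
  ext t
  simp only [played, Finset.mem_filter, Finset.mem_univ, true_and]
  constructor
  · rintro ⟨⟨h1, h2⟩, h3⟩
    exact ⟨⟨(hw t h3).1 h1, by rwa [← ha t h3]⟩, h3⟩
  · rintro ⟨⟨h1, h2⟩, h3⟩
    exact ⟨⟨(hw t h3).2 h1, by rwa [ha t h3]⟩, h3⟩

end Policy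

/-- A sequence that follows `x` before the time `h` and is equal to `y` from then on. -/
def phase (h : ℕ) (x : ℕ → ℝ) (y : ℝ) (t : ℕ) : ℝ := if t < h then x t else y

theorem phase_of_lt {h : ℕ} (x : ℕ → ℝ) (y : ℝ) {t : ℕ} (ht : t < h) : phase h x y t = x t :=
  if_pos ht

theorem phase_of_le {h : ℕ} (x : ℕ → ℝ) (y : ℝ) {t : ℕ} (ht : h ≤ t) : phase h x y t = y :=
  if_neg (not_lt.2 ht)

theorem phase_mem {h : ℕ} {x : ℕ → ℝ} {y : ℝ} {s : Set ℝ} (hx : ∀ t, x t ∈ s) (hy : y ∈ s)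
    (t : ℕ) : phase h x y t ∈ s := by
  unfold phase
  split_ifs
  exacts [hx t, hy]

theorem card_filter_lt_le (s : Finset (Fin T)) (h : ℕ) :
    (s.filter fun t => t.val < h).card ≤ h := by
  calc (s.filter fun t => t.val < h).card ≤ (Finset.range h).card :=
        Finset.card_le_card_of_injOn Fin.val
          (fun t ht => Finset.mem_coe.2 (Finset.mem_range.2 (Finset.mem_filter.1 ht).2))
          Fin.val_injective.injOn
    _ = h := Finset.card_range h

theorem card_filter_not_lt_le (s : Finset (Fin T)) (h : ℕ) :
    (s.filter fun t => ¬ t.val < h).card ≤ T - h := by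
  calc (s.filter fun t => ¬ t.val < h).card ≤ (Finset.Ico h T).card :=
        Finset.card_le_card_of_injOn Fin.val
          (fun t ht => Finset.mem_coe.2 (Finset.mem_Ico.2
            ⟨not_lt.1 (Finset.mem_filter.1 ht).2, t.isLt⟩))
          Fin.val_injective.injOn
    _ = T - h := Nat.card_Ico h T

theorem sum_filter_phase (s : Finset (Fin T)) (h : ℕ) (x y : ℝ) :
    ∑ t ∈ s, phase h (fun _ => x) y t
      = (s.filter fun t => t.val < h).card * x + (s.filter fun t => ¬ t.val < h).card * y := by
  rw [← Finset.sum_filter_add_sum_filter_not s (fun t => t.val < h)]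
  congr 1
  · rw [Finset.sum_congr rfl fun t ht => phase_of_lt _ _ (Finset.mem_filter.1 ht).2]
    simp
  · rw [Finset.sum_congr rfl fun t ht => phase_of_le _ _ (not_lt.1 (Finset.mem_filter.1 ht).2)]
    simp

/-- Every policy collects in a two-phase deterministic environment what `n` plays in the first
phase and `k` plays in the second phase yield, for some `n` and `k` that respect the budget. -/
theorem Policy.collected_phase (π : Policy m d) (hd : 1 ≤ d) {B : ℝ} (hB : 0 ≤ B) (s : π.Seed)
    (h : ℕ) {r₁ r₂ c₁ c₂ : ℝ} {c : ℕ → ℝ} (hc₁ : 0 ≤ c₁) (hc : ∀ t, c₁ ≤ c t) (hc₂ : 0 ≤ c₂) :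
    ∃ k : ℕ, k ≤ T - h ∧
      ((((π.played B s (fun t : Fin T => uniformOutcome m d (phase h (fun _ => r₁) r₂ t)
        (phase h c c₂ t))).filter fun t => t.val < h).card : ℝ) * c₁ + k * c₂ ≤ B) ∧
      π.collected B s (fun t : Fin T => uniformOutcome m d (phase h (fun _ => r₁) r₂ t)
        (phase h c c₂ t)) =
        ((π.played B s (fun t : Fin T => uniformOutcome m d (phase h (fun _ => r₁) r₂ t)
        (phase h c c₂ t))).filter fun t => t.val < h).card * r₁ + k * r₂ := by
  set A := π.played B s (fun t : Fin T => uniformOutcome m d (phase h (fun _ => r₁) r₂ t)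
        (phase h c c₂ t)) with hA
  -- Only the second-phase count is hidden behind the existential. The first-phase count stays
  -- explicit, so that `two_phase_regret` can identify it across two environments.
  refine ⟨(A.filter fun t => ¬ t.val < h).card, card_filter_not_lt_le _ _, ?_, ?_⟩
  · rw [← sum_filter_phase]
    refine le_trans (Finset.sum_le_sum fun t _ => ?_) (π.played_cost_le (T := T) hd hB s
      (phase h (fun _ => r₁) r₂) (c := phase h c c₂) fun t => ?_)
    · unfold phase
      split_ifs
      exacts [hc t, le_rfl]
    · unfold phase
      split_ifs
      exacts [hc₁.trans (hc t), hc₂]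
  · rw [π.collected_uniformOutcome, ← hA, sum_filter_phase]

theorem sum_fin_two_blocks (h n k : ℕ) (hn : n ≤ h) (hh : h ≤ T) (hk : k ≤ T - h) (x y : ℝ) :
    ∑ t : Fin T, (if t.val < n ∨ (h ≤ t.val ∧ t.val < h + k) then phase h (fun _ => x) y t else 0)
      = n * x + k * y := by
  rw [Fin.sum_univ_eq_sum_range (fun t => if t < n ∨ (h ≤ t ∧ t < h + k) then
    phase h (fun _ => x) y t else 0) T]
  have e1 : ∀ t, (if t < n ∨ (h ≤ t ∧ t < h + k) then phase h (fun _ => x) y t else 0)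
      = (if t ∈ Finset.range n then x else 0) + (if t ∈ Finset.Ico h (h + k) then y else 0) := by
    intro t
    simp only [Finset.mem_range, Finset.mem_Ico, phase]
    by_cases h1 : t < n
    · have h2 : t < h := by omega
      simp [h1, h2]
    · by_cases h2 : h ≤ t ∧ t < h + k
      · have h3 : ¬ t < h := by omega
        simp [h1, h2, h3]
      · simp [h1, h2]
  rw [Finset.sum_congr rfl fun t _ => e1 t, Finset.sum_add_distrib, Finset.sum_ite_mem,
    Finset.sum_ite_mem]
  have e2 : Finset.range T ∩ Finset.range n = Finset.range n := by
    ext t; simp only [Finset.mem_inter, Finset.mem_range]; omega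
  have e3 : Finset.range T ∩ Finset.Ico h (h + k) = Finset.Ico h (h + k) := by
    ext t; simp only [Finset.mem_inter, Finset.mem_range, Finset.mem_Ico]; omega
  rw [e2, e3]
  simp

/-- Playing in the first `n` periods and in the first `k` periods of the second phase is
possible if it respects the budget. -/
theorem le_opt_phase (hm : 1 ≤ m) {B : ℝ} {h : ℕ} (hh : h ≤ T)
    {r₁ r₂ C₁ c₂ : ℝ} {c : ℕ → ℝ} (hcC : ∀ t, c t ≤ C₁) (hC₁ : 0 ≤ C₁) (hc₂ : 0 ≤ c₂)
    (hr : ∀ t, phase h (fun _ => r₁) r₂ t ∈ Set.Icc (0 : ℝ) 1)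
    (hc : ∀ t, phase h c c₂ t ∈ Set.Icc (0 : ℝ) 1) {n k : ℕ} (hn : n ≤ h) (hk : k ≤ T - h)
    (hB : n * C₁ + k * c₂ ≤ B) :
    n * r₁ + k * r₂ ≤ (detInstance m d T (phase h (fun _ => r₁) r₂) (phase h c c₂) hr hc).opt B := by
  classical
  let a : ℕ → Action m := fun t =>
    if t < n ∨ (h ≤ t ∧ t < h + k) then pull (⟨0, hm⟩ : Fin m) else idle
  have ha : ∀ t, a t = idle ↔ ¬ (t < n ∨ (h ≤ t ∧ t < h + k)) := by
    intro t
    by_cases h1 : t < n ∨ (h ≤ t ∧ t < h + k)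
    · simp only [a, h1, not_true_eq_false, iff_false]
      exact pull_ne_idle _
    · simp [a, h1]
  refine le_trans (le_of_eq ?_) ((Policy.schedule a).value_le_opt _ B)
  rw [det_value]
  set ω := fun t : Fin T => uniformOutcome m d (phase h (fun _ => r₁) r₂ t) (phase h c c₂ t)
    with hω
  have key : ∀ s, (Policy.schedule (d := d) a).collected B s ω = n * r₁ + k * r₂ := by
    intro s
    have hact : ∀ t : Fin T, (Policy.schedule (d := d) a).action s ω t = a t := fun t => rfl
    have hwb : ∀ t, (Policy.schedule (d := d) a).WithinBudget B s ω t := by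
      intro t j
      refine le_trans ?_ hB
      rw [← sum_fin_two_blocks h n k hn hh hk]
      calc ∑ u ∈ Finset.Iic t, cost (ω u) ((Policy.schedule (d := d) a).action s ω u) j
          ≤ ∑ u ∈ Finset.Iic t, (if u.val < n ∨ (h ≤ u.val ∧ u.val < h + k) then
              phase h (fun _ => C₁) c₂ u else 0) := by
            refine Finset.sum_le_sum fun u _ => ?_
            rw [hact, hω, cost_uniformOutcome]
            by_cases h1 : u.val < n ∨ (h ≤ u.val ∧ u.val < h + k)
            · rw [if_pos h1]
              have hle : phase h c c₂ u ≤ phase h (fun _ => C₁) c₂ u := by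
                unfold phase
                split_ifs
                exacts [hcC u, le_rfl]
              split_ifs
              · exact hle
              · exact (hc u).1.trans hle
            · rw [if_neg h1, if_neg fun h2 => h2.1 ((ha u).2 h1)]
        _ ≤ _ := by
            refine Finset.sum_le_sum_of_subset_of_nonneg (Finset.subset_univ _) fun u _ _ => ?_
            unfold phase
            split_ifs
            exacts [hC₁, hc₂, le_rfl]
    unfold Policy.collected
    rw [← sum_fin_two_blocks h n k hn hh hk]
    refine Finset.sum_congr rfl fun t _ => ?_
    rw [if_pos (hwb t), hact, hω, gain_uniformOutcome]
    by_cases h1 : t.val < n ∨ (h ≤ t.val ∧ t.val < h + k)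
    · rw [if_pos h1, if_neg fun h2 => (ha t).1 h2 h1]
    · rw [if_neg h1, if_pos ((ha t).2 h1)]
  simp [key]

/-- Two environments that coincide in the first phase: the sum of the regrets is at least the
difference between what two offline schedules collect and the most that a common number of plays in
the first phase allows. -/
theorem two_phase_regret (hm : 1 ≤ m) (hd : 1 ≤ d) {B : ℝ} (hB : 0 ≤ B) {h : ℕ} (hh : h ≤ T)
    {r₁ r₂ r₂' c₁ C₁ c₂ c₂' D : ℝ} {c : ℕ → ℝ} (hc₁ : 0 ≤ c₁) (hcl : ∀ t, c₁ ≤ c t)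
    (hcC : ∀ t, c t ≤ C₁) (hr : ∀ t, phase h (fun _ => r₁) r₂ t ∈ Set.Icc (0 : ℝ) 1)
    (hc : ∀ t, phase h c c₂ t ∈ Set.Icc (0 : ℝ) 1)
    (hr' : ∀ t, phase h (fun _ => r₁) r₂' t ∈ Set.Icc (0 : ℝ) 1)
    (hc' : ∀ t, phase h c c₂' t ∈ Set.Icc (0 : ℝ) 1)
    {n k n' k' : ℕ} (hn : n ≤ h) (hk : k ≤ T - h) (hnk : n * C₁ + k * c₂ ≤ B)
    (hn' : n' ≤ h) (hk' : k' ≤ T - h) (hnk' : n' * C₁ + k' * c₂' ≤ B)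
    (hD : ∀ N K K' : ℕ, N ≤ h → K ≤ T - h → K' ≤ T - h → N * c₁ + K * c₂ ≤ B →
      N * c₁ + K' * c₂' ≤ B → (N * r₁ + K * r₂) + (N * r₁ + K' * r₂') ≤ D)
    (π : Policy m d) :
    (n * r₁ + k * r₂) + (n' * r₁ + k' * r₂') - D
      ≤ (detInstance m d T (phase h (fun _ => r₁) r₂) (phase h c c₂) hr hc).regret B π
        + (detInstance m d T (phase h (fun _ => r₁) r₂') (phase h c c₂') hr' hc').regret B π := by
  have hc₂ : 0 ≤ c₂ := by simpa [phase] using (hc h).1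
  have hc₂' : 0 ≤ c₂' := by simpa [phase] using (hc' h).1
  have hC₁ : 0 ≤ C₁ := (hc₁.trans (hcl 0)).trans (hcC 0)
  have h1 := le_opt_phase (d := d) hm hh hcC hC₁ hc₂ hr hc hn hk hnk
  have h2 := le_opt_phase (d := d) hm hh hcC hC₁ hc₂' hr' hc' hn' hk' hnk'
  have h3 : π.value (detInstance m d T (phase h (fun _ => r₁) r₂) (phase h c c₂) hr hc) B
      + π.value (detInstance m d T (phase h (fun _ => r₁) r₂') (phase h c c₂') hr' hc') B ≤ D := by
    rw [det_value, det_value, ← integral_add (det_integrable hr π B) (det_integrable hr' π B)]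
    refine le_trans (integral_mono ((det_integrable hr π B).add (det_integrable hr' π B))
      (integrable_const D) fun s => ?_) (by simp)
    -- For a fixed seed both runs are deterministic, so the bound `D` applies seed by seed.
    obtain ⟨K, hK, hKB, e⟩ := π.collected_phase (T := T) hd hB s h (r₁ := r₁) (r₂ := r₂)
      hc₁ hcl hc₂
    obtain ⟨K', hK', hKB', e'⟩ := π.collected_phase (T := T) hd hB s h (r₁ := r₁) (r₂ := r₂')
      hc₁ hcl hc₂'
    have hcongr := π.played_congr B s (h := h)
      (ω := fun t : Fin T => uniformOutcome m d (phase h (fun _ => r₁) r₂ t) (phase h c c₂ t))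
      (ω' := fun t : Fin T => uniformOutcome m d (phase h (fun _ => r₁) r₂' t) (phase h c c₂' t))
      (fun u hu => by simp only [phase_of_lt _ _ hu])
    rw [← hcongr] at e' hKB'
    simp only [e, e']
    exact hD _ K K' (card_filter_lt_le _ _) hK hK' hKB hKB'
  unfold Instance.regret
  linarith

/-- A common number `N` of plays in the first phase cannot be good in both environments: the best
numbers are `x` in the environment that improves and `T₁` in the one that deteriorates. -/
theorem two_phase_gap {T₁ T₂ B r ρ c η g x y N K K' : ℝ} (hη : 0 ≤ η) (hηc : η < c)
    (hρ : 0 ≤ ρ) (hρr : ρ ≤ r) (hg : g * (c + η) = r * η + ρ * c) (hx : x * c = B - T₂ * (c - η))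
    (hy : y * (c + η) = B - T₁ * c) (hK : K ≤ T₂)
    (hb : N * c + K * (c - η) ≤ B) (hw : N * c + K' * (c + η) ≤ B) :
    (N * r + K * (r + ρ)) + (N * r + K' * (r - ρ))
      ≤ (T₂ * (r + ρ) + x * r) + (T₁ * r + y * (r - ρ)) - g * (T₁ - x) := by
  have hc : 0 < c := lt_of_le_of_lt hη hηc
  have hr : 0 ≤ r := hρ.trans hρr
  have hg0 : 0 ≤ g := by
    have : 0 ≤ g * (c + η) := by rw [hg]; positivity
    exact nonneg_of_mul_nonneg_left this (by linarith)
  -- Deteriorating case: a play withheld from the first phase loses `r` and pays for at most `c / (c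
  -- + η)` later plays of value `r - ρ`. The net loss is exactly `g`.
  have h1 : (N * r + K' * (r - ρ)) ≤ T₁ * r + y * (r - ρ) - g * (T₁ - N) := by
    have h2 : (K' - y) * (c + η) ≤ (T₁ - N) * c := by linarith
    have h3 : (r - ρ) * ((K' - y) * (c + η)) ≤ (r - ρ) * ((T₁ - N) * c) :=
      mul_le_mul_of_nonneg_left h2 (by linarith)
    have h4 : ((N * r + K' * (r - ρ)) - (T₁ * r + y * (r - ρ) - g * (T₁ - N))) * (c + η)
        ≤ 0 := by
      have e : g * (T₁ - N) * (c + η) = (r * η + ρ * c) * (T₁ - N) := by rw [← hg]; ring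
      nlinarith
    have := nonpos_of_mul_nonpos_left h4 (by linarith)
    linarith
  -- Improving case: beyond `x`, an extra early play gains `r` but displaces `c / (c - η)` later
  -- plays of value `r + ρ`, a net loss of `(r * η + ρ * c) / (c - η) ≥ g`. Below `x` the cap `K ≤
  -- T₂` suffices. In the sum of both cases `N` cancels.
  have h5 : N * r + K * (r + ρ) ≤ T₂ * (r + ρ) + x * r - g * (N - x) := by
    rcases le_total N x with h | h
    · have h6 : K * (r + ρ) ≤ T₂ * (r + ρ) := mul_le_mul_of_nonneg_right hK (by linarith)
      have h7 : N * r ≤ x * r := mul_le_mul_of_nonneg_right h hr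
      nlinarith
    · have h2 : (K - T₂) * (c - η) ≤ (x - N) * c := by linarith
      have h3 : (r + ρ) * ((K - T₂) * (c - η)) ≤ (r + ρ) * ((x - N) * c) :=
        mul_le_mul_of_nonneg_left h2 (by linarith)
      have h6 : g * (c - η) ≤ r * η + ρ * c := by nlinarith
      have h7 : g * (c - η) * (N - x) ≤ (r * η + ρ * c) * (N - x) :=
        mul_le_mul_of_nonneg_right h6 (by linarith)
      have h4 : ((N * r + K * (r + ρ)) - (T₂ * (r + ρ) + x * r - g * (N - x))) * (c - η)
          ≤ 0 := by
        nlinarith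
      have := nonpos_of_mul_nonpos_left h4 (by linarith)
      linarith
  linarith

set_option maxHeartbeats 1000000 in
/-- The sum of the regrets in two environments that coincide in the first half and improve,
respectively deteriorate, in the second half. -/
theorem half_switch_regret (hm : 1 ≤ m) (hd : 1 ≤ d) (hT : 8 ≤ T) {b l r ρ η δ : ℝ} {c : ℕ → ℝ}
    (hb : 0 < b) (hl : 1 < l) (hl' : l ≤ 3 / 2) (hη : 0 ≤ η) (hηb : η ≤ (l - 1) / 2 * b)
    (hρ : 0 ≤ ρ) (hρr : ρ ≤ r) (hδ : 0 ≤ δ) (hδb : δ ≤ b / 4)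
    (hcl : ∀ t, l * b ≤ c t) (hcu : ∀ t, c t ≤ l * b + δ)
    (hr : ∀ t, phase (T / 2) (fun _ => r) (r + ρ) t ∈ Set.Icc (0 : ℝ) 1)
    (hc : ∀ t, phase (T / 2) c (l * b - η) t ∈ Set.Icc (0 : ℝ) 1)
    (hr' : ∀ t, phase (T / 2) (fun _ => r) (r - ρ) t ∈ Set.Icc (0 : ℝ) 1)
    (hc' : ∀ t, phase (T / 2) c (l * b + η) t ∈ Set.Icc (0 : ℝ) 1) (π : Policy m d) :
    (r * η + ρ * (l * b)) / (2 * (l * b)) * (T * (l - 1) / (2 * l)) - 2 * r * (1 + T * δ / (l * b))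
      ≤ (detInstance m d T (phase (T / 2) (fun _ => r) (r + ρ)) (phase (T / 2) c (l * b - η))
          hr hc).regret (b * T) π
        + (detInstance m d T (phase (T / 2) (fun _ => r) (r - ρ)) (phase (T / 2) c (l * b + η))
          hr' hc').regret (b * T) π := by
  set T₁ : ℝ := ((T / 2 : ℕ) : ℝ) with hT₁
  set T₂ : ℝ := ((T - T / 2 : ℕ) : ℝ) with hT₂
  have hTR : (8 : ℝ) ≤ T := by exact_mod_cast hT
  have hsum : T₁ + T₂ = T := by
    rw [hT₁, hT₂, ← Nat.cast_add]
    congr 1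
    omega
  have h1u : 2 * T₁ ≤ T := by
    rw [hT₁]; exact_mod_cast (by omega : 2 * (T / 2) ≤ T)
  have h2u : 2 * T₂ ≤ T + 1 := by
    rw [hT₂]; exact_mod_cast (by omega : 2 * (T - T / 2) ≤ T + 1)
  have h10 : 0 ≤ T₁ := Nat.cast_nonneg _
  have h20 : 0 ≤ T₂ := Nat.cast_nonneg _
  have hlb : b < l * b := by nlinarith
  have hlb' : l * b ≤ 3 / 2 * b := by nlinarith
  set c₁ := l * b with hc₁
  have hc₁0 : 0 < c₁ := hb.trans hlb
  have hr0 : 0 ≤ r := hρ.trans hρr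
  have hηc : η < c₁ := by nlinarith
  set x := (b * T - T₂ * (c₁ - η)) / c₁ with hx
  set y := (b * T - T₁ * c₁) / (c₁ + η) with hy
  set g := (r * η + ρ * c₁) / (c₁ + η) with hg
  have hxc : x * c₁ = b * T - T₂ * (c₁ - η) := div_mul_cancel₀ _ hc₁0.ne'
  have hyc : y * (c₁ + η) = b * T - T₁ * c₁ := div_mul_cancel₀ _ (by positivity)
  have hgc : g * (c₁ + η) = r * η + ρ * c₁ := div_mul_cancel₀ _ (by positivity)
  have hX : 0 ≤ b * T - T₂ * (c₁ - η) := by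
    have : T₂ * (c₁ - η) ≤ T₂ * (3 / 2 * b) := mul_le_mul_of_nonneg_left (by linarith) h20
    nlinarith
  have hY : 0 ≤ b * T - T₁ * (c₁ + δ) := by
    have : T₁ * (c₁ + δ) ≤ T₁ * (7 / 4 * b) := mul_le_mul_of_nonneg_left (by linarith) h10
    nlinarith
  have hx0 : 0 ≤ x := div_nonneg hX hc₁0.le
  have hbl : b * T = c₁ * (T / l) := by rw [hc₁]; field_simp
  -- The two optimal first-phase counts are a constant fraction of `T` apart: `(T₁ - x) * c₁ = T *
  -- (l - 1) * b - T₂ * η`, and `η` takes away at most half of the first term.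
  have hxT : T * (l - 1) / (2 * l) ≤ T₁ - x := by
    have e1 : T * (l - 1) / (2 * l) * c₁ = T * ((l - 1) / 2 * b) := by
      rw [hc₁]; field_simp
    have e2 : (T₁ - x) * c₁ = T * ((l - 1) * b) - T₂ * η := by
      rw [sub_mul, hxc, ← hsum, hc₁]; ring
    have e3 : T₂ * η ≤ T * ((l - 1) / 2 * b) :=
      mul_le_mul (by linarith) hηb hη (by positivity)
    have : T * (l - 1) / (2 * l) * c₁ ≤ (T₁ - x) * c₁ := by rw [e1, e2]; linarith
    exact le_of_mul_le_mul_right this hc₁0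
  have hpos : 0 ≤ T * (l - 1) / (2 * l) := by
    have : 0 ≤ l - 1 := by linarith
    positivity
  have hxT' : x ≤ T := by linarith
  have hT0 : (0 : ℝ) < T := by linarith
  -- the offline schedules
  set n := ⌊(b * T - T₂ * (c₁ - η)) / (c₁ + δ)⌋₊ with hn
  set k := ⌊(b * T - T₁ * (c₁ + δ)) / (c₁ + η)⌋₊ with hk
  have hnle : (n : ℝ) * (c₁ + δ) ≤ b * T - T₂ * (c₁ - η) := by
    rw [← le_div_iff₀ (by positivity)]
    exact Nat.floor_le (by positivity)
  have hkle : (k : ℝ) * (c₁ + η) ≤ b * T - T₁ * (c₁ + δ) := by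
    rw [← le_div_iff₀ (by positivity)]
    exact Nat.floor_le (by positivity)
  have hnx : (n : ℝ) ≤ x := by
    rw [hx, le_div_iff₀ hc₁0]
    linarith [mul_nonneg (Nat.cast_nonneg (α := ℝ) n) hδ]
  have hnT : n ≤ T / 2 := by
    have : (n : ℝ) ≤ T₁ := by linarith
    rw [hT₁] at this
    exact Nat.cast_le.1 this
  have hkT : k ≤ T - T / 2 := by
    have h1 : (k : ℝ) * c₁ ≤ T₂ * c₁ := by
      have : (k : ℝ) * c₁ ≤ b * T - T₁ * c₁ := by
        linarith [mul_nonneg h10 hδ, mul_nonneg (Nat.cast_nonneg (α := ℝ) k) hη]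
      have : b * T ≤ (T₁ + T₂) * c₁ := by
        rw [hsum, mul_comm]
        exact mul_le_mul_of_nonneg_left hlb.le hT0.le
      linarith
    have : (k : ℝ) ≤ T₂ := le_of_mul_le_mul_right h1 hc₁0
    rw [hT₂] at this
    exact Nat.cast_le.1 this
  -- The schedules must be affordable at the highest consumption `c₁ + δ`. Compared with the ideal
  -- counts this loses one play by rounding and at most `T * δ / c₁` by the oscillation.
  have hn_lower : x - (1 + T * δ / c₁) ≤ n := by
    have h1 : (b * T - T₂ * (c₁ - η)) / (c₁ + δ) - 1 ≤ n := (Nat.sub_one_lt_floor _).le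
    have h2 : x - T * δ / c₁ ≤ (b * T - T₂ * (c₁ - η)) / (c₁ + δ) := by
      rw [le_div_iff₀ (by positivity), ← hxc]
      have e1 : T * δ / c₁ * c₁ = T * δ := div_mul_cancel₀ _ hc₁0.ne'
      have e2 : 0 ≤ T * δ / c₁ * δ := by positivity
      have e3 : x * δ ≤ T * δ := mul_le_mul_of_nonneg_right hxT' hδ
      linarith
    linarith
  have hk_lower : y - (1 + T * δ / c₁) ≤ k := by
    have h1 : (b * T - T₁ * (c₁ + δ)) / (c₁ + η) - 1 ≤ k := (Nat.sub_one_lt_floor _).le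
    have h2 : y - T * δ / c₁ ≤ (b * T - T₁ * (c₁ + δ)) / (c₁ + η) := by
      rw [le_div_iff₀ (by positivity), sub_mul, hyc]
      have e1 : T * δ / c₁ * c₁ = T * δ := div_mul_cancel₀ _ hc₁0.ne'
      have e2 : 0 ≤ T * δ / c₁ * η := by positivity
      have e3 : T₁ * δ ≤ T * δ := mul_le_mul_of_nonneg_right (by linarith) hδ
      linarith
    linarith
  have main := two_phase_regret (T := T) (B := b * T) (D := (T₂ * (r + ρ) + x * r) +
      (T₁ * r + y * (r - ρ)) - g * (T₁ - x)) hm hd (by positivity) (Nat.div_le_self T 2) hc₁0.le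
    hcl hcu hr hc hr' hc' (n := n) (k := T - T / 2) (n' := T / 2) (k' := k) hnT le_rfl
    (by linarith) le_rfl hkT (by linarith)
    (fun N K K' _ hK _ h1 h2 => two_phase_gap hη hηc hρ hρr hgc hxc hyc
      (by rw [hT₂]; exact_mod_cast hK) h1 h2) π
  refine le_trans ?_ main
  -- Uses `η < c₁`, so that `c₁ + η ≤ 2 * c₁`.
  have hgl : (r * η + ρ * c₁) / (2 * c₁) ≤ g := by
    rw [hg]
    exact div_le_div_of_nonneg_left (by positivity) (by positivity) (by linarith)
  have hgl0 : 0 ≤ (r * η + ρ * c₁) / (2 * c₁) := by positivity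
  have f1 : (r * η + ρ * c₁) / (2 * c₁) * (T * (l - 1) / (2 * l)) ≤ g * (T₁ - x) :=
    mul_le_mul hgl hxT hpos (hgl0.trans hgl)
  have f2 : (x - (1 + T * δ / c₁)) * r ≤ n * r := mul_le_mul_of_nonneg_right hn_lower hr0
  have f3 : (y - (1 + T * δ / c₁)) * (r - ρ) ≤ k * (r - ρ) :=
    mul_le_mul_of_nonneg_right hk_lower (by linarith)
  have f4 : 0 ≤ (1 + T * δ / c₁) * ρ := by positivity
  linarith

/-! ### Variations and dual prices of deterministic environments. -/

theorem sum_phase {h : ℕ} (hh : h ≤ T) (x y : ℝ) :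
    ∑ t : Fin T, phase h (fun _ => x) y t = h * x + (T - h : ℕ) * y := by
  rw [← sum_fin_two_blocks h h (T - h) le_rfl hh le_rfl]
  refine Finset.sum_congr rfl fun t _ => ?_
  rw [if_pos]
  have := t.isLt
  omega

theorem apply_phase (f : ℝ → ℝ) (h : ℕ) (x y : ℝ) (t : ℕ) :
    f (phase h (fun _ => x) y t) = phase h (fun _ => f x) (f y) t := by
  unfold phase
  split_ifs <;> rfl

/-- The total deviation of a two-valued sequence from its mean. -/
theorem sum_abs_sub_mean_phase {h : ℕ} (hh : h ≤ T) (hT : 1 ≤ T) (x y : ℝ) :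
    ∑ t : Fin T, |phase h (fun _ => x) y t - 1 / T * ∑ u : Fin T, phase h (fun _ => x) y u|
      = 2 * (h * (T - h : ℕ)) / T * |x - y| := by
  rw [sum_phase hh, Finset.sum_congr rfl fun (t : Fin T) _ =>
    apply_phase (fun z => |z - 1 / T * (h * x + (T - h : ℕ) * y)|) h x y t, sum_phase hh]
  have hT0 : (0 : ℝ) < T := by exact_mod_cast hT
  set k : ℝ := ((T - h : ℕ) : ℝ) with hk
  have hsum : (h : ℝ) + k = T := by
    rw [hk, ← Nat.cast_add]
    congr 1
    omega
  have hk0 : 0 ≤ k := Nat.cast_nonneg _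
  have e1 : x - 1 / T * (h * x + k * y) = k / T * (x - y) := by
    rw [← hsum] at hT0 ⊢
    field_simp
    ring
  have e2 : y - 1 / T * (h * x + k * y) = h / T * (y - x) := by
    rw [← hsum] at hT0 ⊢
    field_simp
    ring
  rw [e1, e2, abs_mul, abs_mul, abs_of_nonneg (by positivity : 0 ≤ k / T),
    abs_of_nonneg (by positivity : 0 ≤ (h : ℝ) / T), abs_sub_comm y x]
  ring

theorem sum_resource_zero (hd : 1 ≤ d) (x : ℝ) :
    ∑ j : Fin d, (if j.val = 0 then x else 0) = x := by
  rw [Finset.sum_eq_single (⟨0, hd⟩ : Fin d)]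
  · simp
  · intro j _ hj
    rw [if_neg fun h => hj (Fin.ext h)]
  · simp

section Det

variable {r c : ℕ → ℝ} (hr : ∀ t, r t ∈ Set.Icc (0 : ℝ) 1) (hc : ∀ t, c t ∈ Set.Icc (0 : ℝ) 1)

theorem detInstance_W₁ (hm : 1 ≤ m) :
    (detInstance m d T r c hr hc).W₁ = ∑ t : Fin T, |r t - 1 / T * ∑ u : Fin T, r u| := by
  have : Nonempty (Fin m) := ⟨⟨0, hm⟩⟩
  unfold Instance.W₁
  refine Finset.sum_congr rfl fun t _ => ?_
  have : (detInstance m d T r c hr hc).μ t - (detInstance m d T r c hr hc).meanμ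
      = fun _ => r t - 1 / T * ∑ u : Fin T, r u := by
    ext i
    simp [Instance.meanμ, detInstance_μ]
  rw [this, pi_norm_const, Real.norm_eq_abs]

theorem detInstance_W₂ (hm : 1 ≤ m) (hd : 1 ≤ d) :
    (detInstance m d T r c hr hc).W₂ = ∑ t : Fin T, |c t - 1 / T * ∑ u : Fin T, c u| := by
  have : Nonempty (Fin m) := ⟨⟨0, hm⟩⟩
  unfold Instance.W₂
  refine Finset.sum_congr rfl fun t _ => ?_
  have : ∀ i : Fin m, ∑ j, |(detInstance m d T r c hr hc).C t j i
      - (detInstance m d T r c hr hc).meanC j i| = |c t - 1 / T * ∑ u : Fin T, c u| := by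
    intro i
    rw [← sum_resource_zero hd |c t - 1 / T * ∑ u : Fin T, c u|]
    refine Finset.sum_congr rfl fun j _ => ?_
    simp only [Instance.meanC, detInstance_C]
    split_ifs <;> simp
  simp only [this, ciSup_const]

theorem detInstance_V₂ (hm : 1 ≤ m) (hd : 1 ≤ d) :
    (detInstance m d T r c hr hc).V₂ = ∑ t ∈ Finset.range (T - 1), |c t - c (t + 1)| := by
  have : Nonempty (Fin m) := ⟨⟨0, hm⟩⟩
  have : Nonempty (Fin d) := ⟨⟨0, hd⟩⟩
  have key : ∀ j : Fin d, ∑ t : Fin (T - 1), ‖(detInstance m d T r c hr hc).C ⟨t, by omega⟩ j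
      - (detInstance m d T r c hr hc).C ⟨t + 1, by omega⟩ j‖
      = if j.val = 0 then ∑ t ∈ Finset.range (T - 1), |c t - c (t + 1)| else 0 := by
    intro j
    simp only [detInstance_C]
    split_ifs with hj
    · rw [← Fin.sum_univ_eq_sum_range (fun t => |c t - c (t + 1)|)]
      refine Finset.sum_congr rfl fun t _ => ?_
      have : ((fun _ => c t) - fun _ => c (t + 1) : Fin m → ℝ) = fun _ => c t - c (t + 1) := rfl
      rw [this, pi_norm_const, Real.norm_eq_abs]
    · refine Finset.sum_eq_zero fun t _ => ?_
      have : ((fun _ => 0) - fun _ => 0 : Fin m → ℝ) = 0 := by ext; simp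
      rw [this, norm_zero]
  unfold Instance.V₂
  simp only [key]
  have h0 : 0 ≤ ∑ t ∈ Finset.range (T - 1), |c t - c (t + 1)| :=
    Finset.sum_nonneg fun _ _ => abs_nonneg _
  refine le_antisymm (ciSup_le fun j => ?_) ?_
  · split_ifs
    exacts [le_rfl, h0]
  · refine le_ciSup_of_le (Set.finite_range _).bddAbove ⟨0, hd⟩ ?_
    simp

end Det

/-- If `p` times the consumption covers the reward in every period, then `p` bounds every
optimal dual price. -/
theorem norm_dualPrice_le (hd : 1 ≤ d) {S : ℕ} (hS : 1 ≤ S) {b p : ℝ} (hb : 0 < b) (hp : 0 ≤ p)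
    {r c : Fin S → ℝ} (h : ∀ t, r t ≤ p * c t) {q : Fin d → ℝ}
    (hq : IsDualPrice (m := m) b (fun t _ => r t)
      (fun t (j : Fin d) _ => if j.val = 0 then c t else 0) q) : ‖q‖ ≤ p := by
  obtain ⟨α, ⟨h1, h2, h3⟩, hopt⟩ := hq
  have hS0 : (0 : ℝ) < S := by exact_mod_cast hS
  -- The competitor with price `p` on resource `0` and `α = 0` is feasible and has objective `S * b
  -- * p`. Since `α ≥ 0`, an optimal price vector has coordinate sum at most `p`.
  have := hopt (fun j => if j.val = 0 then p else 0) (fun _ => 0) ⟨fun j => by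
    dsimp only
    split_ifs
    exacts [hp, le_rfl], fun t i => by
      have e : ∑ j : Fin d, (if j.val = 0 then c t else 0) * (if j.val = 0 then p else 0)
          = c t * p := by
        rw [← sum_resource_zero hd (c t * p)]
        refine Finset.sum_congr rfl fun j _ => ?_
        split_ifs <;> simp
      rw [e]
      linarith [h t], fun _ => le_rfl⟩
  have e : ∑ j : Fin d, b * (if j.val = 0 then p else 0) = b * p := by
    rw [← Finset.mul_sum, sum_resource_zero hd]
  unfold dualObjective at this
  rw [e, ← Finset.mul_sum, Finset.sum_const_zero, add_zero] at this
  have hα : 0 ≤ ∑ t, α t := Finset.sum_nonneg fun t _ => h3 t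
  have h4 : (S : ℝ) * (b * ∑ j, q j) ≤ S * (b * p) := by linarith
  have h5 : ∑ j, q j ≤ p := le_of_mul_le_mul_left (le_of_mul_le_mul_left h4 hS0) hb
  rw [pi_norm_le_iff_of_nonneg hp]
  intro j
  rw [Real.norm_of_nonneg (h1 j)]
  exact (Finset.single_le_sum (fun j _ => h1 j) (Finset.mem_univ j)).trans h5

/-- The ratio of reward and consumption is an optimal dual price of a single-period linear
program in which the budget is at most the consumption. -/
theorem isDualPrice_single (hm : 1 ≤ m) (hd : 1 ≤ d) {b p r c : ℝ} (hb : 0 ≤ b) (hbc : b ≤ c)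
    (hc : 0 < c) (hp : 0 ≤ p) (h : r = p * c) :
    IsDualPrice (m := m) b (fun _ : Fin 1 => fun _ => r)
      (fun _ (j : Fin d) _ => if j.val = 0 then c else 0) (fun j => if j.val = 0 then p else 0) := by
  refine ⟨fun _ => 0, ⟨fun j => by
    dsimp only
    split_ifs
    exacts [hp, le_rfl], fun t i => ?_, fun _ => le_rfl⟩, ?_⟩
  · have e : ∑ j : Fin d, (if j.val = 0 then c else 0) * (if j.val = 0 then p else 0)
        = c * p := by
      rw [← sum_resource_zero hd (c * p)]
      refine Finset.sum_congr rfl fun j _ => ?_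
      split_ifs <;> simp
    rw [e, h]
    linarith [mul_comm p c]
  · rintro q α ⟨h1, h2, h3⟩
    have e : ∑ j : Fin d, b * (if j.val = 0 then p else 0) = b * p := by
      rw [← Finset.mul_sum, sum_resource_zero hd]
    have e2 : ∑ j : Fin d, (if j.val = 0 then c else 0) * q j = c * q ⟨0, hd⟩ := by
      rw [← sum_resource_zero hd (c * q ⟨0, hd⟩)]
      refine Finset.sum_congr rfl fun j _ => ?_
      by_cases hj : j.val = 0
      · have : j = ⟨0, hd⟩ := Fin.ext hj
        simp [this]
      · simp [hj]
    have h4 := h2 0 ⟨0, hm⟩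
    rw [e2, h] at h4
    -- Weak duality by hand: this is the constraint of an arm, with `q` of resource `0` enlarged to
    -- the sum of all prices. Multiplying by `b` and using `b * α 0 ≤ c * α 0` bounds every feasible
    -- objective from below by `b * p`.
    have h5 : c * p ≤ c * ∑ j, q j + α 0 := by
      have : q ⟨0, hd⟩ ≤ ∑ j, q j := Finset.single_le_sum (fun j _ => h1 j) (Finset.mem_univ _)
      have := mul_le_mul_of_nonneg_left this hc.le
      linarith [mul_comm p c]
    unfold dualObjective
    rw [e, ← Finset.mul_sum]
    simp only [Fin.sum_univ_one, Nat.cast_one, one_mul, add_zero]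
    have h6 : 0 ≤ α 0 := h3 0
    have h7 : b * α 0 ≤ c * α 0 := mul_le_mul_of_nonneg_right hbc h6
    have h8 : b * (c * p) ≤ b * (c * ∑ j, q j + α 0) := mul_le_mul_of_nonneg_left h5 hb
    have h9 : c * (b * p) ≤ c * (b * ∑ j, q j + α 0) := by linarith
    exact le_of_mul_le_mul_left h9 hc

/-- Stated with `upperBounds` because the lower bound on the supremum also needs the set to be
bounded: `sSup` of an unbounded set of reals is `0`. -/
theorem detInstance_qbar_le {r c : ℕ → ℝ} (hr : ∀ t, r t ∈ Set.Icc (0 : ℝ) 1)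
    (hc : ∀ t, c t ∈ Set.Icc (0 : ℝ) 1) (hd : 1 ≤ d) (hT : 1 ≤ T) {b p : ℝ} (hb : 0 < b)
    (hp : 0 ≤ p) (h : ∀ t, r t ≤ p * c t) :
    p ∈ upperBounds {v : ℝ | ∃ q : Fin d → ℝ, v = ‖q‖ ∧
    (IsDualPrice b (detInstance m d T r c hr hc).μ (detInstance m d T r c hr hc).C q ∨
      ∃ t, IsDualPrice b (fun _ : Fin 1 => (detInstance m d T r c hr hc).μ t)
        (fun _ : Fin 1 => (detInstance m d T r c hr hc).C t) q)} := by
  rintro v ⟨q, rfl, hq | ⟨t, hq⟩⟩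
  · refine norm_dualPrice_le (m := m) (r := fun t : Fin T => r t) (c := fun t : Fin T => c t)
      hd hT hb hp (fun t => h t) ?_
    convert hq using 1
    · ext t i
      rw [detInstance_μ]
    · ext t j i
      rw [detInstance_C]
  · simp only [detInstance_μ, detInstance_C] at hq
    exact norm_dualPrice_le (m := m) (r := fun _ => r t) (c := fun _ => c t)
      hd le_rfl hb hp (fun _ => h t) hq

/-- Bounds for the largest dual price by the ratios of reward and consumption. -/
theorem detInstance_qbar_mem {r c : ℕ → ℝ} (hr : ∀ t, r t ∈ Set.Icc (0 : ℝ) 1)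
    (hc : ∀ t, c t ∈ Set.Icc (0 : ℝ) 1) (hm : 1 ≤ m) (hd : 1 ≤ d) (hT : 1 ≤ T) {b p p₀ : ℝ}
    (hb : 0 < b) (hp : 0 ≤ p) (h : ∀ t, r t ≤ p * c t) (hp₀ : 0 ≤ p₀) (h₀ : r 0 = p₀ * c 0)
    (hbc : b ≤ c 0) :
    p₀ ≤ (detInstance m d T r c hr hc).qbar b ∧ (detInstance m d T r c hr hc).qbar b ≤ p := by
  have hub := detInstance_qbar_le (m := m) hr hc hd hT hb hp h
  have hmem : p₀ ∈ {v : ℝ | ∃ q : Fin d → ℝ, v = ‖q‖ ∧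
    (IsDualPrice b (detInstance m d T r c hr hc).μ (detInstance m d T r c hr hc).C q ∨
      ∃ t, IsDualPrice b (fun _ : Fin 1 => (detInstance m d T r c hr hc).μ t)
        (fun _ : Fin 1 => (detInstance m d T r c hr hc).C t) q)} := by
    -- The single-period program of period `0` attains the price `p₀`.
    refine ⟨fun j => if j.val = 0 then p₀ else 0, ?_, Or.inr ⟨⟨0, hT⟩, ?_⟩⟩
    · refine le_antisymm ?_ ((pi_norm_le_iff_of_nonneg hp₀).2 fun j => ?_)
      · refine le_trans (le_of_eq ?_) (norm_le_pi_norm _ (⟨0, hd⟩ : Fin d))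
        simp [abs_of_nonneg hp₀]
      · split_ifs
        · rw [Real.norm_of_nonneg hp₀]
        · rwa [norm_zero]
    · simp only [detInstance_μ, detInstance_C]
      exact isDualPrice_single hm hd hb.le hbc (hb.trans_le hbc) hp₀ h₀
  exact ⟨le_csSup ⟨p, hub⟩ hmem, csSup_le ⟨p₀, hmem⟩ hub⟩

theorem detInstance_isTwoPhase {r₁ r₂ c₁ c₂ : ℝ} (hr hc) :
    (detInstance m d T (phase (T / 2) (fun _ => r₁) r₂) (phase (T / 2) (fun _ => c₁) c₂)
      hr hc).IsTwoPhase := by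
  intro s t hst
  simp only [detInstance, phase]
  by_cases h : s.val < T / 2
  · simp [h, hst.1 h]
  · have h' : ¬ t.val < T / 2 := fun h' => h (hst.2 h')
    simp [h, h']

/-! ### Lower bound by the global variations, part (iii). -/

/-- The factor `l > 1` makes the budget scarce, and the last condition leaves room to raise the
consumption `l * b` by `(l - 1) * b` without exceeding `1`. The choice is `2 * l - 1 = 1 / max b₀ (1
/ 2)`; the maximum with `1 / 2` keeps `l ≤ 3 / 2`. -/
theorem exists_rate (b₀ : ℝ) (hb₀ : b₀ < 1) :
    ∃ l : ℝ, 1 < l ∧ l ≤ 3 / 2 ∧ ∀ b, 0 < b → b ≤ b₀ → l * b + (l - 1) * b ≤ 1 := by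
  have h1 : 0 < max b₀ (1 / 2) := lt_of_lt_of_le (by norm_num) (le_max_right _ _)
  have h2 : max b₀ (1 / 2) < 1 := max_lt hb₀ (by norm_num)
  refine ⟨(1 + 1 / max b₀ (1 / 2)) / 2, ?_, ?_, fun b _ hb => ?_⟩
  · have : 1 < 1 / max b₀ (1 / 2) := (one_lt_div h1).2 h2
    linarith
  · have : 1 / max b₀ (1 / 2) ≤ 2 := by
      rw [div_le_iff₀ h1]
      linarith [le_max_right b₀ (1 / 2)]
    linarith
  · have h3 : b ≤ max b₀ (1 / 2) := hb.trans (le_max_left _ _)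
    have h4 : 1 / max b₀ (1 / 2) * b ≤ 1 := by
      rw [one_div_mul_eq_div, div_le_one h1]
      exact h3
    linarith

set_option maxHeartbeats 1000000 in
/-- Lower bound in terms of the global variations. -/
theorem global_variation_lower_bound (b₀ : ℝ) (hb₀ : b₀ < 1) :
    ∃ c κ K : ℝ, 0 < c ∧ 0 < κ ∧ 0 < K ∧
      ∀ (m d T : ℕ) (b q w₁ w₂ : ℝ), 1 ≤ m → 1 ≤ d → 1 ≤ T → 0 < b → b ≤ b₀ →
        0 < q → q ≤ κ / b →
        0 ≤ w₁ → w₁ ≤ κ * (q * b) * T → 0 ≤ w₂ → w₂ ≤ κ * b * T →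
        K * (q * b) ≤ w₁ + q * w₂ →
        ∃ Ibetter Iworse : BwK.Instance m d T,
          (Ibetter.IsTwoPhase ∧ Iworse.IsTwoPhase ∧
            (∀ t : Fin T, t.val < T / 2 → Ibetter.law t = Iworse.law t) ∧
            Ibetter.SecondHalfBetter ∧ Iworse.SecondHalfWorse) ∧
          (∀ I ∈ ({Ibetter, Iworse} : Set (BwK.Instance m d T)),
            I.W₁ = w₁ ∧ I.W₂ = w₂ ∧ q ≤ I.qbar b ∧ I.qbar b ≤ 2 * q) ∧
          ∀ π : BwK.Policy m d, ∃ I ∈ ({Ibetter, Iworse} : Set (BwK.Instance m d T)),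
            c * (I.W₁ + I.qbar b * I.W₂) ≤ I.regret (b * T) π := by
  obtain ⟨l, hl1, hl2, hl⟩ := exists_rate b₀ hb₀
  obtain ⟨σ, hσ⟩ : ∃ σ, σ = l - 1 := ⟨_, rfl⟩
  have hσ0 : 0 < σ := by linarith
  have hσ1 : σ ≤ 1 / 2 := by linarith
  -- `κ = σ / 10` gives jumps `ρ ≤ σ / 4 * (q * b)` and `η ≤ σ / 4 * b`. `K = 27 / σ` makes the
  -- rounding loss `2 * r ≤ 9 / 2 * (q * b)` at most half of the main term `σ / 3 * (w₁ + q * w₂)`.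
  refine ⟨σ / 24, σ / 10, 27 / σ, by positivity, by positivity, by positivity, ?_⟩
  intro m d T b q w₁ w₂ hm hd hT1 hb hbb hq hqκ hw₁ hw₁u hw₂ hw₂u hK
  have hT0 : (0 : ℝ) < T := by exact_mod_cast hT1
  have hqb : 0 < q * b := mul_pos hq hb
  have hqb' : q * b ≤ σ / 10 := (le_div_iff₀ hb).1 hqκ
  -- The lower and upper bounds on the variations are compatible only for large `T`: `27 / σ ≤ σ / 5
  -- * T`.
  have hTR : (8 : ℝ) ≤ T := by
    have h1 : q * w₂ ≤ q * (σ / 10 * b * T) := mul_le_mul_of_nonneg_left hw₂u hq.le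
    have h2 : (27 / σ) * (q * b) ≤ (σ / 5 * T) * (q * b) := by linarith
    have h3 : 27 / σ ≤ σ / 5 * T := le_of_mul_le_mul_right h2 hqb
    have h4 : 54 ≤ 27 / σ := by rw [le_div_iff₀ hσ0]; linarith
    nlinarith
  have hT : 8 ≤ T := by exact_mod_cast hTR
  have hh : T / 2 ≤ T := Nat.div_le_self T 2
  obtain ⟨P, hP⟩ : ∃ P : ℝ, P = ((T / 2 : ℕ) : ℝ) * ((T - T / 2 : ℕ) : ℝ) := ⟨_, rfl⟩
  have hsum : ((T / 2 : ℕ) : ℝ) + ((T - T / 2 : ℕ) : ℝ) = T := by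
    rw [← Nat.cast_add]
    congr 1
    omega
  have hPu : 4 * P ≤ T * T := by
    rw [hP, ← hsum]
    nlinarith [sq_nonneg (((T / 2 : ℕ) : ℝ) - ((T - T / 2 : ℕ) : ℝ))]
  have hPl : T * T ≤ 5 * P := by
    have h1 : ((T - T / 2 : ℕ) : ℝ) ≤ ((T / 2 : ℕ) : ℝ) + 1 := by
      exact_mod_cast (by omega : T - T / 2 ≤ T / 2 + 1)
    have h2 : ((T / 2 : ℕ) : ℝ) ≤ ((T - T / 2 : ℕ) : ℝ) := by
      exact_mod_cast (by omega : T / 2 ≤ T - T / 2)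
    rw [hP, ← hsum]
    rw [← hsum] at hTR
    nlinarith
  have hP0 : 0 < P := by linarith [mul_pos hT0 hT0]
  -- the size of the change
  have hbounds : ∀ w, 0 ≤ w → 2 * w / T ≤ w * T / (2 * P) ∧ w * T / (2 * P) ≤ 5 / 2 * (w / T) := by
    intro w hw
    constructor
    · rw [div_le_div_iff₀ hT0 (by positivity)]
      linarith [mul_le_mul_of_nonneg_left hPu hw]
    · rw [← mul_div_assoc, div_le_div_iff₀ (by positivity) hT0]
      linarith [mul_le_mul_of_nonneg_left hPl hw]
  -- By `sum_abs_sub_mean_phase` a jump of height `ρ` at `T / 2` has total deviation `2 * P / T *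
  -- ρ`; the heights `ρ` and `η` are solved from this.
  obtain ⟨ρ, hρ⟩ : ∃ ρ, ρ = w₁ * T / (2 * P) := ⟨_, rfl⟩
  obtain ⟨η, hη⟩ : ∃ η, η = w₂ * T / (2 * P) := ⟨_, rfl⟩
  obtain ⟨hρl, hρu⟩ := hbounds w₁ hw₁
  obtain ⟨hηl, hηu⟩ := hbounds w₂ hw₂
  rw [← hρ] at hρl hρu
  rw [← hη] at hηl hηu
  have hρ0 : 0 ≤ ρ := by rw [hρ]; positivity
  have hη0 : 0 ≤ η := by rw [hη]; positivity
  have hw₁T : w₁ / T ≤ σ / 10 * (q * b) := (div_le_iff₀ hT0).2 hw₁u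
  have hw₂T : w₂ / T ≤ σ / 10 * b := (div_le_iff₀ hT0).2 hw₂u
  have hρu' : ρ ≤ σ / 4 * (q * b) := by linarith
  have hηu' : η ≤ σ / 4 * b := by linarith
  have hσqb : σ * (q * b) ≤ 1 / 2 * (q * b) := mul_le_mul_of_nonneg_right hσ1 hqb.le
  have hσb : σ * b ≤ 1 / 2 * b := mul_le_mul_of_nonneg_right hσ1 hb.le
  have hσb0 : 0 ≤ σ * b := by positivity
  have hlb1 : b ≤ l * b := le_mul_of_one_le_left hb.le hl1.le
  have hlqb1 : q * b ≤ l * (q * b) := le_mul_of_one_le_left hqb.le hl1.le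
  have hlqb2 : l * (q * b) ≤ 3 / 2 * (q * b) := mul_le_mul_of_nonneg_right hl2 hqb.le
  have hlbσ : l * b + σ * b ≤ 1 := by rw [hσ]; exact hl b hb hbb
  -- The first-half ratio of reward to consumption is `3 / 2 * q`, in the middle of the allowed
  -- interval `[q, 2 * q]`. The slack absorbs the jumps in the second half.
  obtain ⟨r, hr⟩ : ∃ r, r = 3 / 2 * (l * (q * b)) := ⟨_, rfl⟩
  have hr0 : 0 ≤ r := by rw [hr]; positivity
  have hρr : ρ ≤ r := by linarith
  have hr1 : r + ρ ≤ 1 := by linarith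
  have hqη : q * η ≤ σ / 4 * (q * b) := by
    have := mul_le_mul_of_nonneg_left hηu' hq.le
    linarith
  have mem_r : ∀ z, 0 ≤ z → z ≤ 1 →
      ∀ t, phase (T / 2) (fun _ => r) z t ∈ Set.Icc (0 : ℝ) 1 := fun z hz hz' t =>
    phase_mem (s := Set.Icc (0 : ℝ) 1) (fun _ => ⟨hr0, by linarith⟩) ⟨hz, hz'⟩ t
  have mem_c : ∀ z, 0 ≤ z → z ≤ 1 →
      ∀ t, phase (T / 2) (fun _ => l * b) z t ∈ Set.Icc (0 : ℝ) 1 := fun z hz hz' t =>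
    phase_mem (s := Set.Icc (0 : ℝ) 1) (fun _ => ⟨by linarith, by linarith⟩) ⟨hz, hz'⟩ t
  have mr := mem_r (r + ρ) (by linarith) hr1
  have mc := mem_c (l * b - η) (by linarith) (by linarith)
  have mr' := mem_r (r - ρ) (by linarith) (by linarith)
  have mc' := mem_c (l * b + η) (by linarith) (by linarith)
  have hW : ∀ w z, w * T / (2 * P) = |z| → 2 * P / T * |z| = w := by
    intro w z h
    rw [← h]
    field_simp
  have h0 : 0 < T / 2 := by omega
  have hqbar : ∀ z z' (hz) (hz'), z ≤ 2 * q * z' →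
      q ≤ (detInstance m d T (phase (T / 2) (fun _ => r) z) (phase (T / 2) (fun _ => l * b) z')
        hz hz').qbar b ∧
      (detInstance m d T (phase (T / 2) (fun _ => r) z) (phase (T / 2) (fun _ => l * b) z')
        hz hz').qbar b ≤ 2 * q := by
    intro z z' hz hz' hzz
    have := detInstance_qbar_mem (m := m) (d := d) (T := T) hz hz' hm hd hT1 (b := b) (p := 2 * q)
      (p₀ := 3 / 2 * q) hb (by positivity) (fun t => ?_) (by positivity) ?_ ?_
    · exact ⟨by linarith [this.1], this.2⟩
    · unfold phase
      split_ifs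
      · rw [hr]
        linarith [mul_nonneg hqb.le (by linarith : 0 ≤ l)]
      · exact hzz
    · rw [phase_of_lt _ _ h0, phase_of_lt _ _ h0, hr]
      ring
    · rw [phase_of_lt _ _ h0]
      exact hlb1
  obtain ⟨Ib, hIb⟩ : ∃ I, I = detInstance m d T (phase (T / 2) (fun _ => r) (r + ρ))
    (phase (T / 2) (fun _ => l * b) (l * b - η)) mr mc := ⟨_, rfl⟩
  obtain ⟨Iw, hIw⟩ : ∃ I, I = detInstance m d T (phase (T / 2) (fun _ => r) (r - ρ))
    (phase (T / 2) (fun _ => l * b) (l * b + η)) mr' mc' := ⟨_, rfl⟩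
  have prop : ∀ I ∈ ({Ib, Iw} : Set (BwK.Instance m d T)),
      I.W₁ = w₁ ∧ I.W₂ = w₂ ∧ q ≤ I.qbar b ∧ I.qbar b ≤ 2 * q := by
    rintro I (rfl | rfl)
    · rw [hIb]
      refine ⟨?_, ?_, hqbar _ _ _ _ ?_⟩
      · rw [detInstance_W₁ _ _ hm, sum_abs_sub_mean_phase hh hT1, ← hP]
        refine hW _ _ ?_
        rw [← hρ, sub_add_cancel_left, abs_neg, abs_of_nonneg hρ0]
      · rw [detInstance_W₂ _ _ hm hd, sum_abs_sub_mean_phase hh hT1, ← hP]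
        refine hW _ _ ?_
        rw [← hη, sub_sub_cancel, abs_of_nonneg hη0]
      · rw [hr]
        linarith
    · rw [hIw]
      refine ⟨?_, ?_, hqbar _ _ _ _ ?_⟩
      · rw [detInstance_W₁ _ _ hm, sum_abs_sub_mean_phase hh hT1, ← hP]
        refine hW _ _ ?_
        rw [← hρ, sub_sub_cancel, abs_of_nonneg hρ0]
      · rw [detInstance_W₂ _ _ hm hd, sum_abs_sub_mean_phase hh hT1, ← hP]
        refine hW _ _ ?_
        rw [← hη, sub_add_cancel_left, abs_neg, abs_of_nonneg hη0]
      · rw [hr]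
        have := mul_nonneg hq.le hη0
        linarith
  refine ⟨Ib, Iw, ⟨?_, ?_, ?_, ?_, ?_⟩, prop, ?_⟩
  · rw [hIb]; exact detInstance_isTwoPhase _ _
  · rw [hIw]; exact detInstance_isTwoPhase _ _
  · intro t ht
    rw [hIb, hIw]
    simp only [detInstance, phase_of_lt _ _ ht]
  · intro s t hs ht
    rw [hIb]
    simp only [detInstance_μ, detInstance_C, phase_of_lt _ _ hs, phase_of_le _ _ ht]
    refine ⟨fun _ => by linarith, fun j _ => ?_⟩
    split_ifs
    exacts [by linarith, le_rfl]
  · intro s t hs ht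
    rw [hIw]
    simp only [detInstance_μ, detInstance_C, phase_of_lt _ _ hs, phase_of_le _ _ ht]
    refine ⟨fun _ => by linarith, fun j _ => ?_⟩
    split_ifs
    exacts [by linarith, le_rfl]
  · intro π
    have hreg := half_switch_regret (m := m) (d := d) (c := fun _ => l * b) (δ := 0) hm hd hT hb
      hl1 hl2 hη0 (by rw [← hσ]; linarith) hρ0 hρr le_rfl (by positivity) (fun _ => le_rfl)
      (fun _ => by simp) mr mc mr' mc' π
    rw [← hIb, ← hIw] at hreg
    have hS : σ / 6 * (w₁ + q * w₂) ≤ Ib.regret (b * T) π + Iw.regret (b * T) π := by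
      refine le_trans ?_ hreg
      have e1 : (r * η + ρ * (l * b)) / (2 * (l * b)) = (3 / 2 * (q * η) + ρ) / 2 := by
        rw [hr]
        field_simp
      rw [e1, mul_zero, zero_div, add_zero, mul_one, ← hσ]
      have e2 : T * (σ / 3) ≤ T * σ / (2 * l) := by
        rw [le_div_iff₀ (by positivity)]
        have : T * σ * (2 * l) ≤ T * σ * 3 := mul_le_mul_of_nonneg_left (by linarith) (by positivity)
        linarith
      have e3 : (w₁ + q * w₂) / T ≤ (3 / 2 * (q * η) + ρ) / 2 := by
        have := mul_le_mul_of_nonneg_left hηl hq.le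
        have e : (w₁ + q * w₂) / T = w₁ / T + q * (w₂ / T) := by ring
        have e' : 2 * w₁ / T = 2 * (w₁ / T) := by ring
        have e'' : q * (2 * w₂ / T) = 2 * (q * (w₂ / T)) := by ring
        have : 0 ≤ q * (w₂ / T) := by positivity
        linarith
      have e4 : (w₁ + q * w₂) / T * (T * (σ / 3))
          ≤ (3 / 2 * (q * η) + ρ) / 2 * (T * σ / (2 * l)) :=
        mul_le_mul e3 e2 (by positivity) (by positivity)
      have e5 : (w₁ + q * w₂) / T * (T * (σ / 3)) = σ / 3 * (w₁ + q * w₂) := by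
        field_simp
      have e6 : 27 * (q * b) ≤ σ * (w₁ + q * w₂) := by
        have := mul_le_mul_of_nonneg_left hK hσ0.le
        have e : σ * (27 / σ * (q * b)) = 27 * (q * b) := by field_simp
        linarith
      have e7 : r ≤ 9 / 4 * (q * b) := by linarith
      linarith
    -- One factor `2` is lost through `qbar ≤ 2 * q`; the other is lost below, in passing from the
    -- sum of two regrets to the larger one.
    have hle : ∀ I ∈ ({Ib, Iw} : Set (BwK.Instance m d T)),
        σ / 24 * (I.W₁ + I.qbar b * I.W₂) ≤ σ / 12 * (w₁ + q * w₂) := by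
      intro I hI
      obtain ⟨p1, p2, -, p4⟩ := prop I hI
      rw [p1, p2]
      have := mul_le_mul_of_nonneg_right p4 hw₂
      have h5 : w₁ + I.qbar b * w₂ ≤ 2 * (w₁ + q * w₂) := by linarith
      have := mul_le_mul_of_nonneg_left h5 hσ0.le
      linarith
    rcases le_total (Ib.regret (b * T) π) (Iw.regret (b * T) π) with h | h
    · exact ⟨Iw, by simp, (hle Iw (by simp)).trans (by linarith)⟩
    · exact ⟨Ib, by simp, (hle Ib (by simp)).trans (by linarith)⟩

/-! ### Lower bound by the local variation of the consumption, part (ii). -/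

/-- Allows every comparison with the rate to be made between cubes, without fractional powers. -/
theorem cube_root_product_pow {x y z : ℝ} (hx : 0 ≤ x) (hy : 0 ≤ y) (hz : 0 ≤ z) :
    (x ^ (1 / 3 : ℝ) * y ^ (1 / 3 : ℝ) * z ^ (2 / 3 : ℝ)) ^ 3 = x * y * z ^ 2 := by
  have h1 : ∀ {x : ℝ}, 0 ≤ x → (x ^ (1 / 3 : ℝ)) ^ 3 = x := by
    intro x hx
    rw [← Real.rpow_natCast, ← Real.rpow_mul hx]
    norm_num
  have h2 : (z ^ (2 / 3 : ℝ)) ^ 3 = z ^ 2 := by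
    rw [← Real.rpow_natCast, ← Real.rpow_mul hz, ← Real.rpow_natCast z 2]
    norm_num
  rw [mul_pow, mul_pow, h1 hx, h1 hy, h2]

/-- The local variation of a sequence that alternates in the first phase. -/
theorem sum_abs_sub_succ_phase {h : ℕ} (hh : 1 ≤ h) (hT : h < T) {x δ y : ℝ} (hδ : 0 ≤ δ) :
    ∑ t ∈ Finset.range (T - 1), |phase h (fun t => x + δ * ((h - 1 - t) % 2 : ℕ)) y t
        - phase h (fun t => x + δ * ((h - 1 - t) % 2 : ℕ)) y (t + 1)| = δ * (h - 1 : ℕ) + |x - y| := by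
  have key : ∀ t, |phase h (fun t => x + δ * ((h - 1 - t) % 2 : ℕ)) y t
        - phase h (fun t => x + δ * ((h - 1 - t) % 2 : ℕ)) y (t + 1)|
      = (if t ∈ Finset.range (h - 1) then δ else 0) + (if t = h - 1 then |x - y| else 0) := by
    intro t
    simp only [Finset.mem_range]
    rcases lt_trichotomy t (h - 1) with h1 | h1 | h1
    · rw [phase_of_lt _ _ (by omega), phase_of_lt _ _ (by omega), if_pos h1, if_neg h1.ne, add_zero]
      have e' : ((h - 1 - (t + 1)) % 2 = 0 ∧ (h - 1 - t) % 2 = 1)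
          ∨ ((h - 1 - (t + 1)) % 2 = 1 ∧ (h - 1 - t) % 2 = 0) := by omega
      rcases e' with ⟨e1, e2⟩ | ⟨e1, e2⟩
      · rw [e1, e2]
        simp [abs_of_nonneg hδ]
      · rw [e1, e2]
        simp [abs_of_nonneg hδ]
    -- Counting the parity from `h - 1` makes the oscillation vanish in the last period of the first
    -- phase, so that the jump is exactly `|x - y|`.
    · rw [phase_of_lt _ _ (by omega), phase_of_le _ _ (by omega), if_neg (by omega), if_pos h1, h1]
      simp
    · rw [phase_of_le _ _ (by omega), phase_of_le _ _ (by omega), if_neg (by omega),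
        if_neg (by omega)]
      simp
  rw [Finset.sum_congr rfl fun t _ => key t, Finset.sum_add_distrib, Finset.sum_ite_mem,
    Finset.sum_ite_eq' , if_pos (by rw [Finset.mem_range]; omega)]
  have e2 : Finset.range (T - 1) ∩ Finset.range (h - 1) = Finset.range (h - 1) := by
    ext t; simp only [Finset.mem_inter, Finset.mem_range]; omega
  rw [e2]
  simp [mul_comm]

set_option maxHeartbeats 1000000 in
/-- Lower bound in terms of the local variation of the consumption. -/
theorem consumption_variation_lower_bound (b₀ : ℝ) (hb₀ : b₀ < 1) :
    ∃ c κ : ℝ, 0 < c ∧ 0 < κ ∧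
      ∀ (m d T : ℕ) (b V : ℝ), 1 ≤ m → 1 ≤ d → 1 ≤ T → 0 < b → b ≤ b₀ →
        Real.sqrt (m / T) ≤ V → V ≤ κ * b ^ 3 * T / m →
        ∀ π : BwK.Policy m d, ∃ I : BwK.Instance m d T,
          I.V₂ = V ∧ I.W₁ = 0 ∧
          c * ((1 / b) * (m : ℝ) ^ (1 / 3 : ℝ) * V ^ (1 / 3 : ℝ) * (T : ℝ) ^ (2 / 3 : ℝ))
            ≤ I.regret (b * T) π := by
  obtain ⟨l, hl1, hl2, hl⟩ := exists_rate b₀ hb₀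
  obtain ⟨σ, hσ⟩ : ∃ σ, σ = l - 1 := ⟨_, rfl⟩
  have hσ0 : 0 < σ := by linarith
  have hσ1 : σ ≤ 1 / 2 := by linarith
  -- With a cube, `(κ * T) ^ 2 * T = (T * (σ / 40) ^ 2) ^ 3`, so that the two bounds on `V` force `T
  -- * σ ^ 2 ≥ 1600`.
  obtain ⟨κ, hκ⟩ : ∃ κ, κ = (σ / 40) ^ 3 := ⟨_, rfl⟩
  have hκ0 : 0 < κ := by rw [hκ]; positivity
  have hκσ : 8000 * κ ≤ σ ^ 2 := by
    have : σ ^ 3 ≤ σ ^ 2 * (1 / 2) := by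
      rw [pow_succ]
      exact mul_le_mul_of_nonneg_left hσ1 (by positivity)
    rw [hκ, div_pow]
    linarith [sq_nonneg σ]
  have hσ2 : σ ^ 2 ≤ σ * (1 / 2) := by
    rw [sq]
    exact mul_le_mul_of_nonneg_left hσ1 hσ0.le
  refine ⟨σ ^ 2 / 144, κ, by positivity, hκ0, ?_⟩
  intro m d T b V hm hd hT1 hb hbb hV hVκ π
  have hT0 : (0 : ℝ) < T := by exact_mod_cast hT1
  have hm1 : (1 : ℝ) ≤ m := by exact_mod_cast hm
  have hm0 : (0 : ℝ) < m := by linarith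
  have hV0 : 0 < V := lt_of_lt_of_le (Real.sqrt_pos.2 (by positivity)) hV
  have hV2 : m ≤ V ^ 2 * T := by
    have := (Real.sqrt_le_left hV0.le).1 hV
    rwa [div_le_iff₀ hT0] at this
  have hσb0 : 0 < σ * b := by positivity
  have hlb1 : b ≤ l * b := le_mul_of_one_le_left hb.le hl1.le
  have hlbσ : l * b + σ * b ≤ 1 := by rw [hσ]; exact hl b hb hbb
  have hb1 : b ≤ 1 := by linarith
  have hVm : m * V ≤ κ * b ^ 3 * T := by
    rw [mul_comm]
    exact (le_div_iff₀ hm0).1 hVκ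
  have hb3 : b ^ 3 ≤ b := pow_le_of_le_one hb.le hb1 (by norm_num)
  have hVκT : V ≤ κ * b * T := by
    have h1 : V ≤ m * V := le_mul_of_one_le_left hV0.le hm1
    have h2 : κ * b ^ 3 * T ≤ κ * b * T := by gcongr
    linarith
  have hTσ : 1600 ≤ T * σ ^ 2 := by
    have h1 : V ≤ κ * T := by
      have : κ * b * T ≤ κ * 1 * T := by gcongr
      linarith
    have h2 : V ^ 2 ≤ (κ * T) ^ 2 := by gcongr
    have h3 : 1 ≤ (κ * T) ^ 2 * T := by
      have : V ^ 2 * T ≤ (κ * T) ^ 2 * T := by gcongr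
      linarith
    have h4 : (κ * T) ^ 2 * T = (T * (σ / 40) ^ 2) ^ 3 := by rw [hκ]; ring
    rw [h4] at h3
    have h5 : 1 ≤ T * (σ / 40) ^ 2 := by
      by_contra h
      have := pow_lt_one₀ (by positivity : 0 ≤ T * (σ / 40) ^ 2) (not_le.1 h)
        (by norm_num : (3 : ℕ) ≠ 0)
      linarith
    linarith
  have hTR : (6400 : ℝ) ≤ T := by
    have : σ ^ 2 ≤ 1 / 4 := by linarith
    have : T * σ ^ 2 ≤ T * (1 / 4) := mul_le_mul_of_nonneg_left this hT0.le
    linarith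
  have hT : 6400 ≤ T := by exact_mod_cast hTR
  -- The jump takes as much of `V` as the range of the consumption permits. The rest is spread
  -- evenly over the `T / 2 - 1` oscillation steps of height `δ`.
  obtain ⟨η, hη⟩ : ∃ η, η = min V (σ * b / 4) := ⟨_, rfl⟩
  have hη0 : 0 ≤ η := by rw [hη]; positivity
  have hηV : η ≤ V := by rw [hη]; exact min_le_left _ _
  have hησ : η ≤ σ * b / 4 := by rw [hη]; exact min_le_right _ _
  obtain ⟨δ, hδ⟩ : ∃ δ, δ = (V - η) / (T / 2 - 1 : ℕ) := ⟨_, rfl⟩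
  have hhalf : (T : ℝ) ≤ 4 * (T / 2 - 1 : ℕ) := by
    exact_mod_cast (by omega : T ≤ 4 * (T / 2 - 1))
  have hhalf0 : (0 : ℝ) < (T / 2 - 1 : ℕ) := by linarith
  have hδ0 : 0 ≤ δ := by
    rw [hδ]
    exact div_nonneg (by linarith) hhalf0.le
  have hδκ : δ ≤ 4 * κ * b := by
    rw [hδ, div_le_iff₀ hhalf0]
    have : κ * b * T ≤ κ * b * (4 * (T / 2 - 1 : ℕ)) := by gcongr
    linarith
  have hδσ : δ ≤ σ * b / 4 := by
    have : 4 * κ * b ≤ σ / 4 * b := mul_le_mul_of_nonneg_right (by linarith) hb.le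
    linarith
  have hσb1 : σ * b ≤ 1 / 2 * b := mul_le_mul_of_nonneg_right hσ1 hb.le
  obtain ⟨c, hc⟩ : ∃ c : ℕ → ℝ, c = fun t => l * b + δ * ((T / 2 - 1 - t) % 2 : ℕ) := ⟨_, rfl⟩
  have hc_bounds : ∀ t, l * b ≤ c t ∧ c t ≤ l * b + δ := by
    intro t
    have h1 : (((T / 2 - 1 - t) % 2 : ℕ) : ℝ) ≤ 1 := by
      exact_mod_cast (by omega : (T / 2 - 1 - t) % 2 ≤ 1)
    have h2 : (0 : ℝ) ≤ ((T / 2 - 1 - t) % 2 : ℕ) := Nat.cast_nonneg _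
    rw [hc]
    refine ⟨by linarith [mul_nonneg hδ0 h2], ?_⟩
    have := mul_le_mul_of_nonneg_left h1 hδ0
    linarith
  have mem_r : ∀ z, z = 1 → ∀ t, phase (T / 2) (fun _ => 1) z t ∈ Set.Icc (0 : ℝ) 1 := fun z hz t =>
    phase_mem (s := Set.Icc (0 : ℝ) 1) (fun _ => ⟨zero_le_one, le_rfl⟩)
      ⟨by linarith, by linarith⟩ t
  have mem_c : ∀ z, 0 ≤ z → z ≤ 1 → ∀ t, phase (T / 2) c z t ∈ Set.Icc (0 : ℝ) 1 :=
    fun z hz hz' t => phase_mem (s := Set.Icc (0 : ℝ) 1)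
      (fun t => ⟨by linarith [(hc_bounds t).1], by linarith [(hc_bounds t).2]⟩) ⟨hz, hz'⟩ t
  have mr := mem_r (1 + 0) (by norm_num)
  have mc := mem_c (l * b - η) (by linarith) (by linarith)
  have mr' := mem_r (1 - 0) (by norm_num)
  have mc' := mem_c (l * b + η) (by linarith) (by linarith)
  have hreg := half_switch_regret (m := m) (d := d) hm hd (by omega) hb
      hl1 hl2 hη0 (by rw [← hσ]; linarith) le_rfl zero_le_one hδ0 (by linarith)
      (fun t => (hc_bounds t).1) (fun t => (hc_bounds t).2) mr mc mr' mc' π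
  have hh : T / 2 ≤ T := Nat.div_le_self T 2
  have hW : ∀ z z' (hz : ∀ t, phase (T / 2) (fun _ => 1) z t ∈ Set.Icc (0 : ℝ) 1)
      (hz' : ∀ t, phase (T / 2) c z' t ∈ Set.Icc (0 : ℝ) 1), z = 1 →
      (detInstance m d T (phase (T / 2) (fun _ => 1) z) (phase (T / 2) c z') hz hz').W₁ = 0 := by
    rintro z z' hz hz' rfl
    rw [detInstance_W₁ _ _ hm, sum_abs_sub_mean_phase hh hT1]
    simp
  have hV' : ∀ z z' (hz : ∀ t, phase (T / 2) (fun _ => 1) z t ∈ Set.Icc (0 : ℝ) 1)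
      (hz' : ∀ t, phase (T / 2) c z' t ∈ Set.Icc (0 : ℝ) 1), |l * b - z'| = η →
      (detInstance m d T (phase (T / 2) (fun _ => 1) z) (phase (T / 2) c z') hz hz').V₂ = V := by
    intro z z' hz hz' h
    rw [detInstance_V₂ _ _ hm hd, hc, sum_abs_sub_succ_phase (by omega) (by omega) hδ0, h, hδ,
      div_mul_cancel₀ _ hhalf0.ne']
    ring
  obtain ⟨y, hy⟩ : ∃ y : ℝ, y = (m : ℝ) ^ (1 / 3 : ℝ) * V ^ (1 / 3 : ℝ) * (T : ℝ) ^ (2 / 3 : ℝ) :=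
    ⟨_, rfl⟩
  have hy3 : y ^ 3 = m * V * T ^ 2 := by rw [hy]; exact cube_root_product_pow hm0.le hV0.le hT0.le
  -- The two bounds on the target match the two cases below: `m ≤ V ^ 2 * T` gives `y ≤ V * T`, and
  -- `m * V ≤ κ * b ^ 3 * T` gives `y ≤ b * T`.
  have hyV : y ≤ V * T := by
    refine le_of_pow_le_pow_left₀ (by norm_num : (3 : ℕ) ≠ 0) (by positivity) ?_
    rw [hy3]
    calc m * V * T ^ 2 ≤ (V ^ 2 * T) * V * T ^ 2 := by gcongr
      _ = (V * T) ^ 3 := by ring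
  have hyb : y ≤ b * T := by
    refine le_of_pow_le_pow_left₀ (by norm_num : (3 : ℕ) ≠ 0) (by positivity) ?_
    rw [hy3]
    calc m * V * T ^ 2 ≤ (1 * b ^ 3 * T) * T ^ 2 := by
          have : κ * b ^ 3 * T ≤ 1 * b ^ 3 * T := by
            gcongr
            linarith
          exact mul_le_mul_of_nonneg_right (hVm.trans this) (sq_nonneg _)
      _ = (b * T) ^ 3 := by ring
  have hgoal : (1 / b) * (m : ℝ) ^ (1 / 3 : ℝ) * V ^ (1 / 3 : ℝ) * (T : ℝ) ^ (2 / 3 : ℝ) = y / b := by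
    rw [hy]; ring
  have hl4 : 2 * (l * b) * (2 * l) ≤ 9 * b := by
    have h1 : l * l ≤ 3 / 2 * (3 / 2) := mul_le_mul hl2 hl2 (by linarith) (by norm_num)
    have := mul_le_mul_of_nonneg_right h1 hb.le
    linarith
  have hS : σ ^ 2 / 72 * (y / b) ≤ (1 * η + 0 * (l * b)) / (2 * (l * b)) * (T * (l - 1) / (2 * l))
      - 2 * 1 * (1 + T * δ / (l * b)) := by
    have e1 : η * T * σ / (9 * b) ≤
        (1 * η + 0 * (l * b)) / (2 * (l * b)) * (T * (l - 1) / (2 * l)) := by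
      rw [one_mul, zero_mul, add_zero, ← hσ, div_mul_div_comm, ← mul_assoc]
      exact div_le_div_of_nonneg_left (by positivity) (by positivity) hl4
    refine le_trans ?_ (sub_le_sub_right e1 _)
    -- If `V` fits into the jump, there is no oscillation and the regret is of order `V * T / b`,
    -- with rounding covered by `V * T * σ ≥ 40`. Otherwise the jump is of order `b` and the regret
    -- of order `T`, while the oscillation loses at most `4 * κ * T` plays per schedule.
    rcases le_total V (σ * b / 4) with h | h
    · have e2 : η = V := by rw [hη, min_eq_left h]
      have e3 : δ = 0 := by rw [hδ, e2, sub_self, zero_div]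
      rw [e2, e3, mul_zero, zero_div, add_zero]
      have e4 : 40 ≤ V * T * σ := by
        refine le_of_pow_le_pow_left₀ (by norm_num : (2 : ℕ) ≠ 0) (by positivity) ?_
        have : 1 * (T * σ ^ 2) ≤ (V ^ 2 * T) * (T * σ ^ 2) := by
          gcongr
          linarith
        calc (40 : ℝ) ^ 2 ≤ 1 * (T * σ ^ 2) := by linarith
          _ ≤ (V ^ 2 * T) * (T * σ ^ 2) := this
          _ = (V * T * σ) ^ 2 := by ring
      have e5 : V * T * σ ≤ V * T * σ / b := by
        rw [le_div_iff₀ hb]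
        exact mul_le_of_le_one_right (by positivity) hb1
      have e6 : y / b * σ ≤ V * T * σ / b := by
        rw [div_mul_eq_mul_div]
        gcongr
      have e7 : V * T * σ / (9 * b) = (V * T * σ / b) / 9 := by
        rw [div_div, mul_comm b 9]
      have e8 : σ ^ 2 * (y / b) ≤ σ * (1 / 2) * (y / b) :=
        mul_le_mul_of_nonneg_right hσ2 (by rw [hy]; positivity)
      rw [e7]
      linarith
    · have e2 : η = σ * b / 4 := by rw [hη, min_eq_right h]
      have e3 : η * T * σ / (9 * b) = T * σ ^ 2 / 36 := by
        rw [e2]; field_simp; norm_num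
      have e4 : T * δ / (l * b) ≤ T * (4 * κ) := by
        rw [div_le_iff₀ (by positivity)]
        have : T * (4 * κ) * b ≤ T * (4 * κ) * (l * b) := by gcongr
        have := mul_le_mul_of_nonneg_left hδκ hT0.le
        linarith
      have e5 : y / b ≤ T := by
        rw [div_le_iff₀ hb, mul_comm]
        exact hyb
      have e6 := mul_le_mul_of_nonneg_left e5 (sq_nonneg σ)
      have e7 := mul_le_mul_of_nonneg_left hκσ hT0.le
      rw [e3]
      linarith
  rw [hgoal]
  rcases le_total ((detInstance m d T (phase (T / 2) (fun _ => 1) (1 + 0))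
      (phase (T / 2) c (l * b - η)) mr mc).regret (b * T) π)
    ((detInstance m d T (phase (T / 2) (fun _ => 1) (1 - 0))
      (phase (T / 2) c (l * b + η)) mr' mc').regret (b * T) π) with h | h
  · refine ⟨_, hV' _ _ mr' mc' ?_, hW _ _ mr' mc' (by norm_num), ?_⟩
    · rw [sub_add_cancel_left, abs_neg, abs_of_nonneg hη0]
    · linarith
  · refine ⟨_, hV' _ _ mr mc ?_, hW _ _ mr mc (by norm_num), ?_⟩
    · rw [sub_sub_cancel, abs_of_nonneg hη0]
    · linarith

/-! ### The law of the history, built period by period. -/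

namespace Policy

/-- One period of the interaction: append the observation of the outcome to the history. -/
def step (π : Policy m d) (t : ℕ) (p : (π.Seed × (Fin t → Observation m d)) × Outcome m d) :
    π.Seed × (Fin (t + 1) → Observation m d) :=
  (p.1.1, Fin.snoc p.1.2 (observe p.2 (π.act t p.1.1 p.1.2)))

theorem measurable_observe_act (π : Policy m d) (t : ℕ) :
    Measurable (fun p : (π.Seed × (Fin t → Observation m d)) × Outcome m d =>
      observe p.2 (π.act t p.1.1 p.1.2)) :=
  measurable_observe.comp (measurable_snd.prodMk ((π.measurable_act t).comp measurable_fst))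

theorem measurable_step (π : Policy m d) (t : ℕ) : Measurable (π.step t) :=
  (measurable_fst.comp measurable_fst).prodMk
    (measurable_snoc (measurable_snd.comp measurable_fst) (π.measurable_observe_act t))

/-- The joint law of the seed and of the observations of the first `t` periods. -/
def histLaw (π : Policy m d) (law : ℕ → Measure (Outcome m d)) :
    (t : ℕ) → Measure (π.Seed × (Fin t → Observation m d))
  | 0 => π.seedLaw.map fun s => (s, Fin.elim0)
  | t + 1 => ((π.histLaw law t).prod (law t)).map (π.step t)

instance (π : Policy m d) (law : ℕ → Measure (Outcome m d)) [∀ t, IsProbabilityMeasure (law t)]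
    (t : ℕ) : IsProbabilityMeasure (π.histLaw law t) := by
  induction t with
  | zero => exact Measure.isProbabilityMeasure_map (measurable_id.prodMk measurable_const).aemeasurable
  | succ t ih => exact Measure.isProbabilityMeasure_map (π.measurable_step t).aemeasurable

theorem histLaw_congr (π : Policy m d) {law law' : ℕ → Measure (Outcome m d)} (t : ℕ)
    (h : ∀ u < t, law u = law' u) : π.histLaw law t = π.histLaw law' t := by
  induction t with
  | zero => rfl
  | succ t ih =>
    simp only [histLaw]
    rw [ih fun u hu => h u (by omega), h t (by omega)]

end Policy

/-- Resampling one coordinate preserves a product measure. -/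
theorem measurePreserving_update {ι X : Type*} [Fintype ι] [DecidableEq ι] [MeasurableSpace X]
    (μ : ι → Measure X) [∀ i, IsProbabilityMeasure (μ i)] (t : ι) :
    MeasurePreserving (fun p : (ι → X) × X => Function.update p.1 t p.2)
      ((Measure.pi μ).prod (μ t)) (Measure.pi μ) := by
  have hm : Measurable (fun p : (ι → X) × X => Function.update p.1 t p.2) := measurable_update'
  refine ⟨hm, (Measure.pi_eq fun s hs => ?_).symm⟩
  rw [Measure.map_apply hm (MeasurableSet.univ_pi hs)]
  have e : (fun p : (ι → X) × X => Function.update p.1 t p.2) ⁻¹' Set.pi Set.univ s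
      = (Set.pi Set.univ (Function.update s t Set.univ)) ×ˢ s t := by
    ext ⟨ω, o⟩
    simp only [Set.mem_preimage, Set.mem_pi, Set.mem_univ, forall_true_left, Set.mem_prod]
    constructor
    · intro h
      refine ⟨fun i => ?_, by simpa using h t⟩
      by_cases hi : i = t
      · subst hi; simp
      · simpa [hi] using h i
    · rintro ⟨h1, h2⟩ i
      by_cases hi : i = t
      · subst hi; simpa using h2
      · simpa [hi] using h1 i
  rw [e, Measure.prod_prod, Measure.pi_pi, ← Finset.mul_prod_erase _ _ (Finset.mem_univ t),
    ← Finset.mul_prod_erase Finset.univ (fun i => μ i (s i)) (Finset.mem_univ t)]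
  rw [Finset.prod_congr rfl fun i hi => by
    rw [Function.update_of_ne (Finset.ne_of_mem_erase hi)]]
  simp [mul_comm]

namespace Policy

theorem measurePreserving_resample (π : Policy m d) (I : Instance m d T) (t : Fin T) :
    MeasurePreserving (fun p : (π.Seed × (Fin T → Outcome m d)) × Outcome m d =>
      (p.1.1, Function.update p.1.2 t p.2)) ((π.jointLaw I).prod (I.law t)) (π.jointLaw I) := by
  have := I.isProbabilityMeasure_law
  unfold jointLaw
  exact ((MeasurePreserving.id π.seedLaw).prod (measurePreserving_update I.law t)).comp
    (measurePreserving_prodAssoc _ _ _)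

/-- The current outcome is independent of the seed and of the history. -/
theorem map_history_outcome (π : Policy m d) (I : Instance m d T) (t : Fin T) :
    (π.jointLaw I).map (fun p => ((p.1, π.history p.1 p.2 t t.isLt.le), p.2 t))
      = ((π.jointLaw I).map (fun p => (p.1, π.history p.1 p.2 t t.isLt.le))).prod (I.law t) := by
  have := I.isProbabilityMeasure_law
  have hh : Measurable (fun p : π.Seed × (Fin T → Outcome m d) =>
      (p.1, π.history p.1 p.2 t t.isLt.le)) :=
    measurable_fst.prodMk (π.measurable_history t t.isLt.le)
  have hg : Measurable (fun p : π.Seed × (Fin T → Outcome m d) =>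
      ((p.1, π.history p.1 p.2 t t.isLt.le), p.2 t)) :=
    hh.prodMk ((measurable_pi_apply t).comp measurable_snd)
  have hr := π.measurePreserving_resample I t
  -- Replacing the outcome of period `t` by a fresh copy changes neither the joint law nor the
  -- history before `t`, and the fresh copy is independent by construction.
  conv_lhs => rw [← hr.map_eq]
  rw [Measure.map_map hg hr.measurable]
  have e : (fun p : π.Seed × (Fin T → Outcome m d) =>
      ((p.1, π.history p.1 p.2 t t.isLt.le), p.2 t)) ∘
        (fun p : (π.Seed × (Fin T → Outcome m d)) × Outcome m d =>
          (p.1.1, Function.update p.1.2 t p.2))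
      = Prod.map (fun p : π.Seed × (Fin T → Outcome m d) =>
          (p.1, π.history p.1 p.2 t t.isLt.le)) id := by
    funext p
    refine Prod.ext (Prod.ext rfl ?_) (by simp)
    refine π.history_congr _ t t.isLt.le fun u hu => ?_
    refine Function.update_of_ne ?_ _ _
    rintro rfl
    exact lt_irrefl _ hu
  rw [e, ← Measure.map_prod_map _ _ hh measurable_id, Measure.map_id]

/-- Links two descriptions of a run: values are defined on the product space of outcomes, while
changes of measure are proved by induction on the recursive `histLaw`. -/
theorem map_history (π : Policy m d) (I : Instance m d T) {law : ℕ → Measure (Outcome m d)}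
    (hlaw : ∀ t : Fin T, I.law t = law t) (t : ℕ) (h : t ≤ T) :
    (π.jointLaw I).map (fun p => (p.1, π.history p.1 p.2 t h)) = π.histLaw law t := by
  have := I.isProbabilityMeasure_law
  induction t with
  | zero =>
    have e : (fun p : π.Seed × (Fin T → Outcome m d) => (p.1, π.history p.1 p.2 0 h))
        = (fun s => (s, Fin.elim0)) ∘ Prod.fst := rfl
    have hm : Measurable (fun s : π.Seed => (s, (Fin.elim0 : Fin 0 → Observation m d))) :=
      measurable_id.prodMk measurable_const
    rw [e, ← Measure.map_map hm measurable_fst]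
    simp only [histLaw]
    congr 1
    exact measurePreserving_fst.map_eq
  | succ t ih =>
    have e : (fun p : π.Seed × (Fin T → Outcome m d) => (p.1, π.history p.1 p.2 (t + 1) h))
        = π.step t ∘ fun p => ((p.1, π.history p.1 p.2 (⟨t, h⟩ : Fin T) (Nat.le_of_succ_le h)),
          p.2 ⟨t, h⟩) := rfl
    have hg : Measurable (fun p : π.Seed × (Fin T → Outcome m d) =>
        ((p.1, π.history p.1 p.2 (⟨t, h⟩ : Fin T) (Nat.le_of_succ_le h)), p.2 ⟨t, h⟩)) :=
      (measurable_fst.prodMk (π.measurable_history t _)).prodMk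
        ((measurable_pi_apply _).comp measurable_snd)
    rw [e, ← Measure.map_map (π.measurable_step t) hg, π.map_history_outcome I ⟨t, h⟩]
    simp only [histLaw]
    rw [ih (Nat.le_of_succ_le h), hlaw]

/-- The expected reward of the arm that is played in the period `t`. -/
theorem integral_gain_action (π : Policy m d) (I : Instance m d T)
    {law : ℕ → Measure (Outcome m d)} [∀ t, IsProbabilityMeasure (law t)]
    (hlaw : ∀ t : Fin T, I.law t = law t) (t : Fin T) :
    Integrable (fun p => gain (p.2 t) (π.action p.1 p.2 t)) (π.jointLaw I) ∧
    ∫ p, gain (p.2 t) (π.action p.1 p.2 t) ∂(π.jointLaw I)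
      = ∫ p, (∫ o, gain o (π.act t p.1 p.2) ∂(I.law t)) ∂(π.histLaw law t) := by
  have := I.isProbabilityMeasure_law
  have hint : Integrable (fun p => gain (p.2 t) (π.action p.1 p.2 t)) (π.jointLaw I) := by
    refine Integrable.of_bound (π.measurable_gain_action t).aestronglyMeasurable 1 ?_
    filter_upwards [π.ae_jointLaw I I.reward_mem] with p hp
    have := gain_mem (hp t) (π.action p.1 p.2 t)
    rw [Real.norm_of_nonneg this.1]
    exact this.2
  refine ⟨hint, ?_⟩
  have hg : Measurable (fun p : π.Seed × (Fin T → Outcome m d) =>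
      ((p.1, π.history p.1 p.2 t t.isLt.le), p.2 t)) :=
    (measurable_fst.prodMk (π.measurable_history t _)).prodMk
      ((measurable_pi_apply _).comp measurable_snd)
  have hG : Measurable (fun z : (π.Seed × (Fin t → Observation m d)) × Outcome m d =>
      gain z.2 (π.act t z.1.1 z.1.2)) :=
    measurable_gain.comp (measurable_snd.prodMk ((π.measurable_act t).comp measurable_fst))
  have hmap := π.map_history_outcome I t
  rw [π.map_history I hlaw] at hmap
  have h1 : ∫ p, gain (p.2 t) (π.action p.1 p.2 t) ∂(π.jointLaw I)
      = ∫ z, gain z.2 (π.act t z.1.1 z.1.2) ∂((π.histLaw law t).prod (I.law t)) := by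
    rw [← hmap, integral_map hg.aemeasurable hG.aestronglyMeasurable]
    rfl
  rw [h1, integral_prod]
  rw [← hmap, integrable_map_measure hG.aestronglyMeasurable hg.aemeasurable]
  exact hint

end Policy

/-! ### Bernoulli rewards and their observations. -/

/-- The outcome in which the arm `i` has the reward `1` if `u ≤ p i` and `0` otherwise, and
nothing is consumed. -/
def thresholdOutcome (d : ℕ) (p : Fin m → ℝ) (u : ℝ) : Outcome m d :=
  (fun i => if u ≤ p i then 1 else 0, fun _ _ => 0)

theorem measurable_thresholdOutcome (p : Fin m → ℝ) : Measurable (thresholdOutcome d p) := by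
  refine Measurable.prodMk (measurable_pi_lambda _ fun i => ?_) measurable_const
  exact Measurable.ite measurableSet_Iic measurable_const measurable_const

/-- The law of an outcome with Bernoulli rewards of means `p` and without consumption. -/
def bernoulliLaw (d : ℕ) (p : Fin m → ℝ) : Measure (Outcome m d) :=
  (volume.restrict (Set.Icc (0 : ℝ) 1)).map (thresholdOutcome d p)

instance : IsProbabilityMeasure (volume.restrict (Set.Icc (0 : ℝ) 1)) := ⟨by simp⟩

instance (p : Fin m → ℝ) : IsProbabilityMeasure (bernoulliLaw d p) :=
  Measure.isProbabilityMeasure_map (measurable_thresholdOutcome p).aemeasurable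

theorem ae_bernoulliLaw (p : Fin m → ℝ) {P : Outcome m d → Prop}
    (hP : MeasurableSet {o | P o}) (h : ∀ u, P (thresholdOutcome d p u)) :
    ∀ᵐ o ∂(bernoulliLaw d p), P o := by
  unfold bernoulliLaw
  rw [ae_map_iff (measurable_thresholdOutcome p).aemeasurable hP]
  exact ae_of_all _ h

/-- The observation of the arm `i` with reward `x` and without consumption. -/
def rewardObservation (d : ℕ) (i : Fin m) (x : ℝ) : Observation m d := (pull i, x, fun _ => 0)

theorem measurable_observe_left (a : Action m) :
    Measurable (fun o : Outcome m d => observe o a) :=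
  measurable_observe.comp (measurable_id.prodMk measurable_const)

/-- One uniform variable drives all arms, which makes their rewards dependent. Under bandit feedback
this is harmless, since only the marginal law of the played arm is seen. -/
theorem map_observe_bernoulliLaw (p : Fin m → ℝ) (i : Fin m) (hp : p i ∈ Set.Icc (0 : ℝ) 1) :
    (bernoulliLaw d p).map (fun o => observe o (pull i))
      = ENNReal.ofReal (p i) • Measure.dirac (rewardObservation d i 1)
        + ENNReal.ofReal (1 - p i) • Measure.dirac (rewardObservation d i 0) := by
  unfold bernoulliLaw
  have hm := (measurable_observe_left (m := m) (d := d) (pull i)).comp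
    (measurable_thresholdOutcome p)
  rw [Measure.map_map (measurable_observe_left _) (measurable_thresholdOutcome p)]
  ext S hS
  rw [Measure.map_apply hm hS, Measure.restrict_apply (hm hS)]
  simp only [Measure.add_apply, Measure.smul_apply, smul_eq_mul, Measure.dirac_apply' _ hS]
  have key : ∀ u, u ∈ (fun o => observe o (pull i)) ∘ (thresholdOutcome d p) ⁻¹' S ↔
      rewardObservation d i (if u ≤ p i then 1 else 0) ∈ S := fun u => Iff.rfl
  by_cases h1 : rewardObservation d i 1 ∈ S <;> by_cases h0 : rewardObservation d i 0 ∈ S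
  · have e : (fun o => observe o (pull i)) ∘ (thresholdOutcome d p) ⁻¹' S ∩ Set.Icc 0 1
        = Set.Icc (0 : ℝ) 1 := by
      refine Set.inter_eq_right.2 fun u _ => (key u).2 ?_
      split_ifs <;> assumption
    rw [e]
    simp [h1, h0, ← ENNReal.ofReal_add hp.1 (sub_nonneg.2 hp.2)]
  · have e : (fun o => observe o (pull i)) ∘ (thresholdOutcome d p) ⁻¹' S ∩ Set.Icc 0 1
        = Set.Icc 0 (p i) := by
      ext u
      rw [Set.mem_inter_iff, key]
      by_cases hu : u ≤ p i
      · simp [hu, h1, hu.trans hp.2]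
      · simp [hu, h0]
    rw [e]
    simp [h1, h0]
  · have e : (fun o => observe o (pull i)) ∘ (thresholdOutcome d p) ⁻¹' S ∩ Set.Icc 0 1
        = Set.Ioc (p i) 1 := by
      ext u
      rw [Set.mem_inter_iff, key]
      by_cases hu : u ≤ p i
      · simp [hu, h1]
      · have : 0 ≤ u := hp.1.trans (not_le.1 hu).le
        simp [hu, h0, this, not_le.1 hu]
    rw [e]
    simp [h1, h0]
  · have e : (fun o => observe o (pull i)) ∘ (thresholdOutcome d p) ⁻¹' S ∩ Set.Icc 0 1
        = ∅ := by
      ext u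
      rw [Set.mem_inter_iff, key]
      split_ifs <;> simp [h1, h0]
    rw [e]
    simp [h1, h0]

theorem lintegral_observe_bernoulliLaw (p : Fin m → ℝ) (i : Fin m) (hp : p i ∈ Set.Icc (0 : ℝ) 1)
    {f : Observation m d → ENNReal} (hf : Measurable f) :
    ∫⁻ o, f (observe o (pull i)) ∂(bernoulliLaw d p)
      = ENNReal.ofReal (p i) * f (rewardObservation d i 1)
        + ENNReal.ofReal (1 - p i) * f (rewardObservation d i 0) := by
  rw [← lintegral_map hf (measurable_observe_left _), map_observe_bernoulliLaw p i hp,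
    lintegral_add_measure, lintegral_smul_measure, lintegral_smul_measure,
    lintegral_dirac' _ hf, lintegral_dirac' _ hf]
  rfl

theorem integral_observe_bernoulliLaw (p : Fin m → ℝ) (i : Fin m) (hp : p i ∈ Set.Icc (0 : ℝ) 1)
    {f : Observation m d → ℝ} (hf : Measurable f) :
    ∫ o, f (observe o (pull i)) ∂(bernoulliLaw d p)
      = p i * f (rewardObservation d i 1) + (1 - p i) * f (rewardObservation d i 0) := by
  have hi : ∀ x, Integrable f (Measure.dirac (rewardObservation d i x)) := fun x =>
    integrable_dirac' hf.stronglyMeasurable (by simp)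
  rw [← integral_map (measurable_observe_left _).aemeasurable hf.aestronglyMeasurable,
    map_observe_bernoulliLaw p i hp, integral_add_measure
      ((hi 1).smul_measure ENNReal.ofReal_ne_top) ((hi 0).smul_measure ENNReal.ofReal_ne_top),
    integral_smul_measure, integral_smul_measure, integral_dirac' _ _ hf.stronglyMeasurable,
    integral_dirac' _ _ hf.stronglyMeasurable, ENNReal.toReal_ofReal hp.1,
    ENNReal.toReal_ofReal (sub_nonneg.2 hp.2)]
  rfl

theorem integral_gain_bernoulliLaw (p : Fin m → ℝ) (i : Fin m) (hp : p i ∈ Set.Icc (0 : ℝ) 1) :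
    ∫ o, gain o (pull i) ∂(bernoulliLaw d p) = p i := by
  have := integral_observe_bernoulliLaw (d := d) p i hp (f := fun x => x.2.1)
    (measurable_fst.comp measurable_snd)
  refine this.trans ?_
  simp [rewardObservation]

/-! ### Change of measure between histories. -/

namespace Policy

/-- The probability that the action `a` is played in the period `t`. -/
def playProb (π : Policy m d) (law : ℕ → Measure (Outcome m d)) (t : ℕ) (a : Action m) : ℝ :=
  (π.histLaw law t).real {p | π.act t p.1 p.2 = a}

theorem playProb_congr (π : Policy m d) {law law' : ℕ → Measure (Outcome m d)} {t : ℕ}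
    (h : ∀ u < t, law u = law' u) (a : Action m) : π.playProb law t a = π.playProb law' t a := by
  unfold playProb
  rw [π.histLaw_congr t h]

theorem measurableSet_act (π : Policy m d) (t : ℕ) (a : Action m) :
    MeasurableSet {p : π.Seed × (Fin t → Observation m d) | π.act t p.1 p.2 = a} :=
  π.measurable_act t (MeasurableSet.of_discrete : MeasurableSet {a})

/-- The events are disjoint; the missing mass is the probability of the null arm. -/
theorem sum_playProb_le (π : Policy m d) (law : ℕ → Measure (Outcome m d))
    [∀ t, IsProbabilityMeasure (law t)] (t : ℕ) : ∑ i, π.playProb law t (pull i) ≤ 1 := by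
  unfold playProb
  rw [← measureReal_biUnion_finset]
  · exact measureReal_le_one
  · intro i _ j _ hij
    refine Set.disjoint_left.2 fun p hp hp' => hij (pull_injective ?_)
    exact (Set.mem_ofPred.1 hp).symm.trans (Set.mem_ofPred.1 hp')
  · exact fun i _ => π.measurableSet_act t _

theorem lintegral_histLaw_succ (π : Policy m d) (law : ℕ → Measure (Outcome m d))
    [∀ t, IsProbabilityMeasure (law t)] (t : ℕ)
    {f : π.Seed × (Fin (t + 1) → Observation m d) → ENNReal} (hf : Measurable f) :
    ∫⁻ z, f z ∂(π.histLaw law (t + 1))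
      = ∫⁻ p, ∫⁻ o, f (π.step t (p, o)) ∂(law t) ∂(π.histLaw law t) := by
  simp only [histLaw]
  rw [lintegral_map hf (π.measurable_step t)]
  exact lintegral_prod _ (hf.comp (π.measurable_step t)).aemeasurable

/-- Change of measure: a likelihood ratio of the single observations yields a likelihood ratio of
the histories. -/
theorem lintegral_histLaw_change (π : Policy m d) (P Q : ℕ → Measure (Outcome m d))
    [∀ t, IsProbabilityMeasure (P t)] [∀ t, IsProbabilityMeasure (Q t)]
    {ratio : ℕ → Observation m d → ENNReal} (hr : ∀ t, Measurable (ratio t)) (t : ℕ)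
    (H : ∀ u < t, ∀ (a : Action m) (f : Observation m d → ENNReal), Measurable f →
      ∫⁻ o, f (observe o a) ∂(P u) = ∫⁻ o, f (observe o a) * ratio u (observe o a) ∂(Q u))
    {f : π.Seed × (Fin t → Observation m d) → ENNReal} (hf : Measurable f) :
    ∫⁻ z, f z ∂(π.histLaw P t) = ∫⁻ z, f z * ∏ u : Fin t, ratio u (z.2 u) ∂(π.histLaw Q t) := by
  induction t with
  | zero => simp [histLaw]
  | succ t ih =>
    have hL : ∀ t : ℕ, Measurable (fun z : π.Seed × (Fin t → Observation m d) =>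
        ∏ u : Fin t, ratio u (z.2 u)) := fun t =>
      Finset.measurable_prod _ fun u _ =>
        (hr u).comp ((measurable_pi_apply u).comp measurable_snd)
    have hfs : Measurable (fun z : (π.Seed × (Fin t → Observation m d)) × Outcome m d =>
        f (π.step t z)) := hf.comp (π.measurable_step t)
    have hfL : Measurable (fun z : π.Seed × (Fin (t + 1) → Observation m d) =>
        f z * ∏ u : Fin (t + 1), ratio u (z.2 u)) := hf.mul (hL _)
    rw [π.lintegral_histLaw_succ P t hf, π.lintegral_histLaw_succ Q t hfL,
      ih (fun u hu => H u (by omega)) (hfs.lintegral_prod_right')]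
    refine lintegral_congr fun p => ?_
    -- Given seed and history the next action is fixed, so the one-period hypothesis applies to `f`
    -- as a function of the last observation alone.
    have h1 := H t (Nat.lt_succ_self t) (π.act t p.1 p.2)
      (fun x => f (p.1, Fin.snoc p.2 x)) (hf.comp (measurable_const.prodMk
        (measurable_snoc measurable_const measurable_id)))
    simp only [step]
    rw [h1, ← lintegral_mul_const]
    · refine lintegral_congr fun o => ?_
      rw [Fin.prod_univ_castSucc]
      simp only [Fin.snoc_castSucc, Fin.snoc_last, Fin.val_castSucc, Fin.val_last]
      ring
    · exact ((hf.comp (measurable_const.prodMk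
        (measurable_snoc measurable_const measurable_id))).mul (hr t)).comp
          (measurable_observe_left _)

end Policy

/-- The likelihood ratio of an observation when the mean reward of the arm `i` is raised from
`1 / 2` to `1 / 2 + ε`. -/
def armRatio (ε : ℝ) (i : Fin m) (x : Observation m d) : ℝ :=
  if x.1 = pull i then (if x.2.1 = 1 then 1 + 2 * ε else 1 - 2 * ε) else 1

/-- The likelihood ratio of the observation of the period `t` when the mean reward of the arm `i`
is raised from the time `s` on. -/
def windowRatio (ε : ℝ) (i : Fin m) (s t : ℕ) (x : Observation m d) : ℝ :=
  if s ≤ t then armRatio ε i x else 1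

theorem measurable_armRatio (ε : ℝ) (i : Fin m) :
    Measurable (armRatio ε i : Observation m d → ℝ) := by
  refine Measurable.ite (measurable_fst (MeasurableSet.of_discrete : MeasurableSet {pull i}))
    (Measurable.ite ?_ measurable_const measurable_const) measurable_const
  exact (measurable_fst.comp measurable_snd) (measurableSet_singleton (1 : ℝ))

theorem measurable_windowRatio (ε : ℝ) (i : Fin m) (s t : ℕ) :
    Measurable (windowRatio ε i s t : Observation m d → ℝ) := by
  unfold windowRatio
  split_ifs
  exacts [measurable_armRatio ε i, measurable_const]

theorem windowRatio_mem {ε : ℝ} (h0 : 0 ≤ ε) (h1 : ε ≤ 1 / 4) (i : Fin m) (s t : ℕ)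
    (x : Observation m d) : windowRatio ε i s t x ∈ Set.Icc (1 / 2 : ℝ) 2 := by
  unfold windowRatio armRatio
  split_ifs <;> constructor <;> linarith

theorem armRatio_of_ne (ε : ℝ) {i : Fin m} {a : Action m} (ha : a ≠ pull i) (o : Outcome m d) :
    armRatio ε i (observe o a) = 1 := by
  unfold armRatio
  exact if_neg ha

/-- The mean rewards `1 / 2`, raised by `ε` for the arm `i`. -/
def raised (ε : ℝ) (i : Fin m) (k : Fin m) : ℝ := if k = i then 1 / 2 + ε else 1 / 2

/-- For the raised arm, `1 / 2 + ε` and `1 / 2 - ε` are `1 / 2` times `1 + 2 * ε` and `1 - 2 * ε`.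
Any other action has the same observation law under both environments. -/
theorem lintegral_observe_raised {ε : ℝ} (h0 : 0 ≤ ε) (h1 : ε ≤ 1 / 4) (i : Fin m) (a : Action m)
    {f : Observation m d → ENNReal} (hf : Measurable f) :
    ∫⁻ o, f (observe o a) ∂(bernoulliLaw d (raised ε i))
      = ∫⁻ o, f (observe o a) * ENNReal.ofReal (armRatio ε i (observe o a))
          ∂(bernoulliLaw d fun _ : Fin m => (1 / 2 : ℝ)) := by
  have hhalf : (1 / 2 : ℝ) ∈ Set.Icc (0 : ℝ) 1 := by constructor <;> norm_num
  have hr : ∀ k : Fin m, raised ε i k ∈ Set.Icc (0 : ℝ) 1 := by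
    intro k
    unfold raised
    split_ifs <;> constructor <;> linarith
  by_cases ha : a = pull i
  · subst ha
    have hm : Measurable (fun x : Observation m d => f x * ENNReal.ofReal (armRatio ε i x)) :=
      hf.mul (measurable_armRatio ε i).ennreal_ofReal
    rw [lintegral_observe_bernoulliLaw _ i (hr i) hf,
      lintegral_observe_bernoulliLaw (fun _ => (1 / 2 : ℝ)) i hhalf hm]
    have e1 : armRatio ε i (rewardObservation d i 1) = 1 + 2 * ε := by
      unfold armRatio rewardObservation
      simp
    have e0 : armRatio ε i (rewardObservation d i 0) = 1 - 2 * ε := by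
      unfold armRatio rewardObservation
      simp
    rw [e1, e0]
    have e2 : raised ε i i = 1 / 2 + ε := if_pos rfl
    rw [e2]
    have e3 : ENNReal.ofReal (1 / 2 + ε) = ENNReal.ofReal (1 / 2) * ENNReal.ofReal (1 + 2 * ε) := by
      rw [← ENNReal.ofReal_mul (by norm_num)]
      congr 1
      ring
    have e4 : ENNReal.ofReal (1 - (1 / 2 + ε))
        = ENNReal.ofReal (1 - 1 / 2) * ENNReal.ofReal (1 - 2 * ε) := by
      rw [← ENNReal.ofReal_mul (by norm_num)]
      congr 1
      ring
    rw [e3, e4]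
    ring
  · simp only [armRatio_of_ne ε ha, ENNReal.ofReal_one, mul_one]
    rcases eq_idle_or_pull a with rfl | ⟨k, rfl⟩
    · have e : ∀ o : Outcome m d, f (observe o idle) = f (observe 0 idle) := fun o => rfl
      simp only [e, lintegral_const, measure_univ]
    · have hk : k ≠ i := fun h => ha (by rw [h])
      rw [lintegral_observe_bernoulliLaw _ k (hr k) hf,
        lintegral_observe_bernoulliLaw (fun _ => (1 / 2 : ℝ)) k hhalf hf]
      have e2 : raised ε i k = 1 / 2 := if_neg hk
      rw [e2]

/-- The relative entropy of one observation of the raised arm is `-log (1 - 4 * ε ^ 2) / 2`,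
estimated by `log x ≥ 1 - 1 / x`. Other actions reveal nothing. -/
theorem integral_neg_log_armRatio_le {ε : ℝ} (h0 : 0 ≤ ε) (h1 : ε ≤ 1 / 4) (i : Fin m)
    (a : Action m) :
    ∫ o, -Real.log (armRatio ε i (observe o a)) ∂(bernoulliLaw d fun _ : Fin m => (1 / 2 : ℝ))
      ≤ if a = pull i then 4 * ε ^ 2 else 0 := by
  by_cases ha : a = pull i
  · subst ha
    have hhalf : (1 / 2 : ℝ) ∈ Set.Icc (0 : ℝ) 1 := by constructor <;> norm_num
    rw [if_pos rfl, integral_observe_bernoulliLaw (fun _ => (1 / 2 : ℝ)) i hhalf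
      (f := fun x => -Real.log (armRatio ε i x)) (measurable_armRatio ε i).log.neg]
    have e1 : armRatio ε i (rewardObservation d i 1) = 1 + 2 * ε := by
      unfold armRatio rewardObservation
      simp
    have e0 : armRatio ε i (rewardObservation d i 0) = 1 - 2 * ε := by
      unfold armRatio rewardObservation
      simp
    rw [e1, e0]
    have h2 : 0 < 1 - 4 * ε ^ 2 := by nlinarith
    have h3 := Real.one_sub_inv_le_log_of_pos h2
    have h4 : Real.log (1 - 4 * ε ^ 2) = Real.log (1 + 2 * ε) + Real.log (1 - 2 * ε) := by
      rw [← Real.log_mul (by linarith) (by linarith)]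
      congr 1
      ring
    have h5 : -(8 * ε ^ 2) ≤ 1 - (1 - 4 * ε ^ 2)⁻¹ := by
      have : (1 - 4 * ε ^ 2)⁻¹ ≤ 1 + 8 * ε ^ 2 := by
        rw [inv_le_iff_one_le_mul₀ h2]
        have h6 : ε ^ 2 ≤ 1 / 8 := by nlinarith
        nlinarith [mul_nonneg (sq_nonneg ε) (sub_nonneg.2 h6)]
      linarith
    linarith
  · simp [armRatio_of_ne ε ha, ha]

/-- A pointwise substitute for Pinsker's inequality. With `x` a likelihood ratio of mean one, the
expectation of `x - 1 - log x` is the relative entropy. The bound is the tangent of the logarithm at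
`4 / 3`, with `log (3 / 4) ≥ -1 / 3`. -/
theorem le_third_add_sub_log {x : ℝ} (hx : 0 < x) :
    x - 1 ≤ 1 / 3 + 4 * (x - 1 - Real.log x) := by
  have h1 := Real.log_le_sub_one_of_pos (show 0 < x * (3 / 4) by positivity)
  rw [Real.log_mul hx.ne' (by norm_num)] at h1
  have h2 := Real.one_sub_inv_le_log_of_pos (show (0 : ℝ) < 3 / 4 by norm_num)
  norm_num at h2
  linarith

theorem integrable_log_windowRatio {ε : ℝ} (h0 : 0 ≤ ε) (h1 : ε ≤ 1 / 4)
    (i : Fin m) (s u : ℕ) {Ω : Type*} [MeasurableSpace Ω] (μ : Measure Ω) [IsFiniteMeasure μ]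
    {g : Ω → Observation m d} (hg : Measurable g) :
    Integrable (fun z => -Real.log (windowRatio ε i s u (g z))) μ := by
  refine Integrable.of_bound
    ((measurable_windowRatio ε i s u).comp hg).log.neg.aestronglyMeasurable (Real.log 2)
    (ae_of_all _ fun z => ?_)
  obtain ⟨h2, h3⟩ := windowRatio_mem h0 h1 i s u (g z)
  rw [norm_neg, Real.norm_eq_abs, abs_le]
  constructor
  · have := Real.log_le_log (by norm_num) h2
    rwa [one_div, Real.log_inv] at this
  · exact Real.log_le_log (by linarith) h3

namespace Policy

/-- The relative entropy of the histories is at most `4 * ε ^ 2` times the expected number of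
plays of the arm `i`. -/
theorem integral_neg_log_ratio_le (π : Policy m d) (Q : ℕ → Measure (Outcome m d))
    [∀ t, IsProbabilityMeasure (Q t)] {ε : ℝ} (h0 : 0 ≤ ε) (h1 : ε ≤ 1 / 4) (i : Fin m) (s t : ℕ)
    (hQ : ∀ u < t, s ≤ u → Q u = bernoulliLaw d fun _ => (1 / 2 : ℝ)) :
    ∫ z, ∑ u : Fin t, -Real.log (windowRatio ε i s u (z.2 u)) ∂(π.histLaw Q t)
      ≤ ∑ u ∈ Finset.Ico s t, 4 * ε ^ 2 * π.playProb Q u (pull i) := by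
  induction t with
  | zero => simp
  | succ t ih =>
    have hL : ∀ t : ℕ, Measurable (fun z : π.Seed × (Fin t → Observation m d) =>
        ∑ u : Fin t, -Real.log (windowRatio ε i s u (z.2 u))) := fun t =>
      Finset.measurable_sum _ fun u _ => ((measurable_windowRatio ε i s u).comp
        ((measurable_pi_apply u).comp measurable_snd)).log.neg
    have hi1 : Integrable (fun p : (π.Seed × (Fin t → Observation m d)) × Outcome m d =>
        ∑ u : Fin t, -Real.log (windowRatio ε i s u (p.1.2 u))) ((π.histLaw Q t).prod (Q t)) :=
      integrable_finsetSum _ fun u _ => integrable_log_windowRatio h0 h1 i s u _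
        ((measurable_pi_apply u).comp (measurable_snd.comp measurable_fst))
    have hi2 := integrable_log_windowRatio h0 h1 i s t ((π.histLaw Q t).prod (Q t))
      (π.measurable_observe_act t)
    -- Chain rule of relative entropy: the new term is the conditional entropy of the last
    -- observation given the history.
    have e1 : ∫ z, ∑ u : Fin (t + 1), -Real.log (windowRatio ε i s u (z.2 u))
          ∂(π.histLaw Q (t + 1))
        = ∫ z, ∑ u : Fin t, -Real.log (windowRatio ε i s u (z.2 u)) ∂(π.histLaw Q t)
          + ∫ p, ∫ o, -Real.log (windowRatio ε i s t (observe o (π.act t p.1 p.2))) ∂(Q t)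
            ∂(π.histLaw Q t) := by
      have e2 : π.histLaw Q (t + 1) = ((π.histLaw Q t).prod (Q t)).map (π.step t) := rfl
      rw [e2, integral_map (π.measurable_step t).aemeasurable (hL _).aestronglyMeasurable]
      simp only [step, Fin.sum_univ_castSucc, Fin.snoc_castSucc, Fin.snoc_last, Fin.val_castSucc,
        Fin.val_last]
      rw [integral_add hi1 hi2]
      congr 1
      · rw [integral_fun_fst (fun z : π.Seed × (Fin t → Observation m d) =>
          ∑ u : Fin t, -Real.log (windowRatio ε i s u (z.2 u)))]
        simp
      · exact integral_prod _ hi2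
    rw [e1]
    by_cases hst : s ≤ t
    · rw [Finset.sum_Ico_succ_top hst]
      refine add_le_add (ih fun u hu => hQ u (by omega)) ?_
      have e5 : (fun p : π.Seed × (Fin t → Observation m d) =>
          if π.act t p.1 p.2 = pull i then 4 * ε ^ 2 else 0)
          = {p | π.act t p.1 p.2 = pull i}.indicator fun _ => 4 * ε ^ 2 := by
        ext p
        simp [Set.indicator_apply]
      have e3 : ∫ p, (if π.act t p.1 p.2 = pull i then 4 * ε ^ 2 else 0) ∂(π.histLaw Q t)
          = 4 * ε ^ 2 * π.playProb Q t (pull i) := by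
        rw [e5, integral_indicator_const _ (π.measurableSet_act t (pull i)), smul_eq_mul]
        exact mul_comm _ _
      rw [← e3]
      refine integral_mono hi2.integral_prod_left ?_ fun p => ?_
      · rw [e5]
        exact (integrable_const (4 * ε ^ 2)).indicator (π.measurableSet_act t (pull i))
      · simp only [windowRatio, if_pos hst]
        rw [hQ t (Nat.lt_succ_self t) hst]
        exact integral_neg_log_armRatio_le h0 h1 i _
    · have e4 : Finset.Ico s (t + 1) = Finset.Ico s t := by
        ext u; simp only [Finset.mem_Ico]; omega
      rw [e4]
      simp only [windowRatio, if_neg hst, Real.log_one, neg_zero, integral_zero, add_zero]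
      exact ih fun u hu => hQ u (by omega)

/-- Raising the mean reward of the arm `i` increases the probability of playing it by little if it
is rarely played otherwise. -/
theorem playProb_raised_le (π : Policy m d) (P Q : ℕ → Measure (Outcome m d))
    [∀ t, IsProbabilityMeasure (P t)] [∀ t, IsProbabilityMeasure (Q t)] {ε : ℝ} (h0 : 0 ≤ ε)
    (h1 : ε ≤ 1 / 4) (i : Fin m) (s t : ℕ) (hPQ : ∀ u < t, u < s → P u = Q u)
    (hP : ∀ u < t, s ≤ u → P u = bernoulliLaw d (raised ε i))
    (hQ : ∀ u < t, s ≤ u → Q u = bernoulliLaw d fun _ => (1 / 2 : ℝ)) :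
    π.playProb P t (pull i) ≤ π.playProb Q t (pull i) + 1 / 3
      + 4 * ∑ u ∈ Finset.Ico s t, 4 * ε ^ 2 * π.playProb Q u (pull i) := by
  set Λ : π.Seed × (Fin t → Observation m d) → ℝ := fun z =>
    ∏ u : Fin t, windowRatio ε i s u (z.2 u) with hΛ
  set A : Set (π.Seed × (Fin t → Observation m d)) := {p | π.act t p.1 p.2 = pull i} with hA
  have hAm : MeasurableSet A := π.measurableSet_act t _
  have hw0 : ∀ u x, 0 < windowRatio (d := d) ε i s u x := fun u x =>
    lt_of_lt_of_le (by norm_num) (windowRatio_mem h0 h1 i s u x).1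
  have hΛ0 : ∀ z, 0 < Λ z := fun z => Finset.prod_pos fun u _ => hw0 _ _
  have hΛm : Measurable Λ := Finset.measurable_prod _ fun u _ =>
    (measurable_windowRatio ε i s u).comp ((measurable_pi_apply u).comp measurable_snd)
  have hΛi : Integrable Λ (π.histLaw Q t) := by
    refine Integrable.of_bound hΛm.aestronglyMeasurable (2 ^ t) (ae_of_all _ fun z => ?_)
    rw [Real.norm_of_nonneg (hΛ0 z).le]
    calc Λ z ≤ ∏ _u : Fin t, (2 : ℝ) := Finset.prod_le_prod (fun u _ => (hw0 _ _).le)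
          fun u _ => (windowRatio_mem h0 h1 i s u _).2
      _ = 2 ^ t := by simp
  have change : ∀ f : π.Seed × (Fin t → Observation m d) → ENNReal, Measurable f →
      ∫⁻ z, f z ∂(π.histLaw P t) = ∫⁻ z, f z * ENNReal.ofReal (Λ z) ∂(π.histLaw Q t) := by
    intro f hf
    have := π.lintegral_histLaw_change P Q
      (ratio := fun u x => ENNReal.ofReal (windowRatio ε i s u x))
      (fun u => (measurable_windowRatio ε i s u).ennreal_ofReal) t ?_ hf
    · rw [this]
      refine lintegral_congr fun z => ?_
      rw [hΛ, ENNReal.ofReal_prod_of_nonneg fun u _ => (hw0 _ _).le]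
    · intro u hu a g hg
      by_cases hs : s ≤ u
      · simp only [windowRatio, if_pos hs]
        rw [hP u hu hs, hQ u hu hs]
        exact lintegral_observe_raised h0 h1 i a hg
      · simp only [windowRatio, if_neg hs, ENNReal.ofReal_one, mul_one]
        rw [hPQ u hu (not_le.1 hs)]
  -- The change of measure applied to the constant function `1`.
  have hone : ∫ z, Λ z ∂(π.histLaw Q t) = 1 := by
    rw [integral_eq_lintegral_of_nonneg_ae (ae_of_all _ fun z => (hΛ0 z).le)
      hΛm.aestronglyMeasurable]
    have := change (fun _ => 1) measurable_const
    simp only [one_mul, lintegral_const, measure_univ] at this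
    rw [← this]
    simp
  have hPA : π.playProb P t (pull i) = ∫ z, A.indicator Λ z ∂(π.histLaw Q t) := by
    rw [integral_eq_lintegral_of_nonneg_ae
      (ae_of_all _ fun z => Set.indicator_nonneg (fun z _ => (hΛ0 z).le) z)
      (hΛm.indicator hAm).aestronglyMeasurable]
    have := change (A.indicator fun _ => 1) (measurable_const.indicator hAm)
    rw [lintegral_indicator_const hAm, one_mul] at this
    unfold playProb Measure.real
    rw [← hA, this]
    congr 1
    refine lintegral_congr fun z => ?_
    by_cases hz : z ∈ A <;> simp [hz]
  have hlogi : Integrable (fun z : π.Seed × (Fin t → Observation m d) =>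
      ∑ u : Fin t, -Real.log (windowRatio ε i s u (z.2 u))) (π.histLaw Q t) :=
    integrable_finsetSum _ fun u _ => integrable_log_windowRatio h0 h1 i s u _
      ((measurable_pi_apply u).comp measurable_snd)
  have hD := π.integral_neg_log_ratio_le Q h0 h1 i s t hQ
  -- Integrating this against `Q` gives `P(A) ≤ Q(A) + 1 / 3 + 4 * KL(Q, P)`. Off `A` the left side
  -- vanishes and `Λ - 1 - log Λ ≥ 0` suffices.
  have hpt : ∀ z, A.indicator Λ z ≤ A.indicator (fun _ => 1) z + (1 / 3 + 4 * ((Λ z - 1)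
      + ∑ u : Fin t, -Real.log (windowRatio ε i s u (z.2 u)))) := by
    intro z
    have e : ∑ u : Fin t, -Real.log (windowRatio ε i s u (z.2 u)) = -Real.log (Λ z) := by
      rw [hΛ, Real.log_prod fun u _ => (hw0 _ _).ne', Finset.sum_neg_distrib]
    rw [e]
    by_cases hz : z ∈ A
    · rw [Set.indicator_of_mem hz, Set.indicator_of_mem hz]
      linarith [le_third_add_sub_log (hΛ0 z)]
    · rw [Set.indicator_of_notMem hz, Set.indicator_of_notMem hz]
      linarith [Real.log_le_sub_one_of_pos (hΛ0 z)]
  have hi1 : Integrable (A.indicator fun _ => (1 : ℝ)) (π.histLaw Q t) :=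
    (integrable_const 1).indicator hAm
  have hΛ1 : Integrable (fun z => Λ z - 1) (π.histLaw Q t) := hΛi.sub (integrable_const 1)
  have hi2 : Integrable (fun z => (Λ z - 1)
      + ∑ u : Fin t, -Real.log (windowRatio ε i s u (z.2 u))) (π.histLaw Q t) :=
    hΛ1.add hlogi
  have hi3 : Integrable (fun z => 1 / 3 + 4 * ((Λ z - 1)
      + ∑ u : Fin t, -Real.log (windowRatio ε i s u (z.2 u)))) (π.histLaw Q t) :=
    (integrable_const _).add (hi2.const_mul 4)
  have hfin : ∫ z, (A.indicator (fun _ => 1) z + (1 / 3 + 4 * ((Λ z - 1)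
      + ∑ u : Fin t, -Real.log (windowRatio ε i s u (z.2 u))))) ∂(π.histLaw Q t)
      = π.playProb Q t (pull i) + (1 / 3 + 4 *
        ∫ z, ∑ u : Fin t, -Real.log (windowRatio ε i s u (z.2 u)) ∂(π.histLaw Q t)) := by
    rw [integral_add hi1 hi3, integral_add (integrable_const _) (hi2.const_mul 4),
      integral_const_mul, integral_add hΛ1 hlogi,
      integral_sub hΛi (integrable_const 1), hone, integral_indicator_const _ hAm]
    simp [playProb, hA]
  rw [hPA]
  refine (integral_mono (hΛi.indicator hAm) (hi1.add hi3) hpt).trans ?_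
  have := hfin.le
  simp only [Pi.add_apply] at this ⊢
  linarith

end Policy

/-! ### Choice of the special arms. -/

namespace Policy

/-- In a block of `ℓ` periods, some arm is missed a constant fraction of the time if its mean reward
is the only one that is raised. -/
theorem exists_rarely_played (π : Policy m d) (hm : 2 ≤ m) (P : Fin m → ℕ → Measure (Outcome m d))
    (Q : ℕ → Measure (Outcome m d)) [∀ i t, IsProbabilityMeasure (P i t)]
    [∀ t, IsProbabilityMeasure (Q t)] {ε : ℝ} (h0 : 0 ≤ ε) (h1 : ε ≤ 1 / 4) (s ℓ : ℕ)
    (hε : 192 * (ε ^ 2 * ℓ) ≤ m) (hPQ : ∀ i, ∀ u < s, P i u = Q u)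
    (hP : ∀ i u, s ≤ u → u < s + ℓ → P i u = bernoulliLaw d (raised ε i))
    (hQ : ∀ u, s ≤ u → u < s + ℓ → Q u = bernoulliLaw d fun _ => (1 / 2 : ℝ)) :
    ∃ i, ∑ t ∈ Finset.Ico s (s + ℓ), π.playProb (P i) t (pull i) ≤ 11 / 12 * ℓ := by
  have hm2 : (2 : ℝ) ≤ m := by exact_mod_cast hm
  have hm0 : (0 : ℝ) < m := by linarith
  have hne : (Finset.univ : Finset (Fin m)).Nonempty := ⟨⟨0, by omega⟩, Finset.mem_univ _⟩
  -- Pigeonhole under the neutral environment `Q`: the expected plays in the block total at most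
  -- `ℓ`, so some arm receives at most `ℓ / m`.
  obtain ⟨i, -, hi⟩ := Finset.exists_le_of_sum_le hne (f := fun i : Fin m =>
      ∑ t ∈ Finset.Ico s (s + ℓ), π.playProb Q t (pull i)) (g := fun _ => (ℓ : ℝ) / m) (by
    rw [Finset.sum_comm]
    calc ∑ t ∈ Finset.Ico s (s + ℓ), ∑ i : Fin m, π.playProb Q t (pull i)
        ≤ ∑ _t ∈ Finset.Ico s (s + ℓ), (1 : ℝ) :=
          Finset.sum_le_sum fun t _ => π.sum_playProb_le Q t
      _ = ∑ _i : Fin m, (ℓ : ℝ) / m := by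
          simp
          field_simp)
  refine ⟨i, ?_⟩
  have hp0 : ∀ u, 0 ≤ π.playProb Q u (pull i) := fun u => measureReal_nonneg
  -- The entropy term is at most `16 * ε ^ 2 * ℓ / m ≤ 1 / 12`, and `1 / 3 + 1 / 12 = 5 / 12`. With
  -- `ℓ / m ≤ ℓ / 2` the total becomes `11 / 12 * ℓ`.
  have hterm : ∀ t ∈ Finset.Ico s (s + ℓ),
      π.playProb (P i) t (pull i) ≤ π.playProb Q t (pull i) + 5 / 12 := by
    intro t ht
    rw [Finset.mem_Ico] at ht
    have h2 := π.playProb_raised_le (P i) Q h0 h1 i s t (fun u _ hu => hPQ i u hu)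
      (fun u hu hs => hP i u hs (by omega)) (fun u hu hs => hQ u hs (by omega))
    have h3 : ∑ u ∈ Finset.Ico s t, 4 * ε ^ 2 * π.playProb Q u (pull i)
        ≤ 4 * ε ^ 2 * (ℓ / m) := by
      rw [← Finset.mul_sum]
      refine mul_le_mul_of_nonneg_left (le_trans ?_ hi) (by positivity)
      exact Finset.sum_le_sum_of_subset_of_nonneg
        (Finset.Ico_subset_Ico_right (by omega)) fun u _ _ => hp0 u
    have h4 : 4 * ε ^ 2 * (ℓ / m) ≤ 1 / 48 := by
      rw [← mul_div_assoc, div_le_iff₀ hm0]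
      linarith
    linarith
  refine (Finset.sum_le_sum hterm).trans ?_
  rw [Finset.sum_add_distrib]
  have h5 : (ℓ : ℝ) / m ≤ ℓ / 2 := div_le_div_of_nonneg_left (Nat.cast_nonneg _) (by norm_num) hm2
  simp only [Finset.sum_const, Nat.card_Ico, add_tsub_cancel_left, nsmul_eq_mul]
  linarith

/-- The special arms of the blocks can be chosen one after the other such that each of them is
missed a constant fraction of the time. -/
theorem exists_special_arms (π : Policy m d) (hm : 2 ≤ m)
    (mean : (ℕ → Fin m) → ℕ → Fin m → ℝ) {ε : ℝ} (h0 : 0 ≤ ε) (h1 : ε ≤ 1 / 4) {L ℓ n : ℕ}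
    (hℓ : ℓ ≤ L) (hε : 192 * (ε ^ 2 * ℓ) ≤ m)
    (hcausal : ∀ θ θ' t, (∀ k, k * L ≤ t → θ k = θ' k) → mean θ t = mean θ' t)
    (hblock : ∀ θ t, ∀ k < n, k * L ≤ t → t < k * L + ℓ → mean θ t = raised ε (θ k)) :
    ∃ θ : ℕ → Fin m, ∀ k < n, ∑ t ∈ Finset.Ico (k * L) (k * L + ℓ),
      π.playProb (fun t => bernoulliLaw d (mean θ t)) t (pull (θ k)) ≤ 11 / 12 * ℓ := by
  suffices H : ∀ N ≤ n, ∃ θ : ℕ → Fin m, ∀ k < N, ∑ t ∈ Finset.Ico (k * L) (k * L + ℓ),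
      π.playProb (fun t => bernoulliLaw d (mean θ t)) t (pull (θ k)) ≤ 11 / 12 * ℓ from H n le_rfl
  intro N
  induction N with
  | zero => exact fun _ => ⟨fun _ => ⟨0, by omega⟩, fun k hk => absurd hk (Nat.not_lt_zero k)⟩
  | succ N ih =>
    intro hN
    obtain ⟨θ, hθ⟩ := ih (by omega)
    have hpast : ∀ i, ∀ t < N * L, mean (Function.update θ N i) t = mean θ t := by
      intro i t ht
      refine hcausal _ _ t fun k hk => Function.update_of_ne ?_ _ _
      rintro rfl
      omega
    -- The reference environment keeps the arms already chosen and is neutral from block `N` on.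
    -- Since the choice averages over histories, the result is one fixed sequence of laws.
    obtain ⟨i, hi⟩ := π.exists_rarely_played hm
      (fun i t => bernoulliLaw d (mean (Function.update θ N i) t))
      (fun t => bernoulliLaw d (if t < N * L then mean θ t else fun _ => (1 / 2 : ℝ)))
      h0 h1 (N * L) ℓ hε
      (fun i u hu => by simp only [if_pos hu, hpast i u hu])
      (fun i u hu hu' => by
        rw [hblock _ u N (by omega) hu hu', Function.update_self])
      (fun u hu _ => by simp only [if_neg (not_lt.2 hu)])
    refine ⟨Function.update θ N i, fun k hk => ?_⟩
    rcases Nat.lt_succ_iff_lt_or_eq.1 hk with hk | rfl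
    · refine le_trans (le_of_eq (Finset.sum_congr rfl fun t ht => ?_)) (hθ k hk)
      rw [Function.update_of_ne hk.ne]
      -- Changing the arm of block `N` leaves the play probabilities of earlier blocks untouched.
      refine π.playProb_congr (fun u hu => ?_) _
      have h2 : (k + 1) * L ≤ N * L := Nat.mul_le_mul_right L hk
      rw [Finset.mem_Ico] at ht
      rw [Nat.succ_mul] at h2
      simp only [hpast i u (by omega)]
    · rw [Function.update_self]
      exact hi

end Policy

/-! ### Regret of Bernoulli environments with blocks. -/

/-- The instance with Bernoulli rewards of means `p t` and without consumption. -/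
def bernoulliInstance (d T : ℕ) (p : ℕ → Fin m → ℝ) : Instance m d T where
  law t := bernoulliLaw d (p t)
  isProbabilityMeasure_law _ := inferInstance
  reward_mem t := by
    refine ae_bernoulliLaw _ ?_ fun u i => ?_
    · rw [Set.ofPred_forall]
      exact MeasurableSet.iInter fun i =>
        ((measurable_pi_apply i).comp measurable_fst) measurableSet_Icc
    · simp only [thresholdOutcome]
      split_ifs <;> simp
  consumption_mem t := by
    refine ae_bernoulliLaw _ ?_ fun u j i => by simp [thresholdOutcome]
    simp only [Set.ofPred_forall]
    exact MeasurableSet.iInter fun j => MeasurableSet.iInter fun i =>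
      ((measurable_pi_apply i).comp ((measurable_pi_apply j).comp measurable_snd)) measurableSet_Icc

section Bernoulli

variable {p : ℕ → Fin m → ℝ} (hp : ∀ t i, p t i ∈ Set.Icc (0 : ℝ) 1)

include hp in
theorem bernoulliInstance_μ (t : Fin T) : (bernoulliInstance d T p).μ t = p t := by
  ext i
  exact integral_gain_bernoulliLaw (p t) i (hp t i)

theorem bernoulliInstance_consumption (t : Fin T) :
    ∀ᵐ o ∂((bernoulliInstance d T p).law t), o.2 = 0 :=
  ae_bernoulliLaw _ (measurable_snd (measurableSet_singleton 0)) fun _ => rfl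

theorem bernoulliInstance_C (t : Fin T) : (bernoulliInstance d T p).C t = 0 := by
  ext j i
  refine (integral_congr_ae ?_).trans (integral_zero _ ℝ)
  filter_upwards [bernoulliInstance_consumption t] with o ho
  rw [ho]
  rfl

theorem bernoulliInstance_W₂ : (bernoulliInstance d T p).W₂ = 0 := by
  simp [Instance.W₂, Instance.meanC, bernoulliInstance_C]

include hp in
theorem bernoulliInstance_V₁ : (bernoulliInstance d T p).V₁
    = ∑ t ∈ Finset.range (T - 1), ‖p t - p (t + 1)‖ := by
  unfold Instance.V₁
  rw [← Fin.sum_univ_eq_sum_range (fun t => ‖p t - p (t + 1)‖)]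
  refine Finset.sum_congr rfl fun t _ => ?_
  rw [bernoulliInstance_μ hp, bernoulliInstance_μ hp]

/-- Almost surely nothing is consumed, so the budget never binds and the value is a sum of
one-period expectations. -/
theorem bernoulliInstance_value (π : Policy m d) {B : ℝ} (hB : 0 ≤ B) :
    π.value (bernoulliInstance d T p) B
      = ∑ t : Fin T, ∫ z, (∫ o, gain o (π.act t z.1 z.2) ∂(bernoulliLaw d (p t)))
          ∂(π.histLaw (fun t => bernoulliLaw d (p t)) t) := by
  set I := bernoulliInstance d T p with hI
  have hlaw : ∀ t : Fin T, I.law t = (fun t : ℕ => bernoulliLaw d (p t)) t := fun t => rfl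
  have h1 : (fun z : π.Seed × (Fin T → Outcome m d) => π.collected B z.1 z.2)
      =ᵐ[π.jointLaw I] fun z => ∑ t, gain (z.2 t) (π.action z.1 z.2 t) := by
    filter_upwards [π.ae_jointLaw I (P := fun t o => o.2 = 0)
      fun t => bernoulliInstance_consumption t] with z hz
    unfold Policy.collected
    refine Finset.sum_congr rfl fun t _ => if_pos fun j => ?_
    have h2 : ∀ u, cost (z.2 u) (π.action z.1 z.2 u) j = 0 := by
      intro u
      rcases eq_idle_or_pull (π.action z.1 z.2 u) with h | ⟨i, h⟩
      · rw [h, cost_idle]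
      · rw [h, cost_pull, hz u]
        rfl
    simpa [h2] using hB
  rw [Policy.value_eq, integral_congr_ae h1,
    integral_finsetSum _ fun t _ =>
      (π.integral_gain_action (law := fun t : ℕ => bernoulliLaw d (p t)) I hlaw t).1]
  exact Finset.sum_congr rfl fun t _ =>
    (π.integral_gain_action (law := fun t : ℕ => bernoulliLaw d (p t)) I hlaw t).2

include hp in
/-- The regret is at least the expected sum of the gaps in the periods in which the best arm is
missed. -/
theorem bernoulliInstance_regret {B : ℝ} (hB : 0 ≤ B) (best : ℕ → Fin m) (gap : ℕ → ℝ)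
    (hg : ∀ t, gap t ≤ p t (best t)) (hbest : ∀ t i, i ≠ best t → p t i ≤ p t (best t) - gap t)
    (π : Policy m d) :
    ∑ t ∈ Finset.range T,
        gap t * (1 - π.playProb (fun t => bernoulliLaw d (p t)) t (pull (best t)))
      ≤ (bernoulliInstance d T p).regret B π := by
  have h1 := (Policy.schedule fun t => pull (best t)).value_le_opt (bernoulliInstance d T p) B
  rw [bernoulliInstance_value _ hB] at h1
  have h2 : ∀ t : Fin T, ∫ z, (∫ o, gain o
      ((Policy.schedule (d := d) fun t => pull (best t)).act t z.1 z.2) ∂(bernoulliLaw d (p t)))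
        ∂((Policy.schedule fun t => pull (best t)).histLaw (fun t => bernoulliLaw d (p t)) t)
      = p t (best t) := by
    intro t
    have : ∀ z, ∫ o, gain o ((Policy.schedule (d := d) fun t => pull (best t)).act t
        (z : (Policy.schedule (d := d) fun t => pull (best t)).Seed ×
          (Fin t → Observation m d)).1 z.2) ∂(bernoulliLaw d (p t)) = p t (best t) :=
      fun z => integral_gain_bernoulliLaw (p t) (best t) (hp t _)
    refine (integral_congr_ae (ae_of_all _ this)).trans ?_
    rw [integral_const, probReal_univ, one_smul]
  rw [Finset.sum_congr rfl fun t _ => h2 t] at h1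
  have h3 : ∀ t : Fin T, ∫ z, (∫ o, gain o (π.act t z.1 z.2) ∂(bernoulliLaw d (p t)))
          ∂(π.histLaw (fun t => bernoulliLaw d (p t)) t)
      ≤ p t (best t) - gap t
        + π.playProb (fun t => bernoulliLaw d (p t)) t (pull (best t)) * gap t := by
    intro t
    have hms := π.measurableSet_act t (pull (best t))
    have hint : Integrable ({z | π.act t z.1 z.2 = pull (best t)}.indicator fun _ => gap t)
        (π.histLaw (fun t => bernoulliLaw d (p t)) t) := (integrable_const _).indicator hms
    have e : ∫ z, ((p t (best t) - gap t)
        + {z | π.act t z.1 z.2 = pull (best t)}.indicator (fun _ => gap t) z)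
          ∂(π.histLaw (fun t => bernoulliLaw d (p t)) t)
        = p t (best t) - gap t
        + π.playProb (fun t => bernoulliLaw d (p t)) t (pull (best t)) * gap t := by
      rw [integral_add (integrable_const _) hint, integral_indicator_const _ hms]
      simp [Policy.playProb]
    rw [← e]
    -- This form of monotonicity needs no integrability of the left integrand.
    refine integral_mono_of_nonneg (ae_of_all _ fun z => ?_) ((integrable_const _).add hint)
      (ae_of_all _ fun z => ?_)
    · rcases eq_idle_or_pull (π.act t z.1 z.2) with h | ⟨i, h⟩
      · simp [h]
      · simp only [h, integral_gain_bernoulliLaw (p t) i (hp t i)]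
        exact (hp t i).1
    · simp only
      by_cases hz : π.act t z.1 z.2 = pull (best t)
      · rw [Set.indicator_of_mem (by exact hz), hz,
          integral_gain_bernoulliLaw (p t) _ (hp t _)]
        linarith
      · rw [Set.indicator_of_notMem (by exact hz), add_zero]
        rcases eq_idle_or_pull (π.act t z.1 z.2) with h | ⟨i, h⟩
        · simp only [h, gain_idle, integral_zero]
          linarith [hg t]
        · rw [h, integral_gain_bernoulliLaw (p t) i (hp t i)]
          exact hbest t i fun hi => hz (by rw [h, hi])
  unfold Instance.regret
  rw [bernoulliInstance_value _ hB, ← Fin.sum_univ_eq_sum_range (fun t =>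
    gap t * (1 - π.playProb (fun t => bernoulliLaw d (p t)) t (pull (best t))))]
  refine le_trans ?_ (sub_le_sub h1 (Finset.sum_le_sum fun t _ => h3 t))
  rw [← Finset.sum_sub_distrib]
  refine le_of_eq (Finset.sum_congr rfl fun t _ => ?_)
  ring

end Bernoulli

theorem sum_range_mul_eq {M : Type*} [AddCommMonoid M] (f : ℕ → M) (n L : ℕ) :
    ∑ t ∈ Finset.range (n * L), f t = ∑ k ∈ Finset.range n, ∑ r ∈ Finset.range L, f (k * L + r) := by
  induction n with
  | zero => simp
  | succ n ih => rw [Nat.succ_mul, Finset.sum_range_add, Finset.sum_range_succ, ih]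

/-- Bandit lower bound for `n` blocks of `L` periods: in the first `ℓ` periods of each block one
special arm is better by `ε`. -/
theorem exists_block_regret (hm : 2 ≤ m) (π : Policy m d) {B : ℝ} (hB : 0 ≤ B)
    (mean : (ℕ → Fin m) → ℕ → Fin m → ℝ) (hp : ∀ θ t i, mean θ t i ∈ Set.Icc (0 : ℝ) 1)
    {ε : ℝ} (h0 : 0 ≤ ε) (h1 : ε ≤ 1 / 4) {L ℓ n : ℕ}
    (hℓ : ℓ ≤ L) (hT : n * L ≤ T) (hε : 192 * (ε ^ 2 * ℓ) ≤ m)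
    (hcausal : ∀ θ θ' t, (∀ k, k * L ≤ t → θ k = θ' k) → mean θ t = mean θ' t)
    (hblock : ∀ θ t, ∀ k < n, k * L ≤ t → t < k * L + ℓ → mean θ t = raised ε (θ k))
    (best : (ℕ → Fin m) → ℕ → Fin m) (gap : ℕ → ℝ) (hgap : ∀ t, 0 ≤ gap t)
    (hg : ∀ θ t, gap t ≤ mean θ t (best θ t))
    (hbest : ∀ θ t i, i ≠ best θ t → mean θ t i ≤ mean θ t (best θ t) - gap t)
    (hbb : ∀ θ, ∀ k < n, ∀ r < ℓ, best θ (k * L + r) = θ k ∧ gap (k * L + r) = ε) :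
    ∃ θ, n * ℓ * ε / 12 ≤ (bernoulliInstance d T (mean θ)).regret B π := by
  obtain ⟨θ, hθ⟩ := π.exists_special_arms hm mean h0 h1 hℓ hε hcausal hblock
  refine ⟨θ, le_trans ?_ (bernoulliInstance_regret (hp θ) hB (best θ) gap (hg θ) (hbest θ) π)⟩
  set f : ℕ → ℝ := fun t => gap t *
    (1 - π.playProb (fun t => bernoulliLaw d (mean θ t)) t (pull (best θ t))) with hf
  have hf0 : ∀ t, 0 ≤ f t := fun t => mul_nonneg (hgap t) (sub_nonneg.2 measureReal_le_one)
  calc (n : ℝ) * ℓ * ε / 12 = ∑ _k ∈ Finset.range n, ε * (ℓ / 12) := by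
        simp
        ring
    _ ≤ ∑ k ∈ Finset.range n, ∑ r ∈ Finset.range ℓ, f (k * L + r) := by
        refine Finset.sum_le_sum fun k hk => ?_
        have hk := Finset.mem_range.1 hk
        have h2 := hθ k hk
        rw [Finset.sum_Ico_eq_sum_range, add_tsub_cancel_left] at h2
        have e : ∑ r ∈ Finset.range ℓ, f (k * L + r) = ε * (ℓ - ∑ r ∈ Finset.range ℓ,
            π.playProb (fun t => bernoulliLaw d (mean θ t)) (k * L + r) (pull (θ k))) := by
          have : (ℓ : ℝ) = ∑ _r ∈ Finset.range ℓ, (1 : ℝ) := by simp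
          rw [this, ← Finset.sum_sub_distrib, Finset.mul_sum]
          refine Finset.sum_congr rfl fun r hr => ?_
          obtain ⟨e1, e2⟩ := hbb θ k hk r (Finset.mem_range.1 hr)
          simp only [hf, e1, e2]
        rw [e]
        exact mul_le_mul_of_nonneg_left (by linarith) h0
    -- Periods outside the informative part of a block contribute a nonnegative regret.
    _ ≤ ∑ k ∈ Finset.range n, ∑ r ∈ Finset.range L, f (k * L + r) :=
        Finset.sum_le_sum fun k _ => Finset.sum_le_sum_of_subset_of_nonneg
          (Finset.range_subset_range.2 hℓ) fun r _ _ => hf0 _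
    _ = ∑ t ∈ Finset.range (n * L), f t := (sum_range_mul_eq f n L).symm
    _ ≤ ∑ t ∈ Finset.range T, f t := Finset.sum_le_sum_of_subset_of_nonneg
          (Finset.range_subset_range.2 hT) fun t _ _ => hf0 t

/-! ### Calibration of the blocks and lower bound by the local variation of the rewards, part (i).
-/

/-- The mean rewards for `n` blocks of `L` periods: except in the last period of each block, the
special arm of the block is better by `ε`. -/
def blockMean (ε : ℝ) (L n : ℕ) (θ : ℕ → Fin m) (t : ℕ) : Fin m → ℝ :=
  if t / L < n ∧ t % L < L - 1 then raised ε (θ (t / L)) else fun _ => 1 / 2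

theorem blockMean_of_lt {ε : ℝ} {L n k r : ℕ} (θ : ℕ → Fin m) (hk : k < n) (hr : r < L - 1) :
    blockMean ε L n θ (k * L + r) = raised ε (θ k) := by
  have h1 : (k * L + r) / L = k := by
    rw [mul_comm, Nat.mul_add_div (by omega), Nat.div_eq_of_lt (by omega), add_zero]
  have h2 : (k * L + r) % L = r := by
    rw [mul_comm, Nat.mul_add_mod, Nat.mod_eq_of_lt (by omega)]
  unfold blockMean
  rw [if_pos (by rw [h1, h2]; exact ⟨hk, hr⟩), h1]

theorem blockMean_last {ε : ℝ} {L n k : ℕ} (θ : ℕ → Fin m) (hL : 0 < L) :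
    blockMean ε L n θ (k * L + (L - 1)) = fun _ => 1 / 2 := by
  have h2 : (k * L + (L - 1)) % L = L - 1 := by
    rw [mul_comm, Nat.mul_add_mod, Nat.mod_eq_of_lt (by omega)]
  unfold blockMean
  rw [if_neg (by rw [h2]; exact fun h => lt_irrefl _ h.2)]

theorem blockMean_of_le {ε : ℝ} {L n t : ℕ} (θ : ℕ → Fin m) (hL : 0 < L) (ht : n * L ≤ t) :
    blockMean ε L n θ t = fun _ => 1 / 2 := by
  unfold blockMean
  rw [if_neg fun h => absurd h.1 (not_lt.2 ((Nat.le_div_iff_mul_le hL).2 ht))]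

theorem norm_raised_sub {ε : ℝ} (hε : 0 ≤ ε) (i : Fin m) :
    ‖raised ε i - fun _ => (1 / 2 : ℝ)‖ = ε := by
  have : (raised ε i - fun _ => (1 / 2 : ℝ)) = Pi.single i ε := by
    ext k
    simp only [Pi.sub_apply, raised, Pi.single_apply]
    split_ifs <;> ring
  rw [this, Pi.norm_single, Real.norm_of_nonneg hε]

/-- There are `n` drops, one at the end of each block, and `n - 1` rises, because the first block
begins raised. The neutral last periods make the variation independent of `θ`; without them,
consecutive blocks with the same special arm would contribute nothing. -/
theorem sum_norm_blockMean_sub {ε : ℝ} (hε : 0 ≤ ε) {L n : ℕ} (hL : 2 ≤ L) (hn : 1 ≤ n)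
    (hT : n * L ≤ T) (θ : ℕ → Fin m) :
    ∑ t ∈ Finset.range (T - 1), ‖blockMean ε L n θ t - blockMean ε L n θ (t + 1)‖
      = ε * (2 * n - 1) := by
  set f : ℕ → ℝ := fun t => ‖blockMean ε L n θ t - blockMean ε L n θ (t + 1)‖ with hf
  have hL0 : 0 < L := by omega
  have hnL : L ≤ n * L := Nat.le_mul_of_pos_left L hn
  have hend : ∀ t, n * L ≤ t + 1 → f t = 0 := by
    intro t ht
    have e2 := blockMean_of_le (ε := ε) θ hL0 ht
    have e1 : blockMean ε L n θ t = fun _ => 1 / 2 := by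
      rcases Nat.lt_or_ge t (n * L) with h | h
      · obtain ⟨k, rfl⟩ : ∃ k, n = k + 1 := ⟨n - 1, by omega⟩
        have : t = k * L + (L - 1) := by
          rw [Nat.succ_mul] at h ht
          omega
        rw [this]
        exact blockMean_last θ hL0
      · exact blockMean_of_le θ hL0 h
    simp only [hf, e1, e2, sub_self, norm_zero]
  have hblock : ∀ k ∈ Finset.range n, ∑ r ∈ Finset.range L, f (k * L + r)
      = ε + if k < n - 1 then ε else 0 := by
    intro k hk
    rw [Finset.mem_range] at hk
    obtain ⟨l, rfl⟩ : ∃ l, L = l + 2 := ⟨L - 2, by omega⟩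
    rw [Finset.sum_range_succ, Finset.sum_range_succ, Finset.sum_eq_zero, zero_add]
    · congr 1
      · simp only [hf]
        rw [blockMean_of_lt θ hk (by omega),
          show k * (l + 2) + l + 1 = k * (l + 2) + (l + 2 - 1) by omega, blockMean_last θ hL0]
        exact norm_raised_sub hε _
      · have e1 : blockMean ε (l + 2) n θ (k * (l + 2) + (l + 1)) = fun _ => 1 / 2 :=
          blockMean_last θ hL0
        have e2 : k * (l + 2) + (l + 1) + 1 = (k + 1) * (l + 2) + 0 := by ring
        split_ifs with h
        · simp only [hf]
          rw [e1, e2, blockMean_of_lt θ (by omega) (by omega), norm_sub_rev]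
          exact norm_raised_sub hε _
        · refine hend _ ?_
          rw [e2, add_zero]
          exact Nat.mul_le_mul_right _ (by omega)
    · intro r hr
      rw [Finset.mem_range] at hr
      simp only [hf]
      rw [blockMean_of_lt θ hk (by omega), add_assoc, blockMean_of_lt θ hk (by omega), sub_self,
        norm_zero]
  have e1 : ∑ t ∈ Finset.range (T - 1), f t = ∑ t ∈ Finset.range T, f t := by
    obtain ⟨S, rfl⟩ : ∃ S, T = S + 1 := ⟨T - 1, by omega⟩
    rw [Finset.sum_range_succ, hend S hT, add_zero, Nat.add_sub_cancel]
  have e2 : ∑ t ∈ Finset.range (n * L), f t = ∑ t ∈ Finset.range T, f t := by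
    refine Finset.sum_subset (Finset.range_subset_range.2 hT) fun t _ ht => hend t ?_
    rw [Finset.mem_range] at ht
    omega
  rw [e1, ← e2, sum_range_mul_eq, Finset.sum_congr rfl hblock, Finset.sum_add_distrib]
  obtain ⟨k, rfl⟩ : ∃ k, n = k + 1 := ⟨n - 1, by omega⟩
  rw [Finset.sum_range_succ (fun x => if x < k + 1 - 1 then ε else 0), if_neg (by omega),
    Finset.sum_congr rfl fun x hx => if_pos (by rw [Finset.mem_range] at hx; omega)]
  simp
  ring

theorem raised_le {ε : ℝ} (i k : Fin m) (hk : k ≠ i) : raised ε i k = raised ε i i - ε := by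
  simp [raised, hk]

theorem raised_mem {ε : ℝ} (h0 : 0 ≤ ε) (h1 : ε ≤ 1 / 4) (i k : Fin m) :
    raised ε i k ∈ Set.Icc (1 / 2 : ℝ) (3 / 4) := by
  unfold raised
  split_ifs <;> constructor <;> linarith

/-- Lower bound for several blocks. -/
theorem exists_blockMean_regret (hm : 2 ≤ m) (π : Policy m d) {B : ℝ} (hB : 0 ≤ B)
    {ε : ℝ} (h0 : 0 ≤ ε) (h1 : ε ≤ 1 / 4) {L n : ℕ} (hT : n * L ≤ T)
    (hε : 192 * (ε ^ 2 * L) ≤ m) :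
    ∃ θ, n * (L - 1 : ℕ) * ε / 12 ≤ (bernoulliInstance d T (blockMean ε L n θ)).regret B π := by
  have hp : ∀ (θ : ℕ → Fin m) t i, blockMean ε L n θ t i ∈ Set.Icc (0 : ℝ) 1 := by
    intro θ t i
    unfold blockMean
    split_ifs
    · have := raised_mem h0 h1 (θ (t / L)) i
      exact ⟨by linarith [this.1], by linarith [this.2]⟩
    · constructor <;> norm_num
  refine exists_block_regret hm π hB (blockMean ε L n) hp h0 h1 (L := L) (ℓ := L - 1)
    (Nat.sub_le _ _) hT (le_trans ?_ hε) ?_ ?_ (fun θ t => θ (t / L))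
    (fun t => if t / L < n ∧ t % L < L - 1 then ε else 0) ?_ ?_ ?_ ?_
  · gcongr
    omega
  · intro θ θ' t h
    unfold blockMean
    rw [h _ (Nat.div_mul_le_self t L)]
  · intro θ t k hk h2 h3
    obtain ⟨r, rfl⟩ := Nat.exists_eq_add_of_le h2
    exact blockMean_of_lt θ hk (by omega)
  · intro t
    split_ifs
    exacts [h0, le_rfl]
  · intro θ t
    unfold blockMean
    split_ifs
    · linarith [(raised_mem h0 h1 (θ (t / L)) (θ (t / L))).1]
    · norm_num
  · intro θ t i hi
    unfold blockMean
    split_ifs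
    · rw [raised_le _ _ hi]
    · simp
  · intro θ k hk r hr
    have h2 : (k * L + r) / L = k := by
      rw [mul_comm, Nat.mul_add_div (by omega), Nat.div_eq_of_lt (by omega), add_zero]
    have h3 : (k * L + r) % L = r := by
      rw [mul_comm, Nat.mul_add_mod, Nat.mod_eq_of_lt (by omega)]
    exact ⟨by rw [h2], by rw [h2, h3, if_pos ⟨hk, hr⟩]⟩

/-- The mean rewards with one special arm, where all rewards drop by `V` in the last period. -/
def dropMean (ε V : ℝ) (T : ℕ) (θ : ℕ → Fin m) (t : ℕ) (i : Fin m) : ℝ :=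
  raised ε (θ 0) i - if t + 1 < T then 0 else V

theorem sum_norm_dropMean_sub {ε V : ℝ} (hm : 1 ≤ m) (hV : 0 ≤ V) (hT : 2 ≤ T) (θ : ℕ → Fin m) :
    ∑ t ∈ Finset.range (T - 1), ‖dropMean ε V T θ t - dropMean ε V T θ (t + 1)‖ = V := by
  have : Nonempty (Fin m) := ⟨⟨0, hm⟩⟩
  obtain ⟨S, rfl⟩ : ∃ S, T = S + 2 := ⟨T - 2, by omega⟩
  have e : ∀ t, dropMean ε V (S + 2) θ t - dropMean ε V (S + 2) θ (t + 1) = fun _ =>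
      (if t + 1 + 1 < S + 2 then 0 else V) - if t + 1 < S + 2 then 0 else V := by
    intro t
    ext i
    simp [dropMean]
  simp only [e, pi_norm_const]
  rw [show S + 2 - 1 = S + 1 by omega, Finset.sum_range_succ, Finset.sum_eq_zero]
  · simp [abs_of_nonneg hV]
  · intro t ht
    rw [Finset.mem_range] at ht
    rw [if_pos (by omega), if_pos (by omega), sub_self, norm_zero]

/-- A single block whose last period is not counted. The drop by `V` in that period serves only to
set the variation; being common to all arms, it keeps the gap `ε`. -/
theorem exists_dropMean_regret (hm : 2 ≤ m) (π : Policy m d) {B : ℝ} (hB : 0 ≤ B)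
    {ε V : ℝ} (h0 : 0 ≤ ε) (h1 : ε ≤ 1 / 4) (hV0 : 0 ≤ V) (hV : V ≤ 1 / 2)
    (hε : 192 * (ε ^ 2 * T) ≤ m) :
    ∃ θ, (T - 1 : ℕ) * ε / 12 ≤ (bernoulliInstance d T (dropMean ε V T θ)).regret B π := by
  have hd0 : ∀ t : ℕ, (0 : ℝ) ≤ (if t + 1 < T then 0 else V) := by
    intro t
    split_ifs
    exacts [le_rfl, hV0]
  have hd1 : ∀ t : ℕ, (if t + 1 < T then 0 else V) ≤ (1 / 2 : ℝ) := by
    intro t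
    split_ifs
    exacts [by norm_num, hV]
  have key := exists_block_regret (T := T) hm π hB (dropMean ε V T) (fun θ t i => ?_) h0 h1
    (L := T) (ℓ := T - 1) (n := 1)
    (Nat.sub_le _ _) (by omega) (le_trans ?_ hε) ?_ ?_ (fun θ _ => θ 0)
    (fun t => ε) ?_ ?_ ?_ ?_
  · simpa using key
  · have h2 := raised_mem h0 h1 (θ 0) i
    unfold dropMean
    exact ⟨by linarith [h2.1, hd1 t], by linarith [h2.2, hd0 t]⟩
  · gcongr
    omega
  · intro θ θ' t h
    unfold dropMean
    rw [h 0 (by omega)]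
  · intro θ t k hk _ h3
    obtain rfl : k = 0 := by omega
    ext i
    unfold dropMean
    rw [if_pos (by omega), sub_zero]
  · exact fun _ => h0
  · intro θ t
    have : raised ε (θ 0) (θ 0) = 1 / 2 + ε := if_pos rfl
    unfold dropMean
    rw [this]
    linarith [hd1 t]
  · intro θ t i hi
    unfold dropMean
    rw [raised_le _ _ hi]
    linarith
  · intro θ k hk r _
    obtain rfl : k = 0 := by omega
    exact ⟨rfl, rfl⟩

/-- Lower bound in terms of the local variation of the rewards. -/
theorem reward_variation_lower_bound :
    ∃ c κ : ℝ, 0 < c ∧ 0 < κ ∧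
      ∀ (m d T : ℕ) (b V : ℝ), 2 ≤ m → 1 ≤ d → 2 ≤ T → 0 < b →
        0 < V → V ≤ κ * T / m →
        ∀ π : BwK.Policy m d, ∃ I : BwK.Instance m d T,
          I.V₁ = V ∧ I.W₂ = 0 ∧
          c * ((m : ℝ) ^ (1 / 3 : ℝ) * V ^ (1 / 3 : ℝ) * (T : ℝ) ^ (2 / 3 : ℝ))
            ≤ I.regret (b * T) π := by
  -- `336 = 2 * 14 * 12`: at least `T / 2` counted periods, a gap of at least `e / 14`, and a missed
  -- fraction of `1 / 12`.
  refine ⟨1 / 336, 1 / 1000, by norm_num, by norm_num, ?_⟩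
  intro m d T b V hm _ hT hb hV hVκ π
  have hm2 : (2 : ℝ) ≤ m := by exact_mod_cast hm
  have hT2 : (2 : ℝ) ≤ T := by exact_mod_cast hT
  have hm0 : (0 : ℝ) < m := by linarith
  have hT0 : (0 : ℝ) < T := by linarith
  have hVm : V * m ≤ 1 / 1000 * T := (le_div_iff₀ hm0).1 hVκ
  obtain ⟨y, hy⟩ : ∃ y : ℝ, y = (m : ℝ) ^ (1 / 3 : ℝ) * V ^ (1 / 3 : ℝ) * (T : ℝ) ^ (2 / 3 : ℝ) :=
    ⟨_, rfl⟩
  have hy0 : 0 < y := by rw [hy]; positivity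
  have hy3 : y ^ 3 = m * V * T ^ 2 := by rw [hy]; exact cube_root_product_pow hm0.le hV.le hT0.le
  rw [← hy]
  -- The target per period. It satisfies `e ^ 3 * T = m * V` and is the scale of the gap `ε`.
  obtain ⟨e, he⟩ : ∃ e, e = y / T := ⟨_, rfl⟩
  have he0 : 0 < e := by rw [he]; positivity
  have heT : e * T = y := by rw [he]; field_simp
  have he3 : e ^ 3 * T = m * V := by
    rw [he, div_pow, hy3]
    field_simp
  have he1 : e ≤ 1 := by
    refine le_of_pow_le_pow_left₀ (by norm_num : (3 : ℕ) ≠ 0) zero_le_one ?_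
    refine le_of_mul_le_mul_right ?_ hT0
    rw [he3]
    linarith
  have hB : 0 ≤ b * T := by positivity
  rcases lt_or_ge (V ^ 2 * T) m with hcase | hcase
  · -- few changes: one block
    have he2 : e ^ 2 * T ≤ m := by
      refine le_of_pow_le_pow_left₀ (by norm_num : (3 : ℕ) ≠ 0) hm0.le ?_
      calc (e ^ 2 * T) ^ 3 = (e ^ 3 * T) ^ 2 * T := by ring
        _ = m ^ 2 * (V ^ 2 * T) := by rw [he3]; ring
        _ ≤ m ^ 2 * m := by gcongr
        _ = m ^ 3 := by ring
    have hV3 : V ≤ 1 / 2 := by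
      refine le_of_pow_le_pow_left₀ (by norm_num : (3 : ℕ) ≠ 0) (by norm_num) ?_
      refine le_of_mul_le_mul_right ?_ hT0
      calc V ^ 3 * T = V * (V ^ 2 * T) := by ring
        _ ≤ V * m := by gcongr
        _ ≤ 1 / 1000 * T := hVm
        _ ≤ (1 / 2) ^ 3 * T := by gcongr; norm_num
    obtain ⟨θ, hθ⟩ := exists_dropMean_regret (T := T) hm π hB (ε := e / 14) (by positivity)
      (by linarith) hV.le hV3 (by
        calc 192 * ((e / 14) ^ 2 * T) = 192 / 196 * (e ^ 2 * T) := by ring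
          _ ≤ 1 * (e ^ 2 * T) := by gcongr; norm_num
          _ ≤ m := by linarith)
    have hp : ∀ t i, dropMean (e / 14) V T θ t i ∈ Set.Icc (0 : ℝ) 1 := by
      intro t i
      have h2 := raised_mem (ε := e / 14) (by positivity) (by linarith) (θ 0) i
      unfold dropMean
      split_ifs
      · exact ⟨by linarith [h2.1], by linarith [h2.2]⟩
      · exact ⟨by linarith [h2.1], by linarith [h2.2]⟩
    refine ⟨_, ?_, bernoulliInstance_W₂, le_trans ?_ hθ⟩
    · rw [bernoulliInstance_V₁ hp, sum_norm_dropMean_sub (by omega) hV.le hT]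
    · have h2 : (T : ℝ) ≤ 2 * (T - 1 : ℕ) := by
        exact_mod_cast (by omega : T ≤ 2 * (T - 1))
      have h3 := mul_le_mul_of_nonneg_left h2 he0.le
      rw [← heT]
      linarith
  · -- many changes
    obtain ⟨x, hx⟩ : ∃ x, x = V / e := ⟨_, rfl⟩
    have hxe : x * e = V := by rw [hx]; field_simp
    have hx0 : 0 < x := by rw [hx]; positivity
    have hx3 : x ^ 3 * m = V ^ 2 * T := by
      have h2 : x ^ 3 * (e ^ 3 * T) = V ^ 3 * T := by
        rw [← hxe]; ring
      rw [he3] at h2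
      have h3 : V * (x ^ 3 * m) = V * (V ^ 2 * T) := by linarith
      exact mul_left_cancel₀ hV.ne' h3
    have hx1 : 1 ≤ x := by
      by_contra h
      have h2 := pow_lt_one₀ hx0.le (not_le.1 h) (by norm_num : (3 : ℕ) ≠ 0)
      have h3 : x ^ 3 * m < 1 * m := mul_lt_mul_of_pos_right h2 hm0
      linarith
    -- Ensures `4 * n ≤ T`, hence blocks of length at least `4`.
    have hxT : x ≤ T / 100 := by
      refine le_of_pow_le_pow_left₀ (by norm_num : (3 : ℕ) ≠ 0) (by positivity) ?_
      refine le_of_mul_le_mul_right ?_ (by positivity : 0 < (m : ℝ) ^ 2)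
      have hm1 : x ^ 3 * m ^ 2 ≤ x ^ 3 * m ^ 3 := by
        have : (m : ℝ) ^ 2 ≤ m ^ 3 := pow_le_pow_right₀ (by linarith) (by norm_num)
        gcongr
      calc x ^ 3 * m ^ 2 ≤ x ^ 3 * m ^ 3 := hm1
        _ = (x ^ 3 * m) * m ^ 2 := by ring
        _ = (V * m) ^ 2 * T := by rw [hx3]; ring
        _ ≤ (1 / 1000 * T) ^ 2 * T := by gcongr
        _ = (T / 100) ^ 3 * 1 := by ring
        _ ≤ (T / 100) ^ 3 * (m : ℝ) ^ 2 := by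
            gcongr
            exact one_le_pow₀ (by linarith)
    -- With `n` between `6 * x` and `7 * x`, the gap `V / (2 * n - 1)` that makes the variation
    -- exactly `V` lies between `e / 14` and `e / 6`.
    obtain ⟨n, hn⟩ : ∃ n, n = ⌈6 * x⌉₊ := ⟨_, rfl⟩
    have hn6 : 6 * x ≤ n := by rw [hn]; exact Nat.le_ceil _
    have hn7 : (n : ℝ) ≤ 7 * x := by
      have := (Nat.ceil_lt_add_one (by positivity : 0 ≤ 6 * x)).le
      rw [← hn] at this
      linarith
    have hn1R : (1 : ℝ) ≤ n := by linarith
    have hn0R : (0 : ℝ) < n := by linarith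
    have hn1 : 1 ≤ n := by exact_mod_cast hn1R
    have hn4R : 4 * (n : ℝ) ≤ T := by linarith
    have hn4 : 4 * n ≤ T := by exact_mod_cast hn4R
    obtain ⟨L, hL⟩ : ∃ L, L = T / n := ⟨_, rfl⟩
    have hL4 : 4 ≤ L := by rw [hL]; exact (Nat.le_div_iff_mul_le hn1).2 hn4
    have hnL : n * L ≤ T := by rw [hL]; exact Nat.mul_div_le T n
    have hnLR : (n : ℝ) * L ≤ T := by exact_mod_cast hnL
    have hnL' : (T : ℝ) ≤ n * (L - 1 : ℕ) + 2 * n := by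
      have h2 : T < n * (L + 1) := by
        rw [hL]
        exact Nat.lt_mul_div_succ T hn1
      have h3 : n * (L + 1) = n * (L - 1) + 2 * n := by
        obtain ⟨l, rfl⟩ : ∃ l, L = l + 1 := ⟨L - 1, by omega⟩
        simp
        ring
      exact_mod_cast (by omega : T ≤ n * (L - 1) + 2 * n)
    obtain ⟨ε, hε⟩ : ∃ ε, ε = V / (2 * n - 1) := ⟨_, rfl⟩
    have h2n : (0 : ℝ) < 2 * n - 1 := by linarith
    have hεV : ε * (2 * n - 1) = V := by rw [hε]; field_simp
    have hε0 : 0 < ε := by rw [hε]; positivity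
    have hεu : ε ≤ e / 6 := by
      rw [hε, div_le_iff₀ h2n, ← hxe]
      have : e / 6 * (6 * x) ≤ e / 6 * (2 * n - 1) := by gcongr; linarith
      linarith
    have hεl : e / 14 ≤ ε := by
      rw [hε, le_div_iff₀ h2n, ← hxe]
      have : e / 14 * (2 * n - 1) ≤ e / 14 * (14 * x) := by gcongr; linarith
      linarith
    have hinfo : 192 * (ε ^ 2 * L) ≤ m := by
      have h2 : ε ^ 2 * L ≤ (e / 6) ^ 2 * L := by gcongr
      -- From `6 * x * L ≤ T` and `e ^ 2 * T = x * m` follows `6 * e ^ 2 * L ≤ m`, which is enough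
      -- because `192 / 36 ≤ 6`.
      have h3 : e ^ 2 * (6 * x * L) ≤ e ^ 2 * T := by
        have : 6 * x * L ≤ n * L := by gcongr
        gcongr
        linarith
      have h4 : e ^ 2 * T = x * m := by
        have h5 : e * (e ^ 2 * T) = e * (x * m) := by
          calc e * (e ^ 2 * T) = e ^ 3 * T := by ring
            _ = m * (x * e) := by rw [he3, hxe]
            _ = e * (x * m) := by ring
        exact mul_left_cancel₀ he0.ne' h5
      have h6 : x * (6 * (e ^ 2 * L)) ≤ x * m := by linarith
      have h7 := le_of_mul_le_mul_left h6 hx0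
      linarith
    obtain ⟨θ, hθ⟩ := exists_blockMean_regret (T := T) hm π hB hε0.le (by linarith) hnL hinfo
    have hp : ∀ t i, blockMean ε L n θ t i ∈ Set.Icc (0 : ℝ) 1 := by
      intro t i
      unfold blockMean
      split_ifs
      · have := raised_mem hε0.le (by linarith) (θ (t / L)) i
        exact ⟨by linarith [this.1], by linarith [this.2]⟩
      · constructor <;> norm_num
    refine ⟨_, ?_, bernoulliInstance_W₂, le_trans ?_ hθ⟩
    · rw [bernoulliInstance_V₁ hp, sum_norm_blockMean_sub hε0.le (by omega) hn1 hnL, hεV]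
    · have h2 : (T : ℝ) / 2 ≤ n * (L - 1 : ℕ) := by linarith
      have h3 : T / 2 * (e / 14) ≤ n * (L - 1 : ℕ) * ε := by gcongr
      rw [← heT]
      linarith

end BwK

end

theorem theorem2 :
    -- (i)
    (∃ c κ : ℝ, 0 < c ∧ 0 < κ ∧
      ∀ (m d T : ℕ) (b V : ℝ), 2 ≤ m → 1 ≤ d → 2 ≤ T → 0 < b →
        0 < V → V ≤ κ * T / m →
        ∀ π : BwK.Policy m d, ∃ I : BwK.Instance m d T,
          I.V₁ = V ∧ I.W₂ = 0 ∧
          c * ((m : ℝ) ^ (1 / 3 : ℝ) * V ^ (1 / 3 : ℝ) * (T : ℝ) ^ (2 / 3 : ℝ))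
            ≤ I.regret (b * T) π) ∧
    -- (ii)
    (∀ b₀ : ℝ, b₀ < 1 → ∃ c κ : ℝ, 0 < c ∧ 0 < κ ∧
      ∀ (m d T : ℕ) (b V : ℝ), 1 ≤ m → 1 ≤ d → 1 ≤ T → 0 < b → b ≤ b₀ →
        Real.sqrt (m / T) ≤ V → V ≤ κ * b ^ 3 * T / m →
        ∀ π : BwK.Policy m d, ∃ I : BwK.Instance m d T,
          I.V₂ = V ∧ I.W₁ = 0 ∧
          c * ((1 / b) * (m : ℝ) ^ (1 / 3 : ℝ) * V ^ (1 / 3 : ℝ) * (T : ℝ) ^ (2 / 3 : ℝ))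
            ≤ I.regret (b * T) π) ∧
    -- (iii)
    (∀ b₀ : ℝ, b₀ < 1 → ∃ c κ K : ℝ, 0 < c ∧ 0 < κ ∧ 0 < K ∧
      ∀ (m d T : ℕ) (b q w₁ w₂ : ℝ), 1 ≤ m → 1 ≤ d → 1 ≤ T → 0 < b → b ≤ b₀ →
        0 < q → q ≤ κ / b →
        0 ≤ w₁ → w₁ ≤ κ * (q * b) * T → 0 ≤ w₂ → w₂ ≤ κ * b * T →
        K * (q * b) ≤ w₁ + q * w₂ →
        ∃ Ibetter Iworse : BwK.Instance m d T,
          (Ibetter.IsTwoPhase ∧ Iworse.IsTwoPhase ∧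
            (∀ t : Fin T, t.val < T / 2 → Ibetter.law t = Iworse.law t) ∧
            Ibetter.SecondHalfBetter ∧ Iworse.SecondHalfWorse) ∧
          (∀ I ∈ ({Ibetter, Iworse} : Set (BwK.Instance m d T)),
            I.W₁ = w₁ ∧ I.W₂ = w₂ ∧ q ≤ I.qbar b ∧ I.qbar b ≤ 2 * q) ∧
          ∀ π : BwK.Policy m d, ∃ I ∈ ({Ibetter, Iworse} : Set (BwK.Instance m d T)),
            c * (I.W₁ + I.qbar b * I.W₂) ≤ I.regret (b * T) π) :=
  ⟨BwK.reward_variation_lower_bound, BwK.consumption_variation_lower_bound,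
    BwK.global_variation_lower_bound⟩
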